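/- **Setting.** All C\*-algebras are unital and nonzero, and $\mathbb N=\{0,1,2,\dots\}$. *Quantum compact metric spaces.* A $(2,0)$-quasi-Leibniz quantum compact metric space $(\mathfrak A,\mathsf L)$ is a C\*-algebra $\mathfrak A$ with a lower semicontinuous seminorm $\mathsf L$ defined on a dense Jordan–Lie subalgebra of the self-adjoint part $\mathfrak{sa}(\mathfrak A)$ (and extended by $\infty$) such that - $\mathsf L(a)=0$ if and only if $a\in\mathbb R1_{\mathfrak A}$; - $\max\{\mathsf L(\frac{ab+ba}{2}),\mathsf L(\frac{ab-ba}{2i})\}\le 2(\|a\|\mathsf L(b)+\|b\|\mathsf L(a))$ for all $a,b$ in the domain; - the Monge–Kantorovich metric $\mathsf{mk}_{\mathsf L}(\varphi,\psi)=\sup\{|\varphi(a)-\psi(a)|:\mathsf L(a)\le1\}$ metrizes the weak\* topology of the state space $\mathscr S(\mathfrak A)$. *Quantum propinquity.* A bridge $\gamma=(\mathfrak D,\pi_{\mathfrak A},\pi_{\mathfrak B},\omega)$ from $\mathfrak A$ to $\mathfrak B$ consists of a C\*-algebra $\mathfrak D$, unital \*-monomorphisms $\pi_{\mathfrak A}:\mathfrak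 A\to\mathfrak D$ and $\pi_{\mathfrak B}:\mathfrak B\to\mathfrak D$, and $\omega\in\mathfrak D$ for which $\mathscr S_1(\mathfrak D|\omega)=\{\varphi\in\mathscr S(\mathfrak D):\varphi(1-\omega^*\omega)=\varphi(1-\omega\omega^*)=0\}$ is nonempty. Its length is the maximum of - the Hausdorff distance, for $\mathsf{mk}_{\mathsf L_{\mathfrak A}}$, between $\mathscr S(\mathfrak A)$ and $\{\varphi\circ\pi_{\mathfrak A}:\varphi\in\mathscr S_1(\mathfrak D|\omega)\}$; - the same quantity for $\mathfrak B$; - the Hausdorff distance between $\{\mathsf L_{\mathfrak A}\le1\}$ and $\{\mathsf L_{\mathfrak B}\le1\}$ for the seminorm $(a,b)\mapsto\|\pi_{\mathfrak A}(a)\omega-\omega\pi_{\mathfrak B}(b)\|_{\mathfrak D}$ on $\mathfrak A\oplus\mathfrak B$. The quantum propinquity $\mathsf\Lambda$ is the largest pseudo-distance on the class of $(2,0)$-quasi-Leibniz quantum compact metric spaces that is bounded above by the length of every bridge between its arguments. *Lip-norms on AF algebras.* Let $\mathcal I=(\mathfrak A_n,\alpha_n)_{n\in\mathbb N}$ be an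 inductive sequence of finite dimensional C\*-algebras with unital injective connecting \*-morphisms and $\mathfrak A_0=\mathbb C$. Let $\mathfrak A=\varinjlim\mathcal I$, with canonical maps $\alpha^{(n)}:\mathfrak A_n\to\mathfrak A$, and let $\mu$ be a faithful tracial state of $\mathfrak A$. Let $\mathbb E_n$ be the unique $\mu$-preserving conditional expectation of $\mathfrak A$ onto $\alpha^{(n)}(\mathfrak A_n)$. For $\beta:\mathbb N\to(0,\infty)$ with limit $0$, and for $k>0$, set on $\mathfrak{sa}(\mathfrak A)$ $$\mathsf L^\beta_{\mathcal I,\mu}(a)=\sup_{n\in\mathbb N}\frac{\|a-\mathbb E_n(a)\|}{\beta(n)},\qquad \mathsf L^k_{\mathcal I,\mu}=\mathsf L^{\beta}_{\mathcal I,\mu}\ \text{ with }\ \beta(n)=\frac1{(\dim\mathfrak A_n)^{k}} .$$ *Classes.* $\mathcal{AF}^k$ is the class of the $(2,0)$-quasi-Leibniz quantum compact metric spaces $(\mathfrak A,\mathsf L^k_{\mathcal I,\mu})$ with $\mathcal I,\mu$ as above and $\mathfrak A=\varinjlim\mathcal I$ infinite dimensional. $\mathcal{UHF}^k$ is the class of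 those elements of $\mathcal{AF}^k$ that can be so written with $\mathcal I$ a sequence of full matrix algebras whose multiplicities $\sqrt{\dim\mathfrak A_{n+1}/\dim\mathfrak A_n}$ are all integers $\ge2$ (so that $\mathfrak A$ is a UHF algebra). For $L,U:\mathbb N\to\mathbb N\setminus\{0\}$, $\mathcal{AF}^k(L,U)$ is the class of those elements of $\mathcal{AF}^k$ that can be so written with some $\mathcal I$ (not necessarily of matrix algebras) such that $L(n)\le\dim\mathfrak A_n\le U(n)$ for all $n\in\mathbb N$. **Corollary.** For every real $k>0$ (in particular for every positive integer $k$) and every sequence $B:\mathbb N\to\mathbb N\setminus\{0\}$ with $\sqrt{B(n+1)/B(n)}\in\mathbb N\setminus\{0,1\}$ for all $n\in\mathbb N$, the class $$\mathcal{UHF}^k\cap\mathcal{AF}^k\big((2^n)_{n\in\mathbb N},B\big)$$ is compact for the quantum propinquity $\mathsf\Lambda$. -/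

import Mathlib

open Filter Topology
open scoped ENNReal NNReal ComplexStarModule ComplexOrder

noncomputable section

namespace QuantumMetric

/-! ### States and the Monge-Kantorovich metric -/

section States

variable (A : Type) [CStarAlgebra A]

/-- The state space of a unital C*-algebra, with the weak* topology of `WeakDual ℂ A`. -/
def stateSpace : Set (WeakDual ℂ A) :=
  {φ | φ 1 = 1 ∧ ∀ a : A, 0 ≤ φ (star a * a)}

variable {A}

/-- The Monge-Kantorovich distance of a `[0, ∞]`-valued function `L` on the self-adjoint part:
`sup {|φ(a) - ψ(a)| : L(a) ≤ 1}`. -/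
def mongeKantorovich (L : selfAdjoint A → ℝ≥0∞) (φ ψ : WeakDual ℂ A) : ℝ≥0∞ :=
  ⨆ (a : selfAdjoint A) (_ : L a ≤ 1), ENNReal.ofReal ‖φ (a : A) - ψ (a : A)‖

/-- The `1`-level set of an element `ω`. -/
def levelSet (ω : A) : Set (WeakDual ℂ A) :=
  {φ | φ ∈ stateSpace A ∧ φ (1 - star ω * ω) = 0 ∧ φ (1 - ω * star ω) = 0}

end States

/-! ### Quasi-Leibniz quantum compact metric spaces -/

/-- `(C, D)`-quasi-Leibniz quantum compact metric spaces. The seminorm is extended by `∞` outside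
of its domain, so the domain is `{a | L a < ∞}`; it is a real subspace by `map_add_le` and
`map_smul`, and a Jordan-Lie subalgebra by `quasiLeibniz`. For self-adjoint `a`, `b`, the elements
`ℜ (a * b)` and `ℑ (a * b)` are `(a b + b a) / 2` and `(a b - b a) / (2 i)`.

The algebras live in `Type`; this loses nothing, as an algebra with a Lip-norm is separable,
hence isomorphic to one in `Type`. -/
structure QQCMS (C D : ℝ≥0) where
  carrier : Type
  [cstar : CStarAlgebra carrier]
  [nontrivial : Nontrivial carrier]
  /-- the Lip-norm -/
  L : selfAdjoint carrier → ℝ≥0∞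
  map_add_le : ∀ a b, L (a + b) ≤ L a + L b
  map_smul : ∀ (r : ℝ) (a), L (r • a) = ENNReal.ofReal |r| * L a
  dense_dom : Dense {a | L a < ∞}
  eq_zero_iff : ∀ a, L a = 0 ↔ ∃ r : ℝ, a = r • (1 : selfAdjoint carrier)
  quasiLeibniz : ∀ a b, L a < ∞ → L b < ∞ →
    max (L (ℜ ((a : carrier) * b))) (L (ℑ ((a : carrier) * b))) ≤
      C * (ENNReal.ofReal ‖a‖ * L b + ENNReal.ofReal ‖b‖ * L a) + D * L a * L b
  /-- the Monge-Kantorovich metric takes finite values ... -/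
  mk_lt_top : ∀ φ ∈ stateSpace carrier, ∀ ψ ∈ stateSpace carrier, mongeKantorovich L φ ψ < ∞
  /-- ... and its balls are a neighbourhood basis for the weak* topology at every state -/
  mk_metrizes : ∀ φ : stateSpace carrier,
    (𝓝 φ).HasBasis (fun ε : ℝ≥0∞ => 0 < ε)
      (fun ε => {ψ : stateSpace carrier | mongeKantorovich L φ ψ < ε})
  lowerSemicontinuous : LowerSemicontinuous L

attribute [instance] QQCMS.cstar QQCMS.nontrivial

/-! ### Bridges and the quantum propinquity -/

/-- Bridges between two unital C*-algebras. -/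
structure Bridge (A B : Type) [CStarAlgebra A] [CStarAlgebra B] where
  carrier : Type
  [cstar : CStarAlgebra carrier]
  left : A →⋆ₐ[ℂ] carrier
  right : B →⋆ₐ[ℂ] carrier
  left_injective : Function.Injective left
  right_injective : Function.Injective right
  pivot : carrier
  levelSet_nonempty : (levelSet pivot).Nonempty

attribute [instance] Bridge.cstar

/-- The restriction of a functional along a unital *-morphism. -/
def pullback {A B : Type} [CStarAlgebra A] [CStarAlgebra B] (π : A →⋆ₐ[ℂ] B)
    (φ : WeakDual ℂ B) : WeakDual ℂ A :=
  StrongDual.toWeakDual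
    ((WeakDual.toStrongDual φ).comp
      (⟨π.toAlgHom.toLinearMap, AddMonoidHomClass.continuous_of_bound π 1 fun a => by
        simpa using NonUnitalStarAlgHom.norm_apply_le π a⟩ : A →L[ℂ] B))

/-- The Hausdorff distance between `S` and `T`, for a distance `d x y` of points of `S` to points
of `T`. -/
def hausdorff {X Y : Type} (d : X → Y → ℝ≥0∞) (S : Set X) (T : Set Y) : ℝ≥0∞ :=
  max (⨆ x ∈ S, ⨅ y ∈ T, d x y) (⨆ y ∈ T, ⨅ x ∈ S, d x y)

namespace Bridge

variable {A B : Type} [CStarAlgebra A] [CStarAlgebra B] (γ : Bridge A B)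

/-- The bridge seminorm. -/
def seminorm (a : A) (b : B) : ℝ≥0∞ :=
  ENNReal.ofReal ‖γ.left a * γ.pivot - γ.pivot * γ.right b‖

/-- The height of a bridge. -/
def height (LA : selfAdjoint A → ℝ≥0∞) (LB : selfAdjoint B → ℝ≥0∞) : ℝ≥0∞ :=
  max
    (hausdorff (mongeKantorovich LA) (stateSpace A) (pullback γ.left '' levelSet γ.pivot))
    (hausdorff (mongeKantorovich LB) (stateSpace B) (pullback γ.right '' levelSet γ.pivot))

/-- The reach of a bridge. For the bridge seminorm, `(a, 0)` and `(0, b)` are at distance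
`γ.seminorm a (-b)`; as the unit ball of `LB` is symmetric, the sign may be dropped. -/
def reach (LA : selfAdjoint A → ℝ≥0∞) (LB : selfAdjoint B → ℝ≥0∞) : ℝ≥0∞ :=
  hausdorff (fun (a : selfAdjoint A) (b : selfAdjoint B) => γ.seminorm a b)
    {a | LA a ≤ 1} {b | LB b ≤ 1}

/-- The length of a bridge. -/
def length (LA : selfAdjoint A → ℝ≥0∞) (LB : selfAdjoint B → ℝ≥0∞) : ℝ≥0∞ :=
  max (γ.height LA LB) (γ.reach LA LB)

end Bridge

variable {C D : ℝ≥0}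

/-- `Ξ` is a pseudo-distance on the class of `(C, D)`-quasi-Leibniz quantum compact metric spaces
which is bounded above by the length of any bridge between its arguments. -/
structure IsBridgeBounded (Ξ : QQCMS C D → QQCMS C D → ℝ≥0∞) : Prop where
  self : ∀ X, Ξ X X = 0
  symm : ∀ X Y, Ξ X Y = Ξ Y X
  triangle : ∀ X Y Z, Ξ X Z ≤ Ξ X Y + Ξ Y Z
  le_length : ∀ X Y (γ : Bridge X.carrier Y.carrier), Ξ X Y ≤ γ.length X.L Y.L

/-- The quantum propinquity: the largest pseudo-distance which is bounded above by the length of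
any bridge between its arguments. -/
def propinquity (X Y : QQCMS C D) : ℝ≥0∞ :=
  ⨆ (Ξ : QQCMS C D → QQCMS C D → ℝ≥0∞) (_ : IsBridgeBounded Ξ), Ξ X Y

/-- The quantum propinquity is itself such a pseudo-distance. -/
theorem isBridgeBounded_propinquity :
    IsBridgeBounded (propinquity : QQCMS C D → QQCMS C D → ℝ≥0∞) where
  self X := by
    exact le_antisymm (iSup₂_le fun Ξ h => (h.self X).le) zero_le
  symm X Y := by
    simp only [propinquity]
    exact iSup_congr fun Ξ => iSup_congr fun h => h.symm X Y
  triangle X Y Z := by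
    refine iSup₂_le fun Ξ h => (h.triangle X Y Z).trans (add_le_add ?_ ?_)
    · exact le_iSup₂ (f := fun (Ξ : QQCMS C D → QQCMS C D → ℝ≥0∞)
        (_ : IsBridgeBounded Ξ) => Ξ X Y) Ξ h
    · exact le_iSup₂ (f := fun (Ξ : QQCMS C D → QQCMS C D → ℝ≥0∞)
        (_ : IsBridgeBounded Ξ) => Ξ Y Z) Ξ h
  le_length X Y γ := iSup₂_le fun _ h => h.le_length X Y γ

/-- The class of `(C, D)`-quasi-Leibniz quantum compact metric spaces, with the topology of the
quantum propinquity. -/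
instance : PseudoEMetricSpace (QQCMS C D) where
  edist := propinquity
  edist_self := isBridgeBounded_propinquity.self
  edist_comm := isBridgeBounded_propinquity.symm
  edist_triangle := isBridgeBounded_propinquity.triangle

/-! ### Lip-norms on AF algebras -/

section LipNorm

variable {A : Type} [CStarAlgebra A]

/-- Faithful tracial states. -/
structure IsFaithfulTracialState (μ : WeakDual ℂ A) : Prop where
  mem : μ ∈ stateSpace A
  tracial : ∀ a b : A, μ (a * b) = μ (b * a)
  faithful : ∀ a : A, μ (star a * a) = 0 → a = 0

/-- Conditional expectations of `A` onto a *-subalgebra `S`. -/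
structure IsCondExp (S : StarSubalgebra ℂ A) (E : A →L[ℂ] A) : Prop where
  range_eq : Set.range E = S
  positive : ∀ a : A, ∃ b : A, E (star a * a) = star b * b
  norm_eq : ‖E‖ = 1
  bimodule : ∀ b ∈ S, ∀ c ∈ S, ∀ a : A, E (b * a * c) = b * E a * c

/-- The conditional expectation of `A` onto `S` which preserves `μ`. It exists and is unique when
`μ` is a faithful tracial state and `S` is finite dimensional. -/
def condExp (μ : WeakDual ℂ A) (S : StarSubalgebra ℂ A) : A →L[ℂ] A :=
  Classical.epsilon fun E => IsCondExp S E ∧ ∀ a, μ (E a) = μ a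

/-- The Lip-norm `a ↦ sup_n ‖a - E(a | S n)‖ / β n`. -/
def lipNorm (μ : WeakDual ℂ A) (S : ℕ → StarSubalgebra ℂ A) (β : ℕ → ℝ) (a : selfAdjoint A) :
    ℝ≥0∞ :=
  ⨆ n, ENNReal.ofReal (‖(a : A) - condExp μ (S n) a‖ / β n)

end LipNorm

/-- Inductive sequences of unital C*-algebras, with unital injective *-morphisms. -/
structure InductiveSequence where
  alg : ℕ → Type
  [cstar : ∀ n, CStarAlgebra (alg n)]
  map : ∀ n, alg n →⋆ₐ[ℂ] alg (n + 1)
  map_injective : ∀ n, Function.Injective (map n)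

attribute [instance] InductiveSequence.cstar

namespace InductiveSequence

variable (I : InductiveSequence)

/-- The dimension of the `n`-th algebra. -/
def dim (n : ℕ) : ℕ := Module.finrank ℂ (I.alg n)

/-- `A` is the C*-inductive limit of `I`, with canonical *-morphisms `ι n : I.alg n → A`
(which are injective, as the connecting maps are). -/
structure IsLimit (A : Type) [CStarAlgebra A] (ι : ∀ n, I.alg n →⋆ₐ[ℂ] A) : Prop where
  injective : ∀ n, Function.Injective (ι n)
  compatible : ∀ n a, ι (n + 1) (I.map n a) = ι n a
  dense : Dense (⋃ n, Set.range (ι n))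

/-- The multiplicity sequence. -/
def multiplicity (n : ℕ) : ℝ := √((I.dim (n + 1) : ℝ) / I.dim n)

/-- Inductive sequences of full matrix algebras, starting with `ℂ`, whose multiplicity sequence
consists of integers at least `2`. -/
structure IsStrictFull : Prop where
  full : ∀ n, ∃ d : ℕ, 0 < d ∧ Nonempty (I.alg n ≃⋆ₐ[ℂ] Matrix (Fin d) (Fin d) ℂ)
  zero : Nonempty (I.alg 0 ≃⋆ₐ[ℂ] ℂ)
  strict : ∀ n, ∃ m : ℕ, 2 ≤ m ∧ I.multiplicity n = m

end InductiveSequence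

/-- `X` is the limit of the inductive sequence `I` of finite dimensional C*-algebras which starts
with `ℂ`, with the Lip-norm constructed from `I`, the faithful tracial state `μ` and `β`. -/
structure IsAFSpace (X : QQCMS 2 0) (I : InductiveSequence) (ι : ∀ n, I.alg n →⋆ₐ[ℂ] X.carrier)
    (μ : WeakDual ℂ X.carrier) (β : ℕ → ℝ) : Prop where
  finiteDimensional : ∀ n, FiniteDimensional ℂ (I.alg n)
  zero : Nonempty (I.alg 0 ≃⋆ₐ[ℂ] ℂ)
  isLimit : I.IsLimit X.carrier ι
  trace : IsFaithfulTracialState μ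
  lip : ∀ a, X.L a = lipNorm μ (fun n => (ι n).range) β a

/-- `X = lim I` with the Lip-norm constructed from `I`, some faithful tracial state and the
sequence `1 / (dim A_n) ^ k`. -/
def IsAFkSpace (k : ℝ) (X : QQCMS 2 0) (I : InductiveSequence) : Prop :=
  ∃ ι μ, IsAFSpace X I ι μ fun n => 1 / (I.dim n : ℝ) ^ k

/-- The class `AF`. -/
def AF : Set (QQCMS 2 0) :=
  {X | ∃ I ι μ, ∃ β : ℕ → ℝ, (∀ n, 0 < β n) ∧ Tendsto β atTop (𝓝 0) ∧ IsAFSpace X I ι μ β}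

/-- The class `AF^k`. -/
def AFk (k : ℝ) : Set (QQCMS 2 0) :=
  {X | X ∈ AF ∧ ¬ FiniteDimensional ℂ X.carrier ∧ ∃ I, IsAFkSpace k X I}

/-- The class `AF^k(L, U)`. -/
def AFkBounded (k : ℝ) (L U : ℕ → ℕ) : Set (QQCMS 2 0) :=
  {X | X ∈ AFk k ∧ ∃ I, IsAFkSpace k X I ∧ ∀ n, L n ≤ I.dim n ∧ I.dim n ≤ U n}

/-- The class `UHF^k`: UHF algebras in `AF^k`, with the Lip-norms given by the inductive sequences
of full matrix algebras with multiplicities at least `2`. -/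
def UHFk (k : ℝ) : Set (QQCMS 2 0) :=
  {X | X ∈ AFk k ∧ ∃ I : InductiveSequence, I.IsStrictFull ∧ IsAFkSpace k X I}

end QuantumMetric

end

open Filter Topology
open scoped ENNReal NNReal ComplexStarModule ComplexOrder

noncomputable section

/-! A space in the class is governed by two sequences of integers, which range over a product of
finite sets and determine the space continuously.

Rigidity. Such a space has a strictly growing filtration by matrix algebras of sizes `q n`, and a
second filtration whose dimensions obey the bounds. Both define the same Lip-norm, and the trace is
unique. By `exists_reindexing` the Lip-norm determines the filtration up to repetitions, so the
second one is the first read along a map `σ` with `σ 0 = 0` and steps 0 or 1. Hence `2 ^ n ≤ q (σ n)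
^ 2 ≤ B n`: the pair `(q, σ)` is admissible. The lower bound makes `σ` unbounded, hence onto, and
together with the upper bound it bounds each `q j` by a number depending only on `B` and `j`; also
`σ n ≤ n`.

Continuity. If two such spaces have the same sizes up to `N`, their `N`-th stages are isomorphic
compatibly with the filtrations, because representations of a full matrix algebra are unitarily
determined by their dimension. Uniqueness of the normalized trace then identifies the conditional
expectations and the Lip-norms on these stages. Each space is joined to the common stage by a bridge
with pivot `1` and length at most `β N`, whence `propinquity_le_of_agree`: the distance is at most
`2 β N`.

Realization. Every sequence of sizes comes from an actual space (`exists_isAFSpace_of_sizes`): the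
limit algebra is built in the GNS representation of an ultralimit of the matrix traces, and its
Lip-norm metrizes the weak* topology because finite dimensional stages approximate the Lip ball
uniformly.

Compactness follows: a sequence of admissible pairs has a pointwise convergent subsequence with
admissible limit. The limit is realized by a space of the class, and pointwise convergence of
integers is agreement up to any given `N`. -/

namespace QuantumMetric

/-! ### States are hermitian and contractive. -/

section StateLemmas

variable {A : Type} [CStarAlgebra A] {φ : WeakDual ℂ A}

/-- A state as a positive linear map, for the spectral order. -/
def stateToPositive (hφ : φ ∈ stateSpace A) :
    letI := CStarAlgebra.spectralOrder A
    A →ₚ[ℂ] ℂ :=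
  letI := CStarAlgebra.spectralOrder A
  haveI := CStarAlgebra.spectralOrderedRing A
  PositiveLinearMap.mk₀ (WeakDual.toStrongDual φ).toLinearMap fun x hx => by
    obtain ⟨y, rfl⟩ := CStarAlgebra.nonneg_iff_eq_star_mul_self.mp hx
    exact hφ.2 y

theorem state_map_star (hφ : φ ∈ stateSpace A) (a : A) : φ (star a) = star (φ a) := by
  let _ := CStarAlgebra.spectralOrder A
  have _ := CStarAlgebra.spectralOrderedRing A
  exact map_star (stateToPositive hφ) a

theorem state_norm_apply_le (hφ : φ ∈ stateSpace A) (a : A) : ‖φ a‖ ≤ ‖a‖ := by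
  let _ := CStarAlgebra.spectralOrder A
  have _ := CStarAlgebra.spectralOrderedRing A
  -- Rotating `a` by a phase makes its value real and nonnegative, which reduces the bound to the
  -- self-adjoint element `ℜ b`.
  obtain ⟨c, hc, hca⟩ : ∃ c : ℂ, ‖c‖ = 1 ∧ φ (c • a) = ‖φ a‖ := by
    by_cases h : φ a = 0
    · exact ⟨1, by simp, by simp [h]⟩
    · refine ⟨‖φ a‖ / φ a, by simp [h], ?_⟩
      rw [map_smul, smul_eq_mul]; field_simp
  set b := c • a
  have hb : ‖b‖ = ‖a‖ := by simp [b, norm_smul, hc]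
  have h1 : φ (ℜ b : A) = ‖φ a‖ := by
    rw [realPart_apply_coe]
    rw [← Complex.coe_smul, map_smul, map_add, state_map_star hφ, hca]
    simp
    ring
  have h2 := (stateToPositive hφ).apply_le_of_isSelfAdjoint (ℜ b : A) (ℜ b).2
  have h3 : (stateToPositive hφ) (algebraMap ℝ A ‖(ℜ b : A)‖) = ‖(ℜ b : A)‖ := by
    rw [IsScalarTower.algebraMap_apply ℝ ℂ A, Algebra.algebraMap_eq_smul_one, map_smul]
    have : (stateToPositive hφ) 1 = 1 := hφ.1
    simp [this]
  rw [h3] at h2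
  have h4 : ((‖φ a‖ : ℝ) : ℂ) ≤ ‖(ℜ b : A)‖ := h1 ▸ h2
  have h5 : ‖φ a‖ ≤ ‖(ℜ b : A)‖ := by exact_mod_cast h4
  calc _ ≤ _ := h5
    _ ≤ ‖b‖ := realPart.norm_le b
    _ = _ := hb

end StateLemmas

/-! ### Trace-preserving conditional expectations onto finite dimensional subalgebras. -/

section CondExp

variable {A : Type} [CStarAlgebra A] {μ : WeakDual ℂ A}

theorem IsFaithfulTracialState.nontrivial (hμ : IsFaithfulTracialState μ) : Nontrivial A := by
  refine ⟨0, 1, fun h => ?_⟩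
  have := hμ.mem.1
  rw [← h, map_zero] at this
  exact zero_ne_one this

/-- The pairing `x ↦ μ (x ·)` of `A` with a subalgebra. -/
def tracePairing (μ : WeakDual ℂ A) (S : StarSubalgebra ℂ A) : A →ₗ[ℂ] Module.Dual ℂ S where
  toFun a :=
    { toFun := fun s => μ (a * s)
      map_add' := fun s t => by simp [mul_add]
      map_smul' := fun c s => by simp }
  map_add' a b := by ext s; simp [add_mul]
  map_smul' c a := by ext s; simp

/-- The trace form is nondegenerate on `S`: test against `star (x - y)` and use faithfulness. -/
theorem IsFaithfulTracialState.eq_of_forall_mul_eq (hμ : IsFaithfulTracialState μ)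
    {S : StarSubalgebra ℂ A} {x y : A} (hx : x ∈ S) (hy : y ∈ S)
    (h : ∀ s ∈ S, μ (x * s) = μ (y * s)) : x = y := by
  rw [← sub_eq_zero]
  apply hμ.faithful
  rw [hμ.tracial, sub_mul, map_sub, h _ (star_mem (sub_mem hx hy)), sub_self]

/-- The trace form embeds `S` into its dual, hence is onto by dimension; `E a` represents the
functional `μ (a ·)` on `S`. This is the orthogonal projection for the inner product of `μ`. -/
theorem IsFaithfulTracialState.exists_trace_eq (hμ : IsFaithfulTracialState μ)
    (S : StarSubalgebra ℂ A) [FiniteDimensional ℂ S] :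
    ∃ E : A →ₗ[ℂ] A, ∀ a, E a ∈ S ∧ ∀ s ∈ S, μ (E a * s) = μ (a * s) := by
  set f : S →ₗ[ℂ] Module.Dual ℂ S := (tracePairing μ S).comp S.toSubalgebra.toSubmodule.subtype
  have hf : Function.Injective f := by
    rw [injective_iff_map_eq_zero]
    intro x hx
    have : (x : A) = 0 := hμ.eq_of_forall_mul_eq x.2 S.zero_mem fun s hs => by
      have := congrArg (fun g : Module.Dual ℂ S => g ⟨s, hs⟩) hx
      rw [zero_mul, map_zero]
      exact this
    exact Subtype.ext this
  have hfin : Module.finrank ℂ S = Module.finrank ℂ (Module.Dual ℂ S) :=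
    Subspace.dual_finrank_eq.symm
  set e := LinearEquiv.ofInjectiveOfFinrankEq f hf hfin with he
  refine ⟨S.toSubalgebra.toSubmodule.subtype ∘ₗ e.symm.toLinearMap ∘ₗ tracePairing μ S,
    fun a => ⟨(e.symm (tracePairing μ S a)).2, fun s hs => ?_⟩⟩
  have := congrArg (fun g : Module.Dual ℂ S => g ⟨s, hs⟩)
    (e.apply_symm_apply (tracePairing μ S a))
  exact this

/-- A self-adjoint element of a finite dimensional subalgebra is positive if it is so in the
weak sense given by a faithful tracial state. -/
theorem IsFaithfulTracialState.nonneg_of_forall (hμ : IsFaithfulTracialState μ)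
    (S : StarSubalgebra ℂ A) [FiniteDimensional ℂ S] {x : A} (hx : x ∈ S) (hxs : IsSelfAdjoint x)
    (h : ∀ s ∈ S, 0 ≤ μ (star s * x * s)) : ∃ c ∈ S, x = star c * c := by
  -- Closedness makes `S` a C*-algebra, so negative parts and square roots can be taken inside `S`.
  have hcl : IsClosed (S : Set A) := S.toSubalgebra.toSubmodule.closed_of_finiteDimensional
  let _ := CStarAlgebra.spectralOrder S
  have _ := CStarAlgebra.spectralOrderedRing S
  set y : S := ⟨x, hx⟩
  have hy : IsSelfAdjoint y := Subtype.ext hxs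
  have hneg : y⁻ = 0 := by
    have h0 : 0 ≤ y⁻ := CFC.negPart_nonneg y
    have hs : star y⁻ = y⁻ := (IsSelfAdjoint.of_nonneg h0).star_eq
    have h1 : y⁻ * y * y⁻ = - (y⁻ * y⁻ * y⁻) := by
      have : y⁻ * y = -(y⁻ * y⁻) := by
        conv_lhs => arg 2; rw [← CFC.posPart_sub_negPart y hy]
        rw [mul_sub, CFC.negPart_mul_posPart, zero_sub]
      rw [this, neg_mul]
    obtain ⟨r, hr⟩ := CStarAlgebra.nonneg_iff_eq_star_mul_self.mp h0
    have h2 : y⁻ * y⁻ * y⁻ = star (r * y⁻) * (r * y⁻) := by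
      rw [star_mul, hs]
      conv_lhs => rw [mul_assoc, hr]
      conv_rhs => rw [hr]
      simp only [mul_assoc]
    -- Testing with the negative part gives `-(y⁻)³`, minus a square; its trace has both signs, so
    -- it vanishes and faithfulness applies.
    have h3 := h (y⁻ : S) (y⁻).2
    have h4 : star ((y⁻ : S) : A) * x * (y⁻ : S) =
        -(star ((r * y⁻ : S) : A) * ((r * y⁻ : S) : A)) := by
      have := congrArg (Subtype.val : S → A) h1
      rw [h2] at this
      rw [← StarMemClass.coe_star, hs]
      exact this
    rw [h4, map_neg] at h3
    have h5 := hμ.mem.2 ((r * y⁻ : S) : A)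
    have h6 := hμ.faithful _ (le_antisymm (by simpa using h3) h5)
    have h7 : r * y⁻ = 0 := Subtype.ext h6
    have h9 : star (star y⁻ * y⁻) * (star y⁻ * y⁻) = 0 := by
      have : y⁻ * y⁻ = 0 := by
        conv_lhs => arg 1; rw [hr]
        rw [mul_assoc, h7, mul_zero]
      rw [hs, this, mul_zero]
    exact CStarRing.star_mul_self_eq_zero_iff _ |>.mp
      (CStarRing.star_mul_self_eq_zero_iff _ |>.mp h9)
  have hpos : 0 ≤ y := (CFC.negPart_eq_zero_iff y hy).mp hneg
  obtain ⟨c, hc⟩ := CStarAlgebra.nonneg_iff_eq_star_mul_self.mp hpos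
  exact ⟨c, c.2, congrArg (Subtype.val : S → A) hc⟩

/-- The relation `0 ≤ b ≤ a` is encoded by explicit squares, which keeps order instances out of the
statement. -/
theorem norm_star_mul_self_le_of_sub_eq {a b c : A} (h : a - b = star c * c)
    {d : A} (hb : b = star d * d) : ‖b‖ ≤ ‖a‖ := by
  let _ := CStarAlgebra.spectralOrder A
  have _ := CStarAlgebra.spectralOrderedRing A
  refine CStarAlgebra.norm_le_norm_of_nonneg_of_le (hb ▸ star_mul_self_nonneg d) ?_
  rw [← sub_nonneg, h]
  exact star_mul_self_nonneg c

/-- Bimodularity, star-invariance and positivity are read off from the trace form. Contractivity is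
the Kadison–Schwarz argument: `E (a* a) - E a* E a` is the image of a square, so `‖E a‖² ≤ ‖E (a*
a)‖ ≤ ‖a‖²`, the last step because `E` is positive and unital. -/
theorem IsFaithfulTracialState.exists_condExp (hμ : IsFaithfulTracialState μ)
    (S : StarSubalgebra ℂ A) [FiniteDimensional ℂ S] :
    ∃ E : A →L[ℂ] A, IsCondExp S E ∧ ∀ a, μ (E a) = μ a := by
  have := hμ.nontrivial
  obtain ⟨E, hE⟩ := hμ.exists_trace_eq S
  have hmem a : E a ∈ S := (hE a).1
  have htr a s (hs : s ∈ S) : μ (E a * s) = μ (a * s) := (hE a).2 s hs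
  have hbim b (hb : b ∈ S) c (hc : c ∈ S) a : E (b * a * c) = b * E a * c := by
    refine hμ.eq_of_forall_mul_eq (hmem _) (mul_mem (mul_mem hb (hmem a)) hc) fun s hs => ?_
    rw [htr _ _ hs, mul_assoc, mul_assoc, hμ.tracial, mul_assoc b, mul_assoc b, hμ.tracial b]
    rw [mul_assoc, mul_assoc, mul_assoc, mul_assoc, ← htr _ _ (mul_mem hc (mul_mem hs hb))]
  have hid b (hb : b ∈ S) : E b = b :=
    hμ.eq_of_forall_mul_eq (hmem _) hb fun s hs => htr _ _ hs
  have hstar a : E (star a) = star (E a) := by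
    refine hμ.eq_of_forall_mul_eq (hmem _) (star_mem (hmem a)) fun s hs => ?_
    rw [htr _ _ hs]
    have h1 : star a * s = star (star s * a) := by simp
    have h2 : star (E a) * s = star (star s * E a) := by simp
    rw [h1, h2, state_map_star hμ.mem, state_map_star hμ.mem, hμ.tracial, hμ.tracial _ (E a),
      htr _ _ (star_mem hs)]
  have hpos a : ∃ c ∈ S, E (star a * a) = star c * c := by
    refine hμ.nonneg_of_forall S (hmem _) ?_ fun s hs => ?_
    · rw [IsSelfAdjoint, ← hstar]; simp
    · rw [hμ.tracial, ← mul_assoc, hμ.tracial, htr _ _ (mul_mem hs (star_mem hs)), hμ.tracial]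
      have := hμ.mem.2 (a * s)
      rw [star_mul] at this
      convert this using 1
      rw [mul_assoc s, hμ.tracial]
      simp only [mul_assoc]
  have hnorm a : ‖E a‖ ≤ 1 * ‖a‖ := by
    obtain ⟨c, -, hc⟩ := hpos (a - E a)
    have h1 : E (star a * a) - star (E a) * E a = star c * c := by
      rw [← hc]
      have e1 : E (star a * E a) = star (E a) * E a := by
        simpa [hstar] using hbim 1 (one_mem S) (E a) (hmem a) (star a)
      have e2 : E (star (E a) * a) = star (E a) * E a := by
        simpa using hbim (star (E a)) (star_mem (hmem a)) 1 (one_mem S) a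
      rw [star_sub, sub_mul, mul_sub, mul_sub, map_sub, map_sub, map_sub, e1, e2,
        hid _ (mul_mem (star_mem (hmem a)) (hmem a))]
      abel
    have h2 := norm_star_mul_self_le_of_sub_eq h1 rfl
    have h3 : ‖E (star a * a)‖ ≤ ‖a‖ ^ 2 := by
      let _ := CStarAlgebra.spectralOrder A
      have _ := CStarAlgebra.spectralOrderedRing A
      obtain ⟨d, hd⟩ : ∃ d, algebraMap ℝ A (‖a‖ ^ 2) - star a * a = star d * d := by
        rw [← CStarAlgebra.nonneg_iff_eq_star_mul_self, sub_nonneg, sq,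
          ← CStarRing.norm_star_mul_self (x := a)]
        exact IsSelfAdjoint.le_algebraMap_norm_self (.star_mul_self a)
      obtain ⟨e, -, he⟩ := hpos d
      rw [← hd, map_sub, hid _ (by
        rw [IsScalarTower.algebraMap_apply ℝ ℂ A]; exact S.algebraMap_mem _)] at he
      obtain ⟨g, -, hg⟩ := hpos a
      have := norm_star_mul_self_le_of_sub_eq he hg
      refine this.trans ?_
      rw [norm_algebraMap']
      simp
    rw [CStarRing.norm_star_mul_self] at h2
    rw [one_mul]
    exact abs_le_of_sq_le_sq' (by nlinarith) (norm_nonneg _) |>.2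
  refine ⟨E.mkContinuous 1 hnorm, ⟨?_, ?_, ?_, ?_⟩, ?_⟩
  · ext x
    exact ⟨fun ⟨a, ha⟩ => ha ▸ hmem a, fun hx => ⟨x, hid x hx⟩⟩
  · exact fun a => (hpos a).imp fun _ h => h.2
  · refine le_antisymm (LinearMap.mkContinuous_norm_le _ zero_le_one _) ?_
    have := (E.mkContinuous 1 hnorm).le_opNorm 1
    have h1 : (E.mkContinuous 1 hnorm) 1 = 1 := hid 1 (one_mem S)
    rw [h1, norm_one, mul_one] at this
    exact this
  · exact fun b hb c hc a => hbim b hb c hc a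
  · intro a
    simpa using htr a 1 (one_mem S)

section Properties

theorem isCondExp_condExp (hμ : IsFaithfulTracialState μ) (S : StarSubalgebra ℂ A)
    [FiniteDimensional ℂ S] : IsCondExp S (condExp μ S) :=
  (Classical.epsilon_spec (hμ.exists_condExp S)).1

theorem trace_condExp (hμ : IsFaithfulTracialState μ) (S : StarSubalgebra ℂ A)
    [FiniteDimensional ℂ S] (a : A) : μ (condExp μ S a) = μ a :=
  (Classical.epsilon_spec (hμ.exists_condExp S)).2 a

theorem condExp_mem (hμ : IsFaithfulTracialState μ) (S : StarSubalgebra ℂ A)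
    [FiniteDimensional ℂ S] (a : A) : condExp μ S a ∈ S := by
  have : condExp μ S a ∈ (S : Set A) :=
    (isCondExp_condExp hμ S).range_eq ▸ Set.mem_range_self a
  exact this

theorem condExp_mul_right (hμ : IsFaithfulTracialState μ) (S : StarSubalgebra ℂ A)
    [FiniteDimensional ℂ S] (a : A) {s : A} (hs : s ∈ S) :
    condExp μ S (a * s) = condExp μ S a * s := by
  simpa using (isCondExp_condExp hμ S).bimodule 1 (one_mem S) s hs a

theorem trace_condExp_mul (hμ : IsFaithfulTracialState μ) (S : StarSubalgebra ℂ A)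
    [FiniteDimensional ℂ S] (a : A) {s : A} (hs : s ∈ S) :
    μ (condExp μ S a * s) = μ (a * s) := by
  rw [← condExp_mul_right hμ S a hs, trace_condExp hμ]

/-- This uniqueness criterion replaces the arbitrary choice in `condExp`: values of the expectation
are identified by testing against `μ`. -/
theorem condExp_eq_of_forall (hμ : IsFaithfulTracialState μ) (S : StarSubalgebra ℂ A)
    [FiniteDimensional ℂ S] {a y : A} (hy : y ∈ S) (h : ∀ s ∈ S, μ (y * s) = μ (a * s)) :
    condExp μ S a = y :=
  hμ.eq_of_forall_mul_eq (condExp_mem hμ S a) hy fun s hs => by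
    rw [trace_condExp_mul hμ S a hs, h s hs]

theorem condExp_of_mem (hμ : IsFaithfulTracialState μ) (S : StarSubalgebra ℂ A)
    [FiniteDimensional ℂ S] {a : A} (ha : a ∈ S) : condExp μ S a = a :=
  condExp_eq_of_forall hμ S ha fun _ _ => rfl

theorem condExp_star (hμ : IsFaithfulTracialState μ) (S : StarSubalgebra ℂ A)
    [FiniteDimensional ℂ S] (a : A) : condExp μ S (star a) = star (condExp μ S a) := by
  refine condExp_eq_of_forall hμ S (star_mem (condExp_mem hμ S a)) fun s hs => ?_
  have h1 : star a * s = star (star s * a) := by simp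
  have h2 : star (condExp μ S a) * s = star (star s * condExp μ S a) := by simp
  rw [h1, h2, state_map_star hμ.mem, state_map_star hμ.mem, hμ.tracial, hμ.tracial _ a,
    trace_condExp_mul hμ S a (star_mem hs)]

theorem isSelfAdjoint_condExp (hμ : IsFaithfulTracialState μ) (S : StarSubalgebra ℂ A)
    [FiniteDimensional ℂ S] {a : A} (ha : IsSelfAdjoint a) : IsSelfAdjoint (condExp μ S a) := by
  rw [IsSelfAdjoint, ← condExp_star hμ, ha.star_eq]

theorem norm_condExp_le (hμ : IsFaithfulTracialState μ) (S : StarSubalgebra ℂ A)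
    [FiniteDimensional ℂ S] (a : A) : ‖condExp μ S a‖ ≤ ‖a‖ := by
  simpa [(isCondExp_condExp hμ S).norm_eq] using (condExp μ S).le_opNorm a

theorem condExp_condExp_of_le (hμ : IsFaithfulTracialState μ) {S T : StarSubalgebra ℂ A}
    [FiniteDimensional ℂ S] [FiniteDimensional ℂ T] (h : S ≤ T) (a : A) :
    condExp μ S (condExp μ T a) = condExp μ S a := by
  refine condExp_eq_of_forall hμ S (condExp_mem hμ S a) fun s hs => ?_
  rw [trace_condExp_mul hμ S a hs, trace_condExp_mul hμ T a (h hs)]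

theorem condExp_condExp_of_ge (hμ : IsFaithfulTracialState μ) {S T : StarSubalgebra ℂ A}
    [FiniteDimensional ℂ S] [FiniteDimensional ℂ T] (h : S ≤ T) (a : A) :
    condExp μ T (condExp μ S a) = condExp μ S a :=
  condExp_of_mem hμ T (h (condExp_mem hμ S a))

/-- `IsCondExp.positive` only provides a root in `A`; carrying positivity over to an abstract copy
of `S` requires a root in `S`. -/
theorem exists_mem_condExp_star_mul_self (hμ : IsFaithfulTracialState μ)
    (S : StarSubalgebra ℂ A) [FiniteDimensional ℂ S] (a : A) :
    ∃ c ∈ S, condExp μ S (star a * a) = star c * c := by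
  refine hμ.nonneg_of_forall S (condExp_mem hμ S _)
    (isSelfAdjoint_condExp hμ S (.star_mul_self a)) fun s hs => ?_
  rw [hμ.tracial, ← mul_assoc, hμ.tracial, trace_condExp_mul hμ _ _ (mul_mem hs (star_mem hs)),
    hμ.tracial]
  have := hμ.mem.2 (a * s)
  rw [star_mul] at this
  convert this using 1
  rw [mul_assoc s, hμ.tracial]
  simp only [mul_assoc]

end Properties

/-- The restriction of the conditional expectation to self-adjoint elements. -/
def condExpSA (hμ : IsFaithfulTracialState μ) (S : StarSubalgebra ℂ A)
    [FiniteDimensional ℂ S] (a : selfAdjoint A) : selfAdjoint A :=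
  ⟨condExp μ S a, isSelfAdjoint_condExp hμ S a.2⟩

end CondExp

/-! ### The Lip-norm of a filtration: seminorm, Leibniz and density properties. -/

section LipSup

variable {A : Type} [CStarAlgebra A] {μ : WeakDual ℂ A} {S : ℕ → StarSubalgebra ℂ A}
  {β : ℕ → ℝ}

/-- The part of the Lip-norm given by a set of indices. -/
def lipSup (μ : WeakDual ℂ A) (S : ℕ → StarSubalgebra ℂ A) (β : ℕ → ℝ) (J : Set ℕ)
    (a : selfAdjoint A) : ℝ≥0∞ :=
  ⨆ n ∈ J, ENNReal.ofReal (‖(a : A) - condExp μ (S n) a‖ / β n)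

theorem norm_sub_condExp_le_of_lipNorm_le (hβ : ∀ n, 0 < β n) {a : selfAdjoint A}
    (ha : lipNorm μ S β a ≤ 1) (n : ℕ) : ‖(a : A) - condExp μ (S n) a‖ ≤ β n := by
  have h := (le_iSup (fun n => ENNReal.ofReal (‖(a : A) - condExp μ (S n) a‖ / β n)) n).trans ha
  rwa [ENNReal.ofReal_le_one, div_le_one (hβ n)] at h

theorem lipNorm_eq_lipSup_univ (a : selfAdjoint A) :
    lipNorm μ S β a = lipSup μ S β Set.univ a := by
  simp [lipNorm, lipSup]

theorem le_lipSup {J : Set ℕ} {n : ℕ} (hn : n ∈ J) (a : selfAdjoint A) :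
    ENNReal.ofReal (‖(a : A) - condExp μ (S n) a‖ / β n) ≤ lipSup μ S β J a :=
  le_iSup₂ (f := fun n (_ : n ∈ J) =>
    ENNReal.ofReal (‖(a : A) - condExp μ (S n) a‖ / β n)) n hn

theorem lipSup_le {J : Set ℕ} {a : selfAdjoint A} {c : ℝ≥0∞}
    (h : ∀ n ∈ J, ENNReal.ofReal (‖(a : A) - condExp μ (S n) a‖ / β n) ≤ c) :
    lipSup μ S β J a ≤ c :=
  iSup₂_le h

theorem lipSup_union (J K : Set ℕ) (a : selfAdjoint A) :
    lipSup μ S β (J ∪ K) a = max (lipSup μ S β J a) (lipSup μ S β K a) :=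
  iSup_union

theorem lipSup_add_le (hβ : ∀ n, 0 < β n) (J : Set ℕ) (a b : selfAdjoint A) :
    lipSup μ S β J (a + b) ≤ lipSup μ S β J a + lipSup μ S β J b := by
  refine lipSup_le fun n hn => le_trans ?_ (add_le_add (le_lipSup hn a) (le_lipSup hn b))
  rw [← ENNReal.ofReal_add (div_nonneg (norm_nonneg _) (hβ n).le)
    (div_nonneg (norm_nonneg _) (hβ n).le), ← add_div]
  refine ENNReal.ofReal_le_ofReal (div_le_div_of_nonneg_right ?_ (hβ n).le)
  refine le_trans (le_of_eq ?_) (norm_add_le _ _)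
  rw [AddSubgroup.coe_add, map_add]
  congr 1
  abel

theorem lipSup_smul (J : Set ℕ) (r : ℝ) (a : selfAdjoint A) :
    lipSup μ S β J (r • a) = ENNReal.ofReal |r| * lipSup μ S β J a := by
  simp only [lipSup, ENNReal.mul_iSup]
  refine iSup_congr fun n => iSup_congr fun _ => ?_
  rw [← ENNReal.ofReal_mul (abs_nonneg r)]
  congr 1
  rw [selfAdjoint.val_smul, ← Complex.coe_smul, map_smul, ← smul_sub, norm_smul,
    Complex.norm_real, Real.norm_eq_abs, mul_div_assoc]

theorem lipNorm_lowerSemicontinuous : LowerSemicontinuous (lipNorm μ S β) := by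
  refine lowerSemicontinuous_iSup fun n => Continuous.lowerSemicontinuous ?_
  exact ENNReal.continuous_ofReal.comp (by fun_prop)

theorem mem_bot_of_isSelfAdjoint [Nontrivial A] {a : selfAdjoint A}
    (ha : (a : A) ∈ (⊥ : StarSubalgebra ℂ A)) : ∃ r : ℝ, a = r • (1 : selfAdjoint A) := by
  obtain ⟨c, hc⟩ := StarSubalgebra.mem_bot.mp ha
  have h := a.2.star_eq
  rw [← hc, Algebra.algebraMap_eq_smul_one, star_smul, star_one] at h
  have hcc : star c = c := smul_left_injective ℂ (one_ne_zero (α := A)) h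
  refine ⟨c.re, Subtype.ext ?_⟩
  rw [selfAdjoint.val_smul, selfAdjoint.val_one, ← hc, Algebra.algebraMap_eq_smul_one,
    ← Complex.coe_smul, Complex.conj_eq_iff_re.mp hcc]

theorem realPart_mem_of_mem {T : StarSubalgebra ℂ A} {x : A} (hx : x ∈ T) : (ℜ x : A) ∈ T := by
  rw [realPart_apply_coe, ← Complex.coe_smul]
  exact T.smul_mem (add_mem hx (star_mem hx)) _

variable [∀ n, FiniteDimensional ℂ (S n)]

theorem lipSup_eq_zero_of_mem (hμ : IsFaithfulTracialState μ) {J : Set ℕ} {a : selfAdjoint A}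
    (h : ∀ n ∈ J, (a : A) ∈ S n) : lipSup μ S β J a = 0 := by
  refine le_antisymm (lipSup_le fun n hn => ?_) zero_le
  simp [condExp_of_mem hμ (S n) (h n hn)]

theorem lipSup_lt_top (hμ : IsFaithfulTracialState μ) (hS : Monotone S) {J : Set ℕ}
    {a : selfAdjoint A} {N : ℕ} (h : (a : A) ∈ S N) : lipSup μ S β J a < ∞ := by
  calc lipSup μ S β J a ≤
      ∑ n ∈ Finset.range N, ENNReal.ofReal (‖(a : A) - condExp μ (S n) a‖ / β n) := by
        refine lipSup_le fun n _ => ?_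
        by_cases hn : n < N
        · exact Finset.single_le_sum
            (f := fun n => ENNReal.ofReal (‖(a : A) - condExp μ (S n) a‖ / β n))
            (fun _ _ => zero_le) (Finset.mem_range.mpr hn)
        · simp [condExp_of_mem hμ (S n) (hS (not_lt.mp hn) h)]
    _ < ∞ := ENNReal.sum_lt_top.mpr fun _ _ => ENNReal.ofReal_lt_top

/-- Expectations of a filtration commute, so for `n ≤ N` the `n`-th term is the norm of `E_N (a -
E_n a)`, while the terms with `n ≥ N` vanish. -/
theorem lipNorm_condExpSA_le (hμ : IsFaithfulTracialState μ) (hS : Monotone S)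
    (hβ : ∀ n, 0 < β n) (N : ℕ) (a : selfAdjoint A) :
    lipNorm μ S β (condExpSA hμ (S N) a) ≤ lipNorm μ S β a := by
  refine iSup_mono fun n => ENNReal.ofReal_le_ofReal (div_le_div_of_nonneg_right ?_ (hβ n).le)
  change ‖condExp μ (S N) a - condExp μ (S n) (condExp μ (S N) a)‖ ≤ _
  rcases le_total n N with h | h
  · rw [condExp_condExp_of_le hμ (hS h)]
    refine le_trans (le_of_eq ?_) (norm_condExp_le hμ (S N) _)
    rw [map_sub, condExp_condExp_of_ge hμ (hS h)]
  · rw [condExp_condExp_of_ge hμ (hS h), sub_self, norm_zero]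
    exact norm_nonneg _

/-- Write `b = (b - E b) + E b`. The first summand costs the factor 2 through `‖x - E x‖ ≤ 2 ‖x‖`;
on the second, `E` is right `T`-linear. -/
theorem norm_mul_sub_condExp_le (hμ : IsFaithfulTracialState μ) (T : StarSubalgebra ℂ A)
    [FiniteDimensional ℂ T] (a b : A) :
    ‖a * b - condExp μ T (a * b)‖ ≤
      2 * (‖a‖ * ‖b - condExp μ T b‖ + ‖b‖ * ‖a - condExp μ T a‖) := by
  have h : a * b - condExp μ T (a * b) = (a * (b - condExp μ T b)
      - condExp μ T (a * (b - condExp μ T b))) + (a - condExp μ T a) * condExp μ T b := by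
    rw [sub_mul, mul_sub, map_sub, condExp_mul_right hμ T a (condExp_mem hμ T b)]
    abel
  rw [h]
  have h1 : ‖a * (b - condExp μ T b)‖ ≤ ‖a‖ * ‖b - condExp μ T b‖ := norm_mul_le _ _
  have h2 := norm_condExp_le hμ T (a * (b - condExp μ T b))
  have h3 : ‖(a - condExp μ T a) * condExp μ T b‖ ≤ ‖a - condExp μ T a‖ * ‖b‖ :=
    (norm_mul_le _ _).trans (mul_le_mul_of_nonneg_left (norm_condExp_le hμ T b) (norm_nonneg _))
  have h4 := norm_sub_le (a * (b - condExp μ T b)) (condExp μ T (a * (b - condExp μ T b)))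
  have h5 := norm_add_le (a * (b - condExp μ T b) - condExp μ T (a * (b - condExp μ T b)))
    ((a - condExp μ T a) * condExp μ T b)
  have h6 : 0 ≤ ‖b‖ * ‖a - condExp μ T a‖ := by positivity
  linarith

theorem condExp_realPart (hμ : IsFaithfulTracialState μ) (T : StarSubalgebra ℂ A)
    [FiniteDimensional ℂ T] (x : A) : condExp μ T (ℜ x : A) = (ℜ (condExp μ T x) : A) := by
  rw [realPart_apply_coe, realPart_apply_coe, ← Complex.coe_smul, map_smul, map_add,
    condExp_star hμ, Complex.coe_smul]

theorem condExp_imaginaryPart (hμ : IsFaithfulTracialState μ) (T : StarSubalgebra ℂ A)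
    [FiniteDimensional ℂ T] (x : A) : condExp μ T (ℑ x : A) = (ℑ (condExp μ T x) : A) := by
  rw [imaginaryPart_apply_coe, imaginaryPart_apply_coe, map_smul, ← Complex.coe_smul, map_smul,
    map_sub, condExp_star hμ, Complex.coe_smul]

theorem lipNorm_quasiLeibniz (hμ : IsFaithfulTracialState μ) (hβ : ∀ n, 0 < β n)
    (a b : selfAdjoint A) :
    max (lipNorm μ S β (ℜ ((a : A) * b))) (lipNorm μ S β (ℑ ((a : A) * b))) ≤
      2 * (ENNReal.ofReal ‖a‖ * lipNorm μ S β b + ENNReal.ofReal ‖b‖ * lipNorm μ S β a) := by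
  have key (n : ℕ) (c : A) (hc : ‖c‖ ≤ ‖(a : A) * b - condExp μ (S n) ((a : A) * b)‖) :
      ENNReal.ofReal (‖c‖ / β n) ≤
      2 * (ENNReal.ofReal ‖a‖ * lipNorm μ S β b + ENNReal.ofReal ‖b‖ * lipNorm μ S β a) := by
    calc ENNReal.ofReal (‖c‖ / β n)
        ≤ ENNReal.ofReal (2 * (‖(a : A)‖ * (‖(b : A) - condExp μ (S n) b‖ / β n)
            + ‖(b : A)‖ * (‖(a : A) - condExp μ (S n) a‖ / β n))) := by
          refine ENNReal.ofReal_le_ofReal ?_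
          rw [div_le_iff₀ (hβ n)]
          refine hc.trans ((norm_mul_sub_condExp_le hμ (S n) a b).trans (le_of_eq ?_))
          have := (hβ n).ne'
          field_simp
      _ = 2 * (ENNReal.ofReal ‖a‖ * ENNReal.ofReal (‖(b : A) - condExp μ (S n) b‖ / β n)
            + ENNReal.ofReal ‖b‖ * ENNReal.ofReal (‖(a : A) - condExp μ (S n) a‖ / β n)) := by
          have h1 := div_nonneg (norm_nonneg ((b : A) - condExp μ (S n) b)) (hβ n).le
          have h2 := div_nonneg (norm_nonneg ((a : A) - condExp μ (S n) a)) (hβ n).le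
          rw [ENNReal.ofReal_mul zero_le_two, ENNReal.ofReal_add (by positivity) (by positivity),
            ENNReal.ofReal_mul (norm_nonneg _), ENNReal.ofReal_mul (norm_nonneg _)]
          simp
      _ ≤ _ := by
          gcongr
          · exact le_iSup (fun n => ENNReal.ofReal (‖(b : A) - condExp μ (S n) b‖ / β n)) n
          · exact le_iSup (fun n => ENNReal.ofReal (‖(a : A) - condExp μ (S n) a‖ / β n)) n
  refine max_le (iSup_le fun n => key n _ ?_) (iSup_le fun n => key n _ ?_)
  · rw [condExp_realPart hμ, ← AddSubgroup.coe_sub, ← map_sub]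
    exact realPart.norm_le (_ : A)
  · rw [condExp_imaginaryPart hμ, ← AddSubgroup.coe_sub, ← map_sub]
    exact imaginaryPart.norm_le (_ : A)

theorem lipNorm_eq_zero_iff (hμ : IsFaithfulTracialState μ) (hβ : ∀ n, 0 < β n)
    (h0 : S 0 = ⊥) (a : selfAdjoint A) :
    lipNorm μ S β a = 0 ↔ ∃ r : ℝ, a = r • (1 : selfAdjoint A) := by
  have := hμ.nontrivial
  constructor
  · intro h
    have h1 : ENNReal.ofReal (‖(a : A) - condExp μ (S 0) a‖ / β 0) ≤ 0 :=
      h ▸ le_iSup (fun n => ENNReal.ofReal (‖(a : A) - condExp μ (S n) a‖ / β n)) 0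
    rw [nonpos_iff_eq_zero, ENNReal.ofReal_eq_zero, div_le_iff₀ (hβ 0), zero_mul,
      norm_le_zero_iff, sub_eq_zero] at h1
    refine mem_bot_of_isSelfAdjoint ?_
    rw [h1, ← h0]
    exact condExp_mem hμ (S 0) _
  · rintro ⟨r, rfl⟩
    rw [lipNorm_eq_lipSup_univ, lipSup_smul, lipSup_eq_zero_of_mem hμ, mul_zero]
    exact fun n _ => one_mem (S n)

theorem dense_lipNorm_lt_top (hμ : IsFaithfulTracialState μ) (hS : Monotone S)
    (hd : Dense (⋃ n, (S n : Set A))) : Dense {a | lipNorm μ S β a < ∞} := by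
  rw [Metric.dense_iff]
  intro a r hr
  obtain ⟨x, hxr, hx⟩ := Metric.dense_iff.mp hd (a : A) r hr
  obtain ⟨n, hn⟩ := Set.mem_iUnion.mp hx
  refine ⟨ℜ x, ?_, ?_⟩
  · rw [Metric.mem_ball, dist_eq_norm] at hxr ⊢
    rw [show ℜ x - a = ℜ (x - (a : A)) by
      rw [map_sub, Subtype.ext_iff]
      simp]
    exact (realPart.norm_le _).trans_lt hxr
  · rw [Set.mem_ofPred_eq, lipNorm_eq_lipSup_univ]
    exact lipSup_lt_top hμ hS (realPart_mem_of_mem hn)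

end LipSup

/-! ### The Monge–Kantorovich metric and the weak* topology. -/

section MongeKantorovich

variable {A : Type} [CStarAlgebra A]

/-- On bounded sets of a finite dimensional space weak* convergence is uniform, since a basis
controls everything. -/
theorem eventually_forall_norm_sub_le (V : Submodule ℂ A) [FiniteDimensional ℂ V]
    (φ : WeakDual ℂ A) {R δ : ℝ} (hR : 0 ≤ R) (hδ : 0 < δ) :
    ∀ᶠ ψ in 𝓝 φ, ∀ x ∈ V, ‖x‖ ≤ R → ‖φ x - ψ x‖ ≤ δ := by
  set b := Module.finBasis ℂ V
  set C := ∑ i, ‖LinearMap.toContinuousLinearMap (b.coord i)‖ with hC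
  have hC0 : 0 ≤ C := Finset.sum_nonneg fun i _ => norm_nonneg (LinearMap.toContinuousLinearMap (b.coord i))
  -- Adding 1 keeps the denominator positive when `R * C = 0`.
  have hη : 0 < δ / (R * C + 1) := by positivity
  have h : ∀ᶠ ψ in 𝓝 φ, ∀ i, ‖φ (b i : A) - ψ (b i : A)‖ < δ / (R * C + 1) := by
    rw [eventually_all]
    intro i
    have : Continuous fun ψ : WeakDual ℂ A => ‖φ (b i : A) - ψ (b i : A)‖ :=
      (continuous_const.sub (WeakDual.eval_continuous _)).norm
    have h0 := this.tendsto φ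
    rw [sub_self, norm_zero] at h0
    exact h0.eventually (gt_mem_nhds hη)
  filter_upwards [h] with ψ hψ x hx hxR
  have hsum : x = ∑ i, (b.coord i ⟨x, hx⟩) • (b i : A) := by
    have := congrArg (Subtype.val : V → A) (b.sum_repr ⟨x, hx⟩)
    rw [Submodule.coe_sum] at this
    exact this.symm
  have : φ x - ψ x = ∑ i, (b.coord i ⟨x, hx⟩) * (φ (b i : A) - ψ (b i : A)) := by
    conv_lhs => rw [hsum]
    simp only [map_sum, map_smul, smul_eq_mul, ← Finset.sum_sub_distrib, mul_sub]
  rw [this]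
  calc ‖∑ i, (b.coord i ⟨x, hx⟩) * (φ (b i : A) - ψ (b i : A))‖
      ≤ ∑ i, ‖LinearMap.toContinuousLinearMap (b.coord i)‖ * R * (δ / (R * C + 1)) := by
        refine (norm_sum_le _ _).trans (Finset.sum_le_sum fun i _ => ?_)
        rw [norm_mul]
        refine mul_le_mul ?_ (hψ i).le (norm_nonneg _) (by positivity)
        refine ((LinearMap.toContinuousLinearMap (b.coord i)).le_opNorm ⟨x, hx⟩).trans ?_
        exact mul_le_mul_of_nonneg_left hxR (norm_nonneg _)
    _ = (R * C) * (δ / (R * C + 1)) := by rw [← Finset.sum_mul, ← Finset.sum_mul, ← hC]; ring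
    _ ≤ δ := by
        rw [mul_div_assoc', div_le_iff₀ (by positivity)]
        nlinarith [mul_nonneg hR hC0]

theorem ofReal_norm_sub_le_mul_mongeKantorovich {L : selfAdjoint A → ℝ≥0∞}
    (hsmul : ∀ (r : ℝ) (a), L (r • a) = ENNReal.ofReal |r| * L a) (φ ψ : WeakDual ℂ A)
    {a : selfAdjoint A} (ha : L a < ∞) :
    ENNReal.ofReal ‖φ (a : A) - ψ (a : A)‖ ≤ (L a + 1) * mongeKantorovich L φ ψ := by
  -- Scaling by `L a + 1` rather than `L a` avoids a separate case for `L a = 0`.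
  set r := (L a).toReal + 1 with hr
  have hr0 : 0 < r := by positivity
  have hrL : ENNReal.ofReal r = L a + 1 := by
    rw [hr, ENNReal.ofReal_add ENNReal.toReal_nonneg zero_le_one, ENNReal.ofReal_toReal ha.ne,
      ENNReal.ofReal_one]
  have h1 : L (r⁻¹ • a) ≤ 1 := by
    rw [hsmul, abs_of_pos (inv_pos.mpr hr0), ENNReal.ofReal_inv_of_pos hr0, hrL, mul_comm,
      ← div_eq_mul_inv]
    exact ENNReal.div_le_of_le_mul (by rw [one_mul]; exact le_self_add)
  have h2 : ENNReal.ofReal ‖φ ((r⁻¹ • a : selfAdjoint A) : A) - ψ ((r⁻¹ • a : selfAdjoint A) : A)‖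
      ≤ mongeKantorovich L φ ψ :=
    le_iSup₂ (f := fun (a : selfAdjoint A) (_ : L a ≤ 1) =>
      ENNReal.ofReal ‖φ (a : A) - ψ (a : A)‖) _ h1
  rw [selfAdjoint.val_smul, ← Complex.coe_smul, map_smul, map_smul, ← smul_sub, norm_smul,
    Complex.norm_real, Real.norm_of_nonneg (inv_pos.mpr hr0).le] at h2
  calc ENNReal.ofReal ‖φ (a : A) - ψ (a : A)‖
      = ENNReal.ofReal r * ENNReal.ofReal (r⁻¹ * ‖φ (a : A) - ψ (a : A)‖) := by
        rw [← ENNReal.ofReal_mul hr0.le, mul_inv_cancel_left₀ hr0.ne']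
    _ ≤ _ := by rw [hrL]; gcongr

/-- The metric topology is finer than the weak* one: convergence holds on the domain of `L` by
scaling, on self-adjoint elements by density and contractivity of states, and then on real and
imaginary parts. -/
theorem tendsto_weakDual_of_mongeKantorovich {L : selfAdjoint A → ℝ≥0∞}
    (hsmul : ∀ (r : ℝ) (a), L (r • a) = ENNReal.ofReal |r| * L a)
    (hd : Dense {a | L a < ∞}) (φ : stateSpace A) :
    comap (fun ψ : stateSpace A => mongeKantorovich L φ ψ) (𝓝 0) ≤ 𝓝 φ := by
  set F := comap (fun ψ : stateSpace A => mongeKantorovich L φ ψ) (𝓝 0)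
  have hF : Tendsto (fun ψ : stateSpace A => mongeKantorovich L φ ψ) F (𝓝 0) := tendsto_comap
  have hdom (a : selfAdjoint A) (ha : L a < ∞) :
      Tendsto (fun ψ : stateSpace A => (ψ : WeakDual ℂ A) (a : A)) F (𝓝 (φ.1 (a : A))) := by
    rw [tendsto_iff_norm_sub_tendsto_zero]
    have h1 : Tendsto (fun ψ : stateSpace A => (L a + 1) * mongeKantorovich L φ ψ) F (𝓝 0) := by
      have := ENNReal.Tendsto.const_mul (a := L a + 1) hF
        (Or.inr (ENNReal.add_ne_top.mpr ⟨ha.ne, ENNReal.one_ne_top⟩))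
      rwa [mul_zero] at this
    have h2 : Tendsto (fun ψ : stateSpace A => ENNReal.ofReal ‖φ.1 (a : A) - ψ.1 (a : A)‖) F
        (𝓝 0) :=
      tendsto_of_tendsto_of_tendsto_of_le_of_le tendsto_const_nhds h1 (fun _ => zero_le)
        fun ψ => ofReal_norm_sub_le_mul_mongeKantorovich hsmul φ.1 ψ.1 ha
    have h3 := (ENNReal.tendsto_toReal ENNReal.zero_ne_top).comp h2
    simp only [Function.comp_def, ENNReal.toReal_ofReal (norm_nonneg _),
      ENNReal.toReal_zero] at h3
    simpa only [norm_sub_rev] using h3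
  have hsa (a : selfAdjoint A) :
      Tendsto (fun ψ : stateSpace A => (ψ : WeakDual ℂ A) (a : A)) F (𝓝 (φ.1 (a : A))) := by
    rw [Metric.tendsto_nhds]
    intro ε hε
    obtain ⟨b, hb, hbL⟩ := Metric.dense_iff.mp hd a (ε / 3) (by positivity)
    have hab : ‖(b : A) - a‖ < ε / 3 := by
      rw [Metric.mem_ball, dist_eq_norm] at hb
      exact hb
    filter_upwards [Metric.tendsto_nhds.mp (hdom b hbL) (ε / 3) (by positivity)] with ψ hψ
    rw [dist_eq_norm] at hψ ⊢
    have h1 := state_norm_apply_le φ.2 ((b : A) - a)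
    have h2 := state_norm_apply_le ψ.2 ((b : A) - a)
    rw [map_sub] at h1 h2
    have h3 : ψ.1 (a : A) - φ.1 (a : A) = (ψ.1 (b : A) - φ.1 (b : A))
      - (ψ.1 (b : A) - ψ.1 (a : A)) + (φ.1 (b : A) - φ.1 (a : A)) := by ring
    rw [h3]
    have h4 := norm_add_le ((ψ.1 (b : A) - φ.1 (b : A)) - (ψ.1 (b : A) - ψ.1 (a : A)))
      (φ.1 (b : A) - φ.1 (a : A))
    have h5 := norm_sub_le (ψ.1 (b : A) - φ.1 (b : A)) (ψ.1 (b : A) - ψ.1 (a : A))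
    linarith
  rw [nhds_subtype_eq_comap, ← tendsto_iff_comap]
  rw [tendsto_iff_forall_eval_tendsto_topDualPairing]
  intro a
  have h := (hsa (ℜ a)).add ((hsa (ℑ a)).const_mul Complex.I)
  have e (ψ : WeakDual ℂ A) : ψ (ℜ a : A) + Complex.I * ψ (ℑ a : A) = ψ a := by
    conv_rhs => rw [← realPart_add_I_smul_imaginaryPart a]
    rw [map_add, map_smul, smul_eq_mul]
  simp only [e] at h
  exact h

theorem mongeKantorovich_le {L : selfAdjoint A → ℝ≥0∞} {φ ψ : WeakDual ℂ A} {c : ℝ}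
    (h : ∀ a, L a ≤ 1 → ‖φ (a : A) - ψ (a : A)‖ ≤ c) :
    mongeKantorovich L φ ψ ≤ ENNReal.ofReal c :=
  iSup₂_le fun a ha => ENNReal.ofReal_le_ofReal (h a ha)

end MongeKantorovich

/-! ### The quantum compact metric space of a filtration. -/

section Metrizes

variable {A : Type} [CStarAlgebra A] {μ : WeakDual ℂ A} {S : ℕ → StarSubalgebra ℂ A}
  [∀ n, FiniteDimensional ℂ (S n)] {β : ℕ → ℝ}

theorem apply_eq_of_mem_bot {φ ψ : WeakDual ℂ A} (hφ : φ ∈ stateSpace A) (hψ : ψ ∈ stateSpace A)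
    {x : A} (hx : x ∈ (⊥ : StarSubalgebra ℂ A)) : φ x = ψ x := by
  obtain ⟨c, rfl⟩ := StarSubalgebra.mem_bot.mp hx
  rw [Algebra.algebraMap_eq_smul_one, map_smul, map_smul, hφ.1, hψ.1]

/-- An element of the Lip ball is within `β N` of its expectation in `S N`, which costs `2 * β N`
for two states. After subtracting a scalar, on which states agree, that expectation lies in a fixed
ball of `S N`. -/
theorem norm_sub_le_of_lipNorm_le (hμ : IsFaithfulTracialState μ) (hS : Monotone S)
    (hβ : ∀ n, 0 < β n) (h0 : S 0 = ⊥) {φ ψ : WeakDual ℂ A} (hφ : φ ∈ stateSpace A)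
    (hψ : ψ ∈ stateSpace A) (N : ℕ) {δ : ℝ}
    (h : ∀ x ∈ (S N).toSubalgebra.toSubmodule, ‖x‖ ≤ β 0 → ‖φ x - ψ x‖ ≤ δ)
    {a : selfAdjoint A} (ha : lipNorm μ S β a ≤ 1) :
    ‖φ (a : A) - ψ (a : A)‖ ≤ 2 * β N + δ := by
  set x := condExp μ (S N) ((a : A) - condExp μ (S 0) a) with hx
  have h1 : ‖φ x - ψ x‖ ≤ δ := h x (condExp_mem hμ (S N) _)
    ((norm_condExp_le hμ (S N) _).trans (norm_sub_condExp_le_of_lipNorm_le hβ ha 0))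
  have h2 : φ (condExp μ (S 0) a) = ψ (condExp μ (S 0) a) :=
    apply_eq_of_mem_bot hφ hψ (h0 ▸ condExp_mem hμ (S 0) _)
  rw [map_sub, condExp_condExp_of_ge hμ (hS (zero_le (a := N)))] at hx
  have h3 := state_norm_apply_le hφ ((a : A) - condExp μ (S N) a)
  have h4 := state_norm_apply_le hψ ((a : A) - condExp μ (S N) a)
  have h5 := norm_sub_condExp_le_of_lipNorm_le hβ ha N
  rw [map_sub] at h3 h4
  have h6 : φ (a : A) - ψ (a : A) = (φ (a : A) - φ (condExp μ (S N) a))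
      - (ψ (a : A) - ψ (condExp μ (S N) a)) + (φ x - ψ x) := by
    rw [hx, map_sub, map_sub, h2]; ring
  rw [h6]
  have h7 := norm_add_le ((φ (a : A) - φ (condExp μ (S N) a))
      - (ψ (a : A) - ψ (condExp μ (S N) a))) (φ x - ψ x)
  have h8 := norm_sub_le (φ (a : A) - φ (condExp μ (S N) a))
    (ψ (a : A) - ψ (condExp μ (S N) a))
  linarith

/-- The quasi-Leibniz quantum compact metric space given by an increasing sequence of finite
dimensional subalgebras with dense union and a faithful tracial state. -/
def QQCMS.ofFiltration (hμ : IsFaithfulTracialState μ) (hS : Monotone S) (h0 : S 0 = ⊥)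
    (hd : Dense (⋃ n, (S n : Set A))) (hβ : ∀ n, 0 < β n) (hβ0 : Tendsto β atTop (𝓝 0)) :
    QQCMS 2 0 where
  carrier := A
  nontrivial := hμ.nontrivial
  L := lipNorm μ S β
  map_add_le a b := by
    simpa only [lipNorm_eq_lipSup_univ] using lipSup_add_le hβ Set.univ a b
  map_smul r a := by
    simpa only [lipNorm_eq_lipSup_univ] using lipSup_smul Set.univ r a
  dense_dom := dense_lipNorm_lt_top hμ hS hd
  eq_zero_iff := lipNorm_eq_zero_iff hμ hβ h0
  quasiLeibniz a b _ _ := by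
    simpa using lipNorm_quasiLeibniz hμ hβ a b
  mk_lt_top φ hφ ψ hψ := by
    -- At level 0 the finite dimensional part is scalar, so it contributes nothing.
    refine (mongeKantorovich_le (c := 2 * β 0 + 0) fun a ha =>
      norm_sub_le_of_lipNorm_le hμ hS hβ h0 hφ hψ 0 (fun x hx _ => ?_) ha).trans_lt
      ENNReal.ofReal_lt_top
    rw [apply_eq_of_mem_bot hφ hψ (h0 ▸ hx), sub_self, norm_zero]
  mk_metrizes φ := by
    have h : 𝓝 φ = comap (fun ψ : stateSpace A => mongeKantorovich (lipNorm μ S β) φ ψ) (𝓝 0) := by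
      refine le_antisymm ?_ (tendsto_weakDual_of_mongeKantorovich (fun r a => by
        simpa only [lipNorm_eq_lipSup_univ] using lipSup_smul Set.univ r a)
        (dense_lipNorm_lt_top hμ hS hd) φ)
      rw [← tendsto_iff_comap, ENNReal.tendsto_nhds_zero]
      intro ε hε
      obtain ⟨η, hη, hηε⟩ : ∃ η : ℝ, 0 < η ∧ ENNReal.ofReal η ≤ ε := by
        obtain ⟨r, hr, hrε⟩ := ENNReal.lt_iff_exists_nnreal_btwn.mp hε
        exact ⟨r, by exact_mod_cast hr, by simpa using hrε.le⟩
      -- Half of `η` pays for the approximation error `2 * β N`, the other half for the difference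
      -- of the states on `S N`.
      obtain ⟨N, hN⟩ := (hβ0.eventually (gt_mem_nhds (show (0 : ℝ) < η / 4 by positivity))).exists
      have : FiniteDimensional ℂ (S N).toSubalgebra.toSubmodule :=
        inferInstanceAs (FiniteDimensional ℂ (S N))
      have h1 := eventually_forall_norm_sub_le (S N).toSubalgebra.toSubmodule φ.1 (hβ 0).le
        (show (0 : ℝ) < η / 2 by positivity)
      filter_upwards [continuous_subtype_val.continuousAt.eventually h1] with ψ hψ
      refine (mongeKantorovich_le fun a ha =>
        (norm_sub_le_of_lipNorm_le hμ hS hβ h0 φ.2 ψ.2 N hψ ha).trans ?_).trans hηε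
      linarith
    rw [h]
    exact ENNReal.nhds_zero_basis.comap _
  lowerSemicontinuous := lipNorm_lowerSemicontinuous

end Metrizes

/-! ### Lipschitz retracts and the bridges they give. -/

section SelfAdjointMap

variable {A B : Type} [CStarAlgebra A] [CStarAlgebra B]

/-- The map induced by a *-morphism on self-adjoint elements. -/
def saMap (ρ : A →⋆ₐ[ℂ] B) (a : selfAdjoint A) : selfAdjoint B :=
  ⟨ρ a, IsSelfAdjoint.map a.2 ρ⟩

@[simp] theorem coe_saMap (ρ : A →⋆ₐ[ℂ] B) (a : selfAdjoint A) : (saMap ρ a : B) = ρ a := rfl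

theorem continuous_starAlgHom (ρ : A →⋆ₐ[ℂ] B) : Continuous ρ :=
  AddMonoidHomClass.continuous_of_bound ρ 1 fun a => by
    simpa using NonUnitalStarAlgHom.norm_apply_le ρ a

theorem continuous_saMap (ρ : A →⋆ₐ[ℂ] B) : Continuous (saMap ρ) :=
  ((continuous_starAlgHom ρ).comp continuous_subtype_val).subtype_mk _

theorem saMap_add (ρ : A →⋆ₐ[ℂ] B) (a b : selfAdjoint A) :
    saMap ρ (a + b) = saMap ρ a + saMap ρ b :=
  Subtype.ext (by simp)

theorem saMap_smul (ρ : A →⋆ₐ[ℂ] B) (r : ℝ) (a : selfAdjoint A) :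
    saMap ρ (r • a) = r • saMap ρ a :=
  Subtype.ext (by
    simp only [coe_saMap, selfAdjoint.val_smul, ← Complex.coe_smul, map_smul])

theorem saMap_one (ρ : A →⋆ₐ[ℂ] B) : saMap ρ 1 = 1 :=
  Subtype.ext (by simp)

theorem saMap_injective {ρ : A →⋆ₐ[ℂ] B} (h : Function.Injective ρ) :
    Function.Injective (saMap ρ) :=
  fun _ _ hab => Subtype.ext (h (congrArg Subtype.val hab))

theorem saMap_realPart (ρ : A →⋆ₐ[ℂ] B) (a : A) : saMap ρ (ℜ a) = ℜ (ρ a) :=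
  Subtype.ext (by
    rw [coe_saMap, realPart_apply_coe, realPart_apply_coe, ← Complex.coe_smul,
      ← Complex.coe_smul, map_smul, map_add, map_star])

theorem saMap_imaginaryPart (ρ : A →⋆ₐ[ℂ] B) (a : A) : saMap ρ (ℑ a) = ℑ (ρ a) :=
  Subtype.ext (by
    rw [coe_saMap, imaginaryPart_apply_coe, imaginaryPart_apply_coe, ← Complex.coe_smul,
      ← Complex.coe_smul, map_smul, map_smul, map_sub, map_star])

theorem norm_saMap {ρ : A →⋆ₐ[ℂ] B} (h : Function.Injective ρ) (a : selfAdjoint A) :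
    ‖saMap ρ a‖ = ‖a‖ :=
  NonUnitalStarAlgHom.norm_map ρ h (a : A)

theorem pullback_mem_stateSpace (ρ : A →⋆ₐ[ℂ] B) {φ : WeakDual ℂ B} (hφ : φ ∈ stateSpace B) :
    pullback ρ φ ∈ stateSpace A := by
  refine ⟨?_, fun a => ?_⟩
  · change φ (ρ 1) = 1
    rw [map_one, hφ.1]
  · change 0 ≤ φ (ρ (star a * a))
    rw [map_mul, map_star]
    exact hφ.2 _

theorem levelSet_one : levelSet (1 : A) = stateSpace A := by
  ext φ
  simp [levelSet]

end SelfAdjointMap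

/-- A positive retraction of an injective *-morphism which does not increase the Lip-norm. -/
structure IsLipRetraction {A Z : Type} [CStarAlgebra A] [CStarAlgebra Z]
    (L : selfAdjoint A → ℝ≥0∞) (ρ : Z →⋆ₐ[ℂ] A) (P : A →L[ℂ] Z) : Prop where
  left_inv : ∀ z, P (ρ z) = z
  map_star : ∀ a, P (star a) = star (P a)
  positive : ∀ a, ∃ b, P (star a * a) = star b * b
  lip_le : ∀ (a : selfAdjoint A) (z : selfAdjoint Z), (z : Z) = P a → L (saMap ρ z) ≤ L a

namespace IsLipRetraction

variable {A Z : Type} [CStarAlgebra A] [CStarAlgebra Z]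
  {L : selfAdjoint A → ℝ≥0∞} {ρ : Z →⋆ₐ[ℂ] A} {P : A →L[ℂ] Z}

/-- The retraction on self-adjoint elements. -/
def sa (h : IsLipRetraction L ρ P) (a : selfAdjoint A) : selfAdjoint Z :=
  ⟨P a, by
    change star (P a) = P a
    rw [← h.map_star, a.2.star_eq]⟩

theorem injective (h : IsLipRetraction L ρ P) : Function.Injective ρ :=
  Function.LeftInverse.injective h.left_inv

theorem sa_saMap (h : IsLipRetraction L ρ P) (z : selfAdjoint Z) : h.sa (saMap ρ z) = z :=
  Subtype.ext (h.left_inv z)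

theorem continuous_sa (h : IsLipRetraction L ρ P) : Continuous h.sa :=
  (P.continuous.comp continuous_subtype_val).subtype_mk _

/-- The extension of a state along the retraction. -/
def extend (h : IsLipRetraction L ρ P) (φ : stateSpace Z) : stateSpace A :=
  ⟨StrongDual.toWeakDual ((WeakDual.toStrongDual φ.1).comp P), by
    refine ⟨?_, fun a => ?_⟩
    · change φ.1 (P 1) = 1
      rw [← map_one ρ, h.left_inv, φ.2.1]
    · change 0 ≤ φ.1 (P (star a * a))
      obtain ⟨b, hb⟩ := h.positive a
      rw [hb]
      exact φ.2.2 b⟩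

theorem extend_apply (h : IsLipRetraction L ρ P) (φ : stateSpace Z) (a : A) :
    (h.extend φ).1 a = φ.1 (P a) := rfl

theorem pullback_extend (h : IsLipRetraction L ρ P) (φ : stateSpace Z) :
    pullback ρ (h.extend φ).1 = φ.1 :=
  DFunLike.ext _ _ fun z => by
    change φ.1 (P (ρ z)) = φ.1 z
    rw [h.left_inv]

/-- Restriction of states along `ρ` is a continuous left inverse. -/
theorem isEmbedding_extend (h : IsLipRetraction L ρ P) : IsEmbedding h.extend := by
  refine Function.LeftInverse.isEmbedding
    (f := fun φ : stateSpace A => (⟨pullback ρ φ.1, pullback_mem_stateSpace ρ φ.2⟩ : stateSpace Z))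
    (fun φ => Subtype.ext (h.pullback_extend φ)) ?_ ?_
  · refine Continuous.subtype_mk (WeakDual.continuous_of_continuous_eval fun z => ?_) _
    exact (WeakDual.eval_continuous (ρ z)).comp continuous_subtype_val
  · refine Continuous.subtype_mk (WeakDual.continuous_of_continuous_eval fun z => ?_) _
    exact (WeakDual.eval_continuous (P z)).comp continuous_subtype_val

/-- `P` maps the Lip ball of `A` onto that of `Z`, so extension of states is isometric; the metric
axioms thereby pass to `Z`. -/
theorem mongeKantorovich_extend (h : IsLipRetraction L ρ P) (φ ψ : stateSpace Z) :
    mongeKantorovich L (h.extend φ).1 (h.extend ψ).1 =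
      mongeKantorovich (fun z => L (saMap ρ z)) φ.1 ψ.1 := by
  refine le_antisymm (iSup₂_le fun a ha => ?_) (iSup₂_le fun z hz => ?_)
  · exact le_iSup₂ (f := fun (z : selfAdjoint Z) (_ : L (saMap ρ z) ≤ 1) =>
      ENNReal.ofReal ‖φ.1 (z : Z) - ψ.1 (z : Z)‖) (h.sa a) ((h.lip_le a _ rfl).trans ha)
  · refine le_trans (le_of_eq ?_) (le_iSup₂ (f := fun (a : selfAdjoint A) (_ : L a ≤ 1) =>
      ENNReal.ofReal ‖(h.extend φ).1 (a : A) - (h.extend ψ).1 (a : A)‖) (saMap ρ z) hz)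
    rw [extend_apply, extend_apply, coe_saMap, h.left_inv]

end IsLipRetraction

/-- The quantum compact metric space structure on a retract. -/
def QQCMS.compress {C D : ℝ≥0} (X : QQCMS C D) {Z : Type} [CStarAlgebra Z] [Nontrivial Z]
    {ρ : Z →⋆ₐ[ℂ] X.carrier} {P : X.carrier →L[ℂ] Z} (h : IsLipRetraction X.L ρ P) :
    QQCMS C D where
  carrier := Z
  L z := X.L (saMap ρ z)
  map_add_le a b := by
    rw [saMap_add]
    exact X.map_add_le _ _
  map_smul r a := by
    rw [saMap_smul, X.map_smul]
  dense_dom := by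
    have hs : Function.Surjective h.sa := fun z => ⟨saMap ρ z, h.sa_saMap z⟩
    refine (hs.denseRange.dense_image h.continuous_sa X.dense_dom).mono ?_
    rintro _ ⟨a, ha, rfl⟩
    exact (h.lip_le a _ rfl).trans_lt ha
  eq_zero_iff a := by
    rw [X.eq_zero_iff]
    refine exists_congr fun r => ?_
    rw [← saMap_one ρ, ← saMap_smul, (saMap_injective h.injective).eq_iff]
  quasiLeibniz a b ha hb := by
    have := X.quasiLeibniz (saMap ρ a) (saMap ρ b) ha hb
    rw [norm_saMap h.injective, norm_saMap h.injective, coe_saMap, coe_saMap, ← map_mul,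
      ← saMap_realPart, ← saMap_imaginaryPart] at this
    exact this
  mk_lt_top φ hφ ψ hψ := by
    rw [← h.mongeKantorovich_extend ⟨φ, hφ⟩ ⟨ψ, hψ⟩]
    exact X.mk_lt_top _ (h.extend _).2 _ (h.extend _).2
  mk_metrizes φ := by
    rw [h.isEmbedding_extend.nhds_eq_comap]
    have := (X.mk_metrizes (h.extend φ)).comap h.extend
    convert this using 2 with ε
    ext ψ
    simp only [Set.mem_ofPred_eq, Set.mem_preimage, h.mongeKantorovich_extend]
  lowerSemicontinuous := X.lowerSemicontinuous.comp (continuous_saMap ρ)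

theorem hausdorff_self {X : Type} {d : X → X → ℝ≥0∞} (hd : ∀ x, d x x = 0) (S : Set X) :
    hausdorff d S S = 0 := by
  refine le_antisymm (max_le (iSup₂_le fun x hx => ?_) (iSup₂_le fun x hx => ?_)) zero_le
  · exact (iInf₂_le x hx).trans (hd x).le
  · exact (iInf₂_le x hx).trans (hd x).le

theorem mongeKantorovich_self {A : Type} [CStarAlgebra A] (L : selfAdjoint A → ℝ≥0∞)
    (φ : WeakDual ℂ A) : mongeKantorovich L φ φ = 0 := by
  simp [mongeKantorovich]

/-- The bridge with pivot `1` given by an injective *-morphism. -/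
def inclusionBridge {A Z : Type} [CStarAlgebra A] [CStarAlgebra Z] (ρ : Z →⋆ₐ[ℂ] A)
    (hρ : Function.Injective ρ) (hne : (stateSpace A).Nonempty) : Bridge A Z where
  carrier := A
  left := StarAlgHom.id ℂ A
  right := ρ
  left_injective := Function.injective_id
  right_injective := hρ
  pivot := 1
  levelSet_nonempty := by rwa [levelSet_one]

/-- With pivot `1` every state is in the level set, and every state of `Z` extends to `A`, so the
height is zero; only the approximation of `a` by `P a` counts. -/
theorem length_inclusionBridge_le {A Z : Type} [CStarAlgebra A] [CStarAlgebra Z]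
    {L : selfAdjoint A → ℝ≥0∞} {ρ : Z →⋆ₐ[ℂ] A} {P : A →L[ℂ] Z} (h : IsLipRetraction L ρ P)
    (hne : (stateSpace A).Nonempty) {ε : ℝ}
    (hε : ∀ a : selfAdjoint A, L a ≤ 1 → ‖(a : A) - ρ (P a)‖ ≤ ε) :
    (inclusionBridge ρ h.injective hne).length L (fun z => L (saMap ρ z)) ≤ ENNReal.ofReal ε := by
  have h1 : pullback (StarAlgHom.id ℂ A) '' levelSet (1 : A) = stateSpace A := by
    rw [levelSet_one]
    exact Set.image_id _
  have h2 : pullback ρ '' levelSet (1 : A) = stateSpace Z := by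
    rw [levelSet_one]
    refine Set.Subset.antisymm ?_ fun φ hφ => ⟨_, (h.extend ⟨φ, hφ⟩).2, h.pullback_extend ⟨φ, hφ⟩⟩
    rintro _ ⟨φ, hφ, rfl⟩
    exact pullback_mem_stateSpace ρ hφ
  refine max_le (max_le ?_ ?_) (max_le ?_ ?_)
  · change hausdorff _ _ (pullback (StarAlgHom.id ℂ A) '' levelSet (1 : A)) ≤ _
    rw [h1, hausdorff_self (mongeKantorovich_self _)]
    exact zero_le
  · change hausdorff _ _ (pullback ρ '' levelSet (1 : A)) ≤ _
    rw [h2, hausdorff_self (mongeKantorovich_self _)]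
    exact zero_le
  · refine iSup₂_le fun a ha => (iInf₂_le (h.sa a) ((h.lip_le a _ rfl).trans ha)).trans ?_
    refine ENNReal.ofReal_le_ofReal ?_
    change ‖(a : A) * 1 - 1 * ρ (P a)‖ ≤ ε
    rw [mul_one, one_mul]
    exact hε a ha
  · refine iSup₂_le fun z hz => (iInf₂_le (saMap ρ z) hz).trans ?_
    change ENNReal.ofReal ‖ρ z * 1 - 1 * ρ z‖ ≤ _
    rw [mul_one, one_mul, sub_self, norm_zero, ENNReal.ofReal_zero]
    exact zero_le

/-- Two spaces with a common retract are close if they are both close to it. -/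
theorem propinquity_le_of_common_retract {C D : ℝ≥0} (X X' : QQCMS C D) {Z : Type}
    [CStarAlgebra Z] [Nontrivial Z]
    {ρ : Z →⋆ₐ[ℂ] X.carrier} {P : X.carrier →L[ℂ] Z} (h : IsLipRetraction X.L ρ P)
    {ρ' : Z →⋆ₐ[ℂ] X'.carrier} {P' : X'.carrier →L[ℂ] Z} (h' : IsLipRetraction X'.L ρ' P')
    (hL : ∀ z, X.L (saMap ρ z) = X'.L (saMap ρ' z))
    (hne : (stateSpace X.carrier).Nonempty) (hne' : (stateSpace X'.carrier).Nonempty) {ε : ℝ}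
    (hε : ∀ a : selfAdjoint X.carrier, X.L a ≤ 1 → ‖(a : X.carrier) - ρ (P a)‖ ≤ ε)
    (hε' : ∀ a : selfAdjoint X'.carrier, X'.L a ≤ 1 → ‖(a : X'.carrier) - ρ' (P' a)‖ ≤ ε) :
    propinquity X X' ≤ ENNReal.ofReal ε + ENNReal.ofReal ε := by
  have hb := isBridgeBounded_propinquity (C := C) (D := D)
  refine (hb.triangle X (X.compress h) X').trans (add_le_add ?_ ?_)
  · exact (hb.le_length X (X.compress h) (inclusionBridge ρ h.injective hne)).trans
      (length_inclusionBridge_le h hne hε)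
  · rw [hb.symm]
    refine (hb.le_length X' (X.compress h) (inclusionBridge ρ' h'.injective hne')).trans ?_
    -- The compression of `X` carries the Lip-norm induced from `X'` as well, hence serves both
    -- bridges.
    have : (X.compress h).L = fun z => X'.L (saMap ρ' z) := funext hL
    rw [this]
    exact length_inclusionBridge_le h' hne' hε'

section AF

variable {A Z : Type} [CStarAlgebra A] [CStarAlgebra Z] {μ : WeakDual ℂ A}
  {S : ℕ → StarSubalgebra ℂ A} [∀ n, FiniteDimensional ℂ (S n)] {β : ℕ → ℝ}

theorem exists_isLipRetraction (hμ : IsFaithfulTracialState μ) (hS : Monotone S)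
    (hβ : ∀ n, 0 < β n) {ρ : Z →⋆ₐ[ℂ] A} (hρ : Function.Injective ρ) (N : ℕ)
    (hN : ρ.range = S N) :
    ∃ P : A →L[ℂ] Z, IsLipRetraction (lipNorm μ S β) ρ P ∧ ∀ a, ρ (P a) = condExp μ (S N) a := by
  have hmem a : ∃ z, ρ z = condExp μ (S N) a := by
    have : condExp μ (S N) a ∈ ρ.range := hN ▸ condExp_mem hμ (S N) a
    exact this
  choose f hf using hmem
  let P : A →ₗ[ℂ] Z :=
    { toFun := f
      map_add' := fun a b => hρ (by simp [hf])
      map_smul' := fun c a => hρ (by simp [hf]) }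
  have hP (a) : ρ (P a) = condExp μ (S N) a := hf a
  have hmemρ (z) : ρ z ∈ S N := by rw [← hN]; exact ⟨z, rfl⟩
  have hbd (a) : ‖P a‖ ≤ 1 * ‖a‖ := by
    rw [← NonUnitalStarAlgHom.norm_map ρ hρ, hP, one_mul]
    exact norm_condExp_le hμ (S N) a
  refine ⟨P.mkContinuous 1 hbd, ⟨fun z => hρ ?_, fun a => hρ ?_, fun a => ?_, ?_⟩, hP⟩
  · exact (hP _).trans (condExp_of_mem hμ (S N) (hmemρ z))
  · rw [StarHomClass.map_star ρ]
    refine (hP _).trans ?_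
    rw [condExp_star hμ]
    exact congrArg star (hP a).symm
  · obtain ⟨c, hc, hcc⟩ := exists_mem_condExp_star_mul_self hμ (S N) a
    rw [← hN] at hc
    obtain ⟨z, rfl⟩ := hc
    refine ⟨z, hρ ((hP _).trans (hcc.trans ?_))⟩
    rw [map_mul, StarHomClass.map_star ρ]
    rfl
  · rintro a z hz
    have : saMap ρ z = condExpSA hμ (S N) a := Subtype.ext (by
      rw [coe_saMap, hz]
      exact hP a)
    rw [this]
    exact lipNorm_condExpSA_le hμ hS hβ N a

end AF

/-! ### Full matrix algebras: uniqueness of the trace and of representations. -/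

section TraceUniqueness

/-- Off-diagonal matrix units are commutators, and the diagonal ones share a common value, which
vanishes because they sum to `1`. -/
theorem eq_zero_of_tracial {d : ℕ} (h : Matrix (Fin d) (Fin d) ℂ →ₗ[ℂ] ℂ)
    (ht : ∀ x y, h (x * y) = h (y * x)) (h1 : h 1 = 0) : h = 0 := by
  have hoff i j (hij : i ≠ j) : h (Matrix.single i j 1) = 0 := by
    have e : Matrix.single i j (1 : ℂ) = Matrix.single i i 1 * Matrix.single i j 1 := by simp
    rw [e, ht, Matrix.single_mul_single_of_ne _ _ _ _ (Ne.symm hij), map_zero]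
  have hdiag i j : h (Matrix.single i i 1) = h (Matrix.single j j 1) := by
    have := ht (Matrix.single i j 1) (Matrix.single j i 1)
    simpa using this
  have hdiag0 i : h (Matrix.single i i 1) = 0 := by
    rw [← Matrix.sum_single_one, map_sum, Finset.sum_congr rfl fun j _ => hdiag j i] at h1
    have : NeZero d := ⟨fun hd => by subst hd; exact i.elim0⟩
    simpa [NeZero.ne d] using h1
  refine LinearMap.ext fun x => ?_
  rw [Matrix.matrix_eq_sum_single x, LinearMap.zero_apply, map_sum]
  refine Finset.sum_eq_zero fun i _ => ?_
  rw [map_sum]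
  refine Finset.sum_eq_zero fun j _ => ?_
  have : Matrix.single i j (x i j) = x i j • Matrix.single i j (1 : ℂ) := by
    simp [Matrix.smul_single]
  rw [this, map_smul]
  by_cases hij : i = j
  · subst hij
    rw [hdiag0, smul_zero]
  · rw [hoff i j hij, smul_zero]

/-- A full matrix algebra has at most one normalized trace. -/
theorem eq_of_tracial {Z : Type} [CStarAlgebra Z] {d : ℕ}
    (e : Z ≃⋆ₐ[ℂ] Matrix (Fin d) (Fin d) ℂ) {f g : Z →ₗ[ℂ] ℂ}
    (hf : ∀ x y, f (x * y) = f (y * x)) (hg : ∀ x y, g (x * y) = g (y * x)) (h1 : f 1 = g 1) :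
    f = g := by
  have hz : (f - g) ∘ₗ (e.symm : Matrix (Fin d) (Fin d) ℂ →⋆ₐ[ℂ] Z).toAlgHom.toLinearMap = 0 := by
    refine eq_zero_of_tracial _ (fun x y => ?_) ?_
    · change f (e.symm (x * y)) - g (e.symm (x * y)) = f (e.symm (y * x)) - g (e.symm (y * x))
      rw [map_mul e.symm, map_mul e.symm, hf, hg]
    · change f (e.symm 1) - g (e.symm 1) = 0
      rw [map_one e.symm, h1, sub_self]
  ext z
  have := congrArg (fun k => k (e z)) hz
  change f (e.symm (e z)) - g (e.symm (e z)) = 0 at this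
  rwa [e.symm_apply_apply, sub_eq_zero] at this

end TraceUniqueness

section UnitaryEquivalence

variable {E : Type} [NormedAddCommGroup E] [InnerProductSpace ℂ E] [FiniteDimensional ℂ E]

open ContinuousLinearMap in
-- Equal traces mean ranges of equal dimension; `w` is an isometry between the ranges, extended by
-- zero.
theorem exists_partialIsometry {p q : E →L[ℂ] E} (hp : IsStarProjection p)
    (hq : IsStarProjection q)
    (h : LinearMap.trace ℂ E p = LinearMap.trace ℂ E q) :
    ∃ w : E →L[ℂ] E, star w * w = p ∧ w * star w = q := by
  have : CompleteSpace E := FiniteDimensional.complete ℂ E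
  obtain ⟨hpK, hpe⟩ := isStarProjection_iff_eq_starProjection_range.mp hp
  obtain ⟨hqK, hqe⟩ := isStarProjection_iff_eq_starProjection_range.mp hq
  have hti : IsIdempotentElem (p : E →ₗ[ℂ] E) := by
    have := hp.isIdempotentElem
    exact congrArg ContinuousLinearMap.toLinearMap this
  have htq : IsIdempotentElem (q : E →ₗ[ℂ] E) := by
    have := hq.isIdempotentElem
    exact congrArg ContinuousLinearMap.toLinearMap this
  rw [(LinearMap.IsIdempotentElem.isProj_range _ hti).trace,
    (LinearMap.IsIdempotentElem.isProj_range _ htq).trace, Nat.cast_inj] at h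
  set K := LinearMap.range (p : E →ₗ[ℂ] E)
  set K' := LinearMap.range (q : E →ₗ[ℂ] E)
  let T : K ≃ₗᵢ[ℂ] K' := (stdOrthonormalBasis ℂ K).equiv (stdOrthonormalBasis ℂ K') (finCongr h)
  let w : E →L[ℂ] E := K'.subtypeL ∘L (T : K →L[ℂ] K') ∘L K.orthogonalProjectionOnto
  have hw : star w = K.subtypeL ∘L (T.symm : K' →L[ℂ] K) ∘L K'.orthogonalProjectionOnto := by
    rw [star_eq_adjoint]
    simp only [w, adjoint_comp, Submodule.adjoint_subtypeL, Submodule.adjoint_orthogonalProjectionOnto]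
    have hT : adjoint (T : K →L[ℂ] K') = (T.symm : K' →L[ℂ] K) := T.adjoint_eq_symm
    rw [hT]
    rfl
  refine ⟨w, ?_, ?_⟩
  · rw [hw, hpe]
    ext x
    simp [w]
    rfl
  · rw [hw, hqe]
    ext x
    simp [w]
    rfl

/-- Two unital *-representations of a full matrix algebra on a finite dimensional Hilbert space
are unitarily equivalent. -/
theorem exists_unitary_conj {d : ℕ} (hd : 0 < d)
    (f g : Matrix (Fin d) (Fin d) ℂ →⋆ₐ[ℂ] (E →L[ℂ] E)) :
    ∃ u ∈ unitary (E →L[ℂ] E), ∀ x, g x = u * f x * star u := by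
  have : CompleteSpace E := FiniteDimensional.complete ℂ E
  let o : Fin d := ⟨0, hd⟩
  let e (i j : Fin d) : Matrix (Fin d) (Fin d) ℂ := Matrix.single i j 1
  have hee (i j k l : Fin d) : e i j * e k l = if j = k then e i l else 0 := by
    split_ifs with h
    · subst h; simp [e]
    · exact Matrix.single_mul_single_of_ne _ _ _ _ h _
  have hes (i j : Fin d) : star (e i j) = e j i := by
    rw [Matrix.star_eq_conjTranspose, Matrix.conjTranspose_single, star_one]
  have hsum : ∑ i, e i i = 1 := Matrix.sum_single_one
  have hproj (k : Matrix (Fin d) (Fin d) ℂ →⋆ₐ[ℂ] (E →L[ℂ] E)) : IsStarProjection (k (e o o)) :=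
    ⟨by rw [IsIdempotentElem, ← map_mul, hee, if_pos rfl],
      by rw [IsSelfAdjoint, ← map_star, hes]⟩
  -- The trace of a unital representation is a tracial functional with value `dim E` at `1`, so it
  -- does not depend on the representation.
  have htr : LinearMap.trace ℂ E (f (e o o)) = LinearMap.trace ℂ E (g (e o o)) := by
    let t (k : Matrix (Fin d) (Fin d) ℂ →⋆ₐ[ℂ] (E →L[ℂ] E)) :
        Matrix (Fin d) (Fin d) ℂ →ₗ[ℂ] ℂ :=
      LinearMap.trace ℂ E ∘ₗ ContinuousLinearMap.coeLM ℂ ∘ₗ k.toAlgHom.toLinearMap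
    have ht k x y : t k (x * y) = t k (y * x) := by
      change LinearMap.trace ℂ E (k (x * y)) = LinearMap.trace ℂ E (k (y * x))
      rw [map_mul, map_mul]
      exact LinearMap.trace_mul_comm ℂ _ _
    have h0 : t f - t g = 0 := by
      refine eq_zero_of_tracial _ (fun x y => ?_) ?_
      · rw [LinearMap.sub_apply, LinearMap.sub_apply, ht f, ht g]
      · change LinearMap.trace ℂ E (f 1) - LinearMap.trace ℂ E (g 1) = 0
        rw [map_one, map_one, sub_self]
    exact congrArg (fun k => k (e o o)) (sub_eq_zero.mp h0)
  obtain ⟨w, hw1, hw2⟩ := exists_partialIsometry (hproj f) (hproj g) htr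
  -- The partial isometry between the corners at `o` is spread over the diagonal by matrix units;
  -- this intertwines `f` and `g`.
  set u := ∑ i, g (e i o) * w * f (e o i) with hu
  have hcomm (k l : Fin d) : u * f (e k l) = g (e k l) * u := by
    rw [hu, Finset.sum_mul, Finset.mul_sum]
    rw [Finset.sum_eq_single k, Finset.sum_eq_single l]
    · rw [mul_assoc, ← map_mul, hee, if_pos rfl, ← mul_assoc, ← mul_assoc, ← map_mul, hee,
        if_pos rfl]
    · intro i _ hi
      rw [← mul_assoc, ← mul_assoc, ← map_mul, hee, if_neg (Ne.symm hi), map_zero, zero_mul,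
        zero_mul]
    · simp
    · intro i _ hi
      rw [mul_assoc, ← map_mul, hee, if_neg hi, map_zero, mul_zero]
    · simp
  have hstar : star u = ∑ i, f (e i o) * star w * g (e o i) := by
    rw [hu, star_sum]
    refine Finset.sum_congr rfl fun i _ => ?_
    rw [star_mul, star_mul, ← map_star, ← map_star, hes, hes, mul_assoc]
  have huu : u * star u = 1 := by
    rw [hstar, Finset.mul_sum, ← map_one g, ← hsum, map_sum]
    refine Finset.sum_congr rfl fun i _ => ?_
    rw [← mul_assoc, ← mul_assoc, hcomm, hu, Finset.mul_sum, Finset.sum_mul, Finset.sum_mul,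
      Finset.sum_eq_single o]
    · have e1 : f (e o o) * star w = star w * g (e o o) := by
        rw [← hw1, ← hw2, mul_assoc]
      have e2 : w * (star w * g (e o o)) = g (e o o) := by
        rw [← mul_assoc, hw2, ← map_mul, hee, if_pos rfl]
      rw [← mul_assoc, ← mul_assoc, ← map_mul, hee, if_pos rfl, mul_assoc (g (e i o) * w), e1,
        mul_assoc (g (e i o)), e2, ← map_mul, hee, if_pos rfl, ← map_mul, hee, if_pos rfl]
    · intro j _ hj
      rw [← mul_assoc, ← mul_assoc, ← map_mul, hee, if_neg (Ne.symm hj), map_zero, zero_mul,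
        zero_mul, zero_mul, zero_mul]
    · simp
  -- In finite dimension a right inverse is a left inverse.
  have huu' : star u * u = 1 := by
    have h1 : (u : E →ₗ[ℂ] E) * ((star u : E →L[ℂ] E) : E →ₗ[ℂ] E) = 1 :=
      congrArg ContinuousLinearMap.toLinearMap huu
    have h2 := mul_eq_one_comm.mp h1
    exact ContinuousLinearMap.coe_injective h2
  refine ⟨u, ⟨huu', huu⟩, fun x => ?_⟩
  have hx : u * f x = g x * u := by
    rw [Matrix.matrix_eq_sum_single x]
    simp only [map_sum, Finset.mul_sum, Finset.sum_mul]
    refine Finset.sum_congr rfl fun i _ => Finset.sum_congr rfl fun j _ => ?_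
    have : Matrix.single i j (x i j) = x i j • e i j := by simp [e, Matrix.smul_single]
    rw [this, map_smul, map_smul, mul_smul_comm, smul_mul_assoc, hcomm]
  rw [hx, mul_assoc, huu, mul_one]

/-- Start from any identification of `Z₂` with `Z₂'`; the two embeddings of `Z₁` become
representations on the same space and differ by a unitary, which corrects the identification. -/
theorem exists_starAlgEquiv_extending {Z₁ Z₂ Z₂' : Type} [CStarAlgebra Z₁] [CStarAlgebra Z₂]
    [CStarAlgebra Z₂'] {d D : ℕ} (hd : 0 < d) (e₁ : Z₁ ≃⋆ₐ[ℂ] Matrix (Fin d) (Fin d) ℂ)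
    (e₂ : Z₂ ≃⋆ₐ[ℂ] Matrix (Fin D) (Fin D) ℂ) (e₂' : Z₂' ≃⋆ₐ[ℂ] Matrix (Fin D) (Fin D) ℂ)
    (a : Z₁ →⋆ₐ[ℂ] Z₂) (b : Z₁ →⋆ₐ[ℂ] Z₂') :
    ∃ ψ : Z₂ ≃⋆ₐ[ℂ] Z₂', ∀ z, ψ (a z) = b z := by
  let t := Matrix.toEuclideanCLM (n := Fin D) (𝕜 := ℂ)
  let f : Matrix (Fin d) (Fin d) ℂ →⋆ₐ[ℂ]
      (EuclideanSpace ℂ (Fin D) →L[ℂ] EuclideanSpace ℂ (Fin D)) :=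
    (e₂.trans t : Z₂ →⋆ₐ[ℂ] _).comp (a.comp (e₁.symm : Matrix (Fin d) (Fin d) ℂ →⋆ₐ[ℂ] Z₁))
  let g : Matrix (Fin d) (Fin d) ℂ →⋆ₐ[ℂ]
      (EuclideanSpace ℂ (Fin D) →L[ℂ] EuclideanSpace ℂ (Fin D)) :=
    (e₂'.trans t : Z₂' →⋆ₐ[ℂ] _).comp (b.comp (e₁.symm : Matrix (Fin d) (Fin d) ℂ →⋆ₐ[ℂ] Z₁))
  obtain ⟨u, hu, hfg⟩ := exists_unitary_conj hd f g
  let c := Unitary.conjStarAlgAut ℂ (EuclideanSpace ℂ (Fin D) →L[ℂ] EuclideanSpace ℂ (Fin D)) ⟨u, hu⟩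
  refine ⟨((e₂.trans t).trans c).trans (e₂'.trans t).symm, fun z => ?_⟩
  have h := hfg (e₁ z)
  have h1 : f (e₁ z) = (e₂.trans t) (a z) := by
    change (e₂.trans t) (a (e₁.symm (e₁ z))) = _
    rw [e₁.symm_apply_apply]
  have h2 : g (e₁ z) = (e₂'.trans t) (b z) := by
    change (e₂'.trans t) (b (e₁.symm (e₁ z))) = _
    rw [e₁.symm_apply_apply]
  rw [h1, h2] at h
  change (e₂'.trans t).symm (u * (e₂.trans t) (a z) * star u) = _
  rw [← h, StarAlgEquiv.symm_apply_apply]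

end UnitaryEquivalence

/-! ### The Lip-norm determines the filtration. -/

section Rigidity

variable {A : Type} [CStarAlgebra A] {μ : WeakDual ℂ A}

/-- `T` is a known head of the Lip-norm, `R` and `R'` two candidate tails. If `v = b - E_U b` were
nonzero, the gap would let `v` be moved by a small multiple of `b` without raising `max T R` above
`R' v`. Modulo `U`, where `R'` vanishes, this move multiplies `v` by `1 + t`, so `R'` must grow: a
contradiction. -/
theorem mem_of_max_eq_max (hμ : IsFaithfulTracialState μ) (U : StarSubalgebra ℂ A)
    [FiniteDimensional ℂ U] {T R R' : selfAdjoint A → ℝ≥0∞}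
    (hTadd : ∀ a b, T (a + b) ≤ T a + T b)
    (hTsmul : ∀ (r : ℝ) a, T (r • a) = ENNReal.ofReal |r| * T a)
    (hRadd : ∀ a b, R (a + b) ≤ R a + R b)
    (hRsmul : ∀ (r : ℝ) a, R (r • a) = ENNReal.ofReal |r| * R a)
    (hRadd' : ∀ a b, R' (a + b) ≤ R' a + R' b)
    (hRsmul' : ∀ (r : ℝ) a, R' (r • a) = ENNReal.ofReal |r| * R' a)
    (hL : ∀ a, max (T a) (R a) = max (T a) (R' a))
    (hRU : ∀ a : selfAdjoint A, (a : A) ∈ U → R' a = 0)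
    (hgap : ∀ v : selfAdjoint A, v ≠ 0 → condExp μ U v = 0 → T v < R' v)
    {b : selfAdjoint A} (hTb : T b < ∞) (hRb : R b = 0) : (b : A) ∈ U := by
  set c := condExpSA hμ U b
  have hc : (c : A) ∈ U := condExp_mem hμ U b
  set v := b - c with hv
  by_cases hv0 : v = 0
  · rw [sub_eq_zero.mp hv0]
    exact hc
  exfalso
  have hEv : condExp μ U v = 0 := by
    change condExp μ U ((b : A) - condExp μ U b) = 0
    rw [map_sub, condExp_of_mem hμ U (condExp_mem hμ U b), sub_self]
  have hlt := hgap v hv0 hEv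
  have hadd0 (a d : selfAdjoint A) (hd : (d : A) ∈ U) : R' (a + d) ≤ R' a := by
    simpa [hRU d hd] using hRadd' a d
  have hRb' : R' b ≤ T b := by
    have : R' b ≤ max (T b) (R b) := hL b ▸ le_max_right _ _
    rwa [hRb, max_eq_left zero_le] at this
  have hfin : R' v < ∞ := by
    refine lt_of_le_of_lt ?_ (hRb'.trans_lt hTb)
    rw [hv, sub_eq_add_neg]
    exact hadd0 b (-c) (by simpa using hc)
  -- `t` is so small that `t * T b` fits into the gap `R' v - T v`.
  obtain ⟨t, ht0, ht⟩ := ENNReal.exists_nnreal_pos_mul_lt hTb.ne (tsub_pos_of_lt hlt).ne'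
  have htr : ENNReal.ofReal |(t : ℝ)| = t := by simp
  have h1 : T (v + (t : ℝ) • b) ≤ R' v := by
    refine (hTadd _ _).trans ?_
    rw [hTsmul, htr]
    calc T v + t * T b ≤ T v + (R' v - T v) := by gcongr
      _ = R' v := add_tsub_cancel_of_le hlt.le
  have h2 : R (v + (t : ℝ) • b) ≤ R' v := by
    refine (hRadd _ _).trans ?_
    rw [hRsmul, hRb, mul_zero, add_zero]
    calc R v ≤ max (T v) (R v) := le_max_right _ _
      _ = R' v := by rw [hL, max_eq_right hlt.le]
  have h3 : R' (v + (t : ℝ) • b) ≤ R' v :=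
    calc R' (v + (t : ℝ) • b) ≤ max (T (v + (t : ℝ) • b)) (R' (v + (t : ℝ) • b)) := le_max_right _ _
      _ ≤ R' v := by rw [← hL]; exact max_le h1 h2
  have h4 : R' ((1 + t : ℝ) • v) ≤ R' v := by
    refine le_trans ?_ h3
    have : (1 + t : ℝ) • v = (v + (t : ℝ) • b) + -((t : ℝ) • c) := by
      rw [hv]; module
    rw [this]
    refine hadd0 _ _ ?_
    rw [AddSubgroup.coe_neg, selfAdjoint.val_smul, ← Complex.coe_smul]
    exact neg_mem (U.smul_mem hc _)
  rw [hRsmul', abs_of_pos (by positivity)] at h4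
  have h5 : R' v * 1 < R' v * ENNReal.ofReal (1 + t) := by
    refine (ENNReal.mul_lt_mul_iff_right (pos_of_gt hlt).ne' hfin.ne).mpr ?_
    rw [← ENNReal.ofReal_one]
    exact (ENNReal.ofReal_lt_ofReal_iff (by positivity)).mpr (by simpa using ht0)
  rw [mul_one, mul_comm] at h5
  exact absurd h4 h5.not_ge

variable {S S' : ℕ → StarSubalgebra ℂ A} {β β' : ℕ → ℝ}

theorem le_of_selfAdjoint_mem {U V : StarSubalgebra ℂ A}
    (h : ∀ b : selfAdjoint A, (b : A) ∈ U → (b : A) ∈ V) : U ≤ V := by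
  intro x hx
  have hi : (ℑ x : A) ∈ U := by
    rw [imaginaryPart_apply_coe, ← Complex.coe_smul]
    exact U.smul_mem (U.smul_mem (sub_mem hx (star_mem hx)) _) _
  rw [← realPart_add_I_smul_imaginaryPart x]
  exact add_mem (h _ (realPart_mem_of_mem hx)) (V.smul_mem (h _ hi) _)

theorem lipSup_Iic_succ (n : ℕ) (a : selfAdjoint A) :
    lipSup μ S β (Set.Iic (n + 1)) a =
      max (lipSup μ S β (Set.Iic n) a)
        (ENNReal.ofReal (‖(a : A) - condExp μ (S (n + 1)) a‖ / β (n + 1))) := by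
  have : Set.Iic (n + 1) = Set.Iic n ∪ {n + 1} := by
    ext j; simp; omega
  rw [this, lipSup_union]
  simp [lipSup]

theorem finrank_lt_of_lt {U V : StarSubalgebra ℂ A} [FiniteDimensional ℂ V] (h : U < V) :
    Module.finrank ℂ U < Module.finrank ℂ V := by
  have : FiniteDimensional ℂ V.toSubalgebra.toSubmodule := inferInstanceAs (FiniteDimensional ℂ V)
  exact Submodule.finrank_lt_finrank_of_lt (s := U.toSubalgebra.toSubmodule)
    (t := V.toSubalgebra.toSubmodule) h

variable [∀ n, FiniteDimensional ℂ (S n)]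

/-- All the expectations involved kill `v`, so the head is at most `‖v‖ / β q`, while the tail
contains the larger term `‖v‖ / β' m`. This is the gap needed in `mem_of_max_eq_max`. -/
theorem lipSup_Iic_lt (hμ : IsFaithfulTracialState μ) (hβ : ∀ n, 0 < β n) (hanti : Antitone β)
    {q : ℕ} {U : StarSubalgebra ℂ A} [FiniteDimensional ℂ U] (hU : ∀ j ≤ q, S j ≤ U)
    {m : ℕ} (hm : S' m = U) (hβm : β' m < β q) (hβm0 : 0 < β' m) {J : Set ℕ} (hmJ : m ∈ J)
    {v : selfAdjoint A} (hv : v ≠ 0) (hEv : condExp μ U v = 0) :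
    lipSup μ S β (Set.Iic q) v < lipSup μ S' β' J v := by
  have hv0 : 0 < ‖(v : A)‖ := norm_pos_iff.mpr fun h => hv (Subtype.ext h)
  calc lipSup μ S β (Set.Iic q) v ≤ ENNReal.ofReal (‖(v : A)‖ / β q) := by
        refine lipSup_le fun j hj => ENNReal.ofReal_le_ofReal ?_
        rw [← condExp_condExp_of_le hμ (hU j hj), hEv, map_zero, sub_zero]
        exact div_le_div_of_nonneg_left hv0.le (hβ q) (hanti hj)
    _ < ENNReal.ofReal (‖(v : A)‖ / β' m) := by
        refine (ENNReal.ofReal_lt_ofReal_iff (div_pos hv0 hβm0)).mpr ?_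
        exact div_lt_div_of_pos_left hv0 hβm0 hβm
    _ ≤ lipSup μ S' β' J v := by
        have := le_lipSup (μ := μ) (S := S') (β := β') hmJ v
        rwa [hm, hEv, sub_zero] at this

variable [∀ n, FiniteDimensional ℂ (S' n)]

/-- The Lip-norm determines the filtration, up to repetitions. -/
theorem exists_reindexing (hμ : IsFaithfulTracialState μ) {w : ℕ → ℝ}
    (hw : ∀ n, 0 < n → 0 < w n) (hwa : ∀ m n, 0 < m → m < n → w n < w m)
    (hS : Monotone S) (hSs : StrictMono fun n => Module.finrank ℂ (S n)) (hS' : Monotone S')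
    (h0 : S' 0 = S 0) (hβ : ∀ n, β n = w (Module.finrank ℂ (S n)))
    (hβ' : ∀ n, β' n = w (Module.finrank ℂ (S' n)))
    (hL : ∀ a, lipNorm μ S β a = lipNorm μ S' β' a) :
    ∃ σ : ℕ → ℕ, σ 0 = 0 ∧ (∀ n, σ (n + 1) = σ n ∨ σ (n + 1) = σ n + 1) ∧ ∀ n, S' n = S (σ n) := by
  have := hμ.nontrivial
  have hfin (n) : 0 < Module.finrank ℂ (S n) := Module.finrank_pos
  have hfin' (n) : 0 < Module.finrank ℂ (S' n) := Module.finrank_pos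
  have hβ0 (n) : 0 < β n := hβ n ▸ hw _ (hfin n)
  have hβ0' (n) : 0 < β' n := hβ' n ▸ hw _ (hfin' n)
  have hanti : StrictAnti β := fun m n hmn => by
    rw [hβ, hβ]
    exact hwa _ _ (hfin m) (hSs hmn)
  -- Equality of the heads belongs to the invariant: it is what isolates the tails at the next step.
  let P (n q : ℕ) : Prop := S' n = S q ∧
    ∀ a, lipSup μ S' β' (Set.Iic n) a = lipSup μ S β (Set.Iic q) a
  have hbase : P 0 0 := by
    refine ⟨h0, fun a => ?_⟩
    have hI : Set.Iic 0 = ({0} : Set ℕ) := by ext j; simp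
    have hb : β' 0 = β 0 := by rw [hβ, hβ', h0]
    simp [hI, lipSup, h0, hb]
  have hstep (n q : ℕ) (hP : P n q) : ∃ q', P (n + 1) q' ∧ (q' = q ∨ q' = q + 1) := by
    obtain ⟨hSq, hT⟩ := hP
    -- On a repetition the new term duplicates the previous one, since weights depend on the
    -- dimension alone.
    by_cases heq : S' (n + 1) = S' n
    · refine ⟨q, ⟨heq.trans hSq, fun a => ?_⟩, Or.inl rfl⟩
      rw [lipSup_Iic_succ, heq, ← hT, max_eq_left]
      have hb : β' (n + 1) = β' n := by rw [hβ', hβ', heq]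
      rw [hb]
      exact le_lipSup (Set.mem_Iic.mpr le_rfl) a
    · have hlt : Module.finrank ℂ (S q) < Module.finrank ℂ (S' (n + 1)) := by
        rw [← hSq]
        exact finrank_lt_of_lt (lt_of_le_of_ne (hS' n.le_succ) (Ne.symm heq))
      have hsplit (a) : max (lipSup μ S β (Set.Iic q) a) (lipSup μ S β (Set.Ici (q + 1)) a)
          = max (lipSup μ S β (Set.Iic q) a) (lipSup μ S' β' (Set.Ici (n + 1)) a) := by
        have hu (m : ℕ) : Set.Iic m ∪ Set.Ici (m + 1) = Set.univ := by
          ext j; simp; omega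
        rw [← lipSup_union, hu, ← hT, ← lipSup_union, hu, ← lipNorm_eq_lipSup_univ,
          ← lipNorm_eq_lipSup_univ, hL]
      have hβ1 : β' (n + 1) < β q := by
        rw [hβ, hβ']
        exact hwa _ _ (hfin q) hlt
      -- Both tails vanish on their own first algebra and dominate the common head off it, so the
      -- membership lemma applies with the roles exchanged.
      have hle1 : S (q + 1) ≤ S' (n + 1) := le_of_selfAdjoint_mem fun b hb =>
        mem_of_max_eq_max hμ (S' (n + 1)) (lipSup_add_le hβ0 _) (lipSup_smul _)
          (lipSup_add_le hβ0 _) (lipSup_smul _) (lipSup_add_le hβ0' _) (lipSup_smul _) hsplit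
          (fun a ha => lipSup_eq_zero_of_mem hμ fun j hj => hS' hj ha)
          (fun v hv hEv => lipSup_Iic_lt hμ hβ0 hanti.antitone
            (fun j hj => (hS hj).trans (hSq ▸ hS' n.le_succ)) rfl hβ1 (hβ0' _)
            (Set.mem_Ici.mpr le_rfl) hv hEv)
          (lipSup_lt_top hμ hS hb) (lipSup_eq_zero_of_mem hμ fun j hj => hS hj hb)
      have hle2 : S' (n + 1) ≤ S (q + 1) := le_of_selfAdjoint_mem fun b hb =>
        mem_of_max_eq_max hμ (S (q + 1)) (lipSup_add_le hβ0 _) (lipSup_smul _)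
          (lipSup_add_le hβ0' _) (lipSup_smul _) (lipSup_add_le hβ0 _) (lipSup_smul _)
          (fun a => (hsplit a).symm)
          (fun a ha => lipSup_eq_zero_of_mem hμ fun j hj => hS hj ha)
          (fun v hv hEv => lipSup_Iic_lt hμ hβ0 hanti.antitone
            (fun j hj => hS (hj.trans q.le_succ)) rfl (hanti q.lt_succ_self) (hβ0 _)
            (Set.mem_Ici.mpr le_rfl) hv hEv)
          (hT b ▸ lipSup_lt_top hμ hS' hb) (lipSup_eq_zero_of_mem hμ fun j hj => hS' hj hb)
      have he : S' (n + 1) = S (q + 1) := le_antisymm hle2 hle1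
      refine ⟨q + 1, ⟨he, fun a => ?_⟩, Or.inr rfl⟩
      have hb : β' (n + 1) = β (q + 1) := by rw [hβ, hβ', he]
      rw [lipSup_Iic_succ, lipSup_Iic_succ, hT, he, hb]
  let F : ∀ n, {q // P n q} := fun n => Nat.rec ⟨0, hbase⟩
    (fun n ih => ⟨(hstep n ih.1 ih.2).choose, (hstep n ih.1 ih.2).choose_spec.1⟩) n
  exact ⟨fun n => (F n).1, rfl, fun n => (hstep n (F n).1 (F n).2).choose_spec.2,
    fun n => (F n).2.1⟩

end Rigidity

/-! ### Spaces with the same initial sizes are close. -/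

section Comparison

variable {A A' Z : Type} [CStarAlgebra A] [CStarAlgebra A'] [CStarAlgebra Z]
  {μ : WeakDual ℂ A} {μ' : WeakDual ℂ A'} {S : ℕ → StarSubalgebra ℂ A}
  {S' : ℕ → StarSubalgebra ℂ A'} [∀ n, FiniteDimensional ℂ (S n)]
  [∀ n, FiniteDimensional ℂ (S' n)] {β β' : ℕ → ℝ}

/-- For `n ≤ N` the expectation of `ρ z` is determined inside `Z` by the trace and the position of
the `n`-th subalgebra, which are the same on both sides; for `n ≥ N` both terms vanish. -/
theorem lipNorm_saMap_eq (hμ : IsFaithfulTracialState μ) (hμ' : IsFaithfulTracialState μ')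
    (hS : Monotone S) (hS' : Monotone S') {ρ : Z →⋆ₐ[ℂ] A} {ρ' : Z →⋆ₐ[ℂ] A'}
    (hρ : Function.Injective ρ) (hρ' : Function.Injective ρ') {N : ℕ} (hN : ρ.range = S N)
    (hN' : ρ'.range = S' N) (hβ : ∀ n ≤ N, β n = β' n)
    (hmem : ∀ n ≤ N, ∀ z, ρ z ∈ S n ↔ ρ' z ∈ S' n) (htr : ∀ z, μ (ρ z) = μ' (ρ' z))
    (z : selfAdjoint Z) :
    lipNorm μ S β (saMap ρ z) = lipNorm μ' S' β' (saMap ρ' z) := by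
  refine iSup_congr fun n => ?_
  rw [coe_saMap, coe_saMap]
  have hz : ρ z ∈ S N := hN ▸ ⟨z, rfl⟩
  have hz' : ρ' z ∈ S' N := hN' ▸ ⟨z, rfl⟩
  rcases le_total N n with h | h
  · rw [condExp_of_mem hμ _ (hS h hz), condExp_of_mem hμ' _ (hS' h hz')]
    simp
  · have hEN : condExp μ (S n) (ρ z) ∈ ρ.range := hN ▸ hS h (condExp_mem hμ (S n) (ρ z))
    obtain ⟨y, hy⟩ := hEN
    change ρ y = _ at hy
    have hyn : ρ y ∈ S n := hy ▸ condExp_mem hμ (S n) (ρ z)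
    have hy' : condExp μ' (S' n) (ρ' z) = ρ' y := by
      refine condExp_eq_of_forall hμ' _ ((hmem n h y).mp hyn) fun s hs => ?_
      have hs2 : s ∈ ρ'.range := hN' ▸ hS' h hs
      obtain ⟨t, rfl⟩ := hs2
      change μ' (ρ' y * ρ' t) = μ' (ρ' z * ρ' t)
      rw [← map_mul ρ', ← map_mul ρ', ← htr, ← htr, map_mul ρ, map_mul ρ, hy]
      exact trace_condExp_mul hμ _ _ ((hmem n h t).mpr hs)
    rw [← hy, hy', ← map_sub, ← map_sub, NonUnitalStarAlgHom.norm_map ρ hρ,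
      NonUnitalStarAlgHom.norm_map ρ' hρ', hβ n h]

end Comparison

section Limits

variable {I : InductiveSequence} {A : Type} [CStarAlgebra A] {ι : ∀ n, I.alg n →⋆ₐ[ℂ] A}

theorem InductiveSequence.IsLimit.monotone_range (h : I.IsLimit A ι) :
    Monotone fun n => (ι n).range :=
  monotone_nat_of_le_succ fun n => by
    rintro _ ⟨a, rfl⟩
    exact ⟨I.map n a, h.compatible n a⟩

theorem finiteDimensional_range {Z : Type} [CStarAlgebra Z] [FiniteDimensional ℂ Z]
    (ρ : Z →⋆ₐ[ℂ] A) : FiniteDimensional ℂ ρ.range :=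
  Module.Finite.of_surjective (ρ.toAlgHom.toLinearMap.rangeRestrict) (by
    exact ρ.toAlgHom.toLinearMap.surjective_rangeRestrict)

theorem finrank_range {Z : Type} [CStarAlgebra Z] {ρ : Z →⋆ₐ[ℂ] A} (hρ : Function.Injective ρ) :
    Module.finrank ℂ ρ.range = Module.finrank ℂ Z :=
  LinearMap.finrank_range_of_inj (f := ρ.toAlgHom.toLinearMap) hρ

theorem range_eq_bot_of_equiv {Z : Type} [CStarAlgebra Z] (e : Nonempty (Z ≃⋆ₐ[ℂ] ℂ))
    (ρ : Z →⋆ₐ[ℂ] A) : ρ.range = ⊥ := by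
  obtain ⟨e⟩ := e
  rw [eq_bot_iff]
  rintro _ ⟨z, rfl⟩
  refine StarSubalgebra.mem_bot.mpr ⟨e z, ?_⟩
  have hz : z = e z • (1 : Z) := by
    apply e.injective
    change e z = e (e z • 1)
    rw [map_smul, map_one e, smul_eq_mul, mul_one]
  change _ = ρ z
  conv_rhs => rw [hz]
  rw [map_smul, map_one, Algebra.algebraMap_eq_smul_one]

/-- Each isomorphism is chosen to extend the previous one, so that it respects all the earlier
stages. An arbitrary isomorphism of the `N`-th stages would not. -/
theorem exists_chain_equiv {I' : InductiveSequence} {A' : Type} [CStarAlgebra A']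
    {ι' : ∀ n, I'.alg n →⋆ₐ[ℂ] A'} (h : I.IsLimit A ι) (h' : I'.IsLimit A' ι') {q : ℕ → ℕ}
    (hq : ∀ n, 0 < q n) (N : ℕ)
    (e : ∀ n ≤ N, Nonempty (I.alg n ≃⋆ₐ[ℂ] Matrix (Fin (q n)) (Fin (q n)) ℂ))
    (e' : ∀ n ≤ N, Nonempty (I'.alg n ≃⋆ₐ[ℂ] Matrix (Fin (q n)) (Fin (q n)) ℂ)) :
    ∃ ψ : I.alg N ≃⋆ₐ[ℂ] I'.alg N,
      ∀ n ≤ N, ∀ a, ι N a ∈ (ι n).range ↔ ι' N (ψ a) ∈ (ι' n).range := by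
  induction N with
  | zero =>
    obtain ⟨e⟩ := e 0 le_rfl
    obtain ⟨e'⟩ := e' 0 le_rfl
    refine ⟨e.trans e'.symm, fun n hn a => ?_⟩
    obtain rfl := Nat.le_zero.mp hn
    exact ⟨fun _ => ⟨_, rfl⟩, fun _ => ⟨_, rfl⟩⟩
  | succ N ih =>
    obtain ⟨ψ, hψ⟩ := ih (fun n hn => e n (hn.trans N.le_succ)) fun n hn => e' n (hn.trans N.le_succ)
    obtain ⟨e₁⟩ := e N N.le_succ
    obtain ⟨e₂⟩ := e (N + 1) le_rfl
    obtain ⟨e₂'⟩ := e' (N + 1) le_rfl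
    obtain ⟨χ, hχ⟩ := exists_starAlgEquiv_extending (hq N) e₁ e₂ e₂' (I.map N)
      ((I'.map N).comp (ψ : I.alg N →⋆ₐ[ℂ] I'.alg N))
    replace hχ (z) : χ (I.map N z) = I'.map N (ψ z) := hχ z
    refine ⟨χ, fun n hn a => ?_⟩
    rcases Nat.le_succ_iff.mp hn with hn | rfl
    · constructor
      · intro ha
        obtain ⟨b, hb⟩ := h.monotone_range hn ha
        obtain rfl : I.map N b = a := h.injective (N + 1) ((h.compatible N b).trans hb)
        rw [h.compatible, hψ n hn] at ha
        rwa [hχ, h'.compatible]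
      · intro ha
        obtain ⟨b, hb⟩ := h'.monotone_range hn ha
        obtain ⟨c, rfl⟩ := ψ.surjective b
        have h1 : χ a = χ (I.map N c) := by
          rw [hχ]
          exact (h'.injective (N + 1) ((h'.compatible N _).trans hb)).symm
        obtain rfl := χ.injective h1
        rw [hχ, h'.compatible, ← hψ n hn] at ha
        rwa [h.compatible]
    · exact ⟨fun _ => ⟨_, rfl⟩, fun _ => ⟨_, rfl⟩⟩

/-- Two AF spaces given by sequences of matrix algebras which agree up to `N` are close. -/
theorem propinquity_le_of_agree {X X' : QQCMS 2 0} {I' : InductiveSequence}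
    {ι : ∀ n, I.alg n →⋆ₐ[ℂ] X.carrier} {ι' : ∀ n, I'.alg n →⋆ₐ[ℂ] X'.carrier}
    {μ : WeakDual ℂ X.carrier} {μ' : WeakDual ℂ X'.carrier} {β β' : ℕ → ℝ}
    (h : IsAFSpace X I ι μ β) (h' : IsAFSpace X' I' ι' μ' β') (hβ0 : ∀ n, 0 < β n)
    (hβ0' : ∀ n, 0 < β' n) {q : ℕ → ℕ} (hq : ∀ n, 0 < q n) {N : ℕ}
    (e : ∀ n ≤ N, Nonempty (I.alg n ≃⋆ₐ[ℂ] Matrix (Fin (q n)) (Fin (q n)) ℂ))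
    (e' : ∀ n ≤ N, Nonempty (I'.alg n ≃⋆ₐ[ℂ] Matrix (Fin (q n)) (Fin (q n)) ℂ))
    (hβ : ∀ n ≤ N, β n = β' n) :
    propinquity X X' ≤ ENNReal.ofReal (β N) + ENNReal.ofReal (β N) := by
  have hμ := h.trace
  have hμ' := h'.trace
  have : ∀ n, FiniteDimensional ℂ (I.alg n) := fun n => h.finiteDimensional n
  have : ∀ n, FiniteDimensional ℂ (I'.alg n) := fun n => h'.finiteDimensional n
  have : ∀ n, FiniteDimensional ℂ (ι n).range := fun n => finiteDimensional_range (ι n)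
  have : ∀ n, FiniteDimensional ℂ (ι' n).range := fun n => finiteDimensional_range (ι' n)
  have hLX : X.L = lipNorm μ (fun n => (ι n).range) β := funext h.lip
  have hLX' : X'.L = lipNorm μ' (fun n => (ι' n).range) β' := funext h'.lip
  obtain ⟨ψ, hψ⟩ := exists_chain_equiv h.isLimit h'.isLimit hq N e e'
  obtain ⟨eN⟩ := e N le_rfl
  have : Nonempty (Fin (q N)) := ⟨⟨0, hq N⟩⟩
  have : Nontrivial (I.alg N) := eN.toEquiv.nontrivial
  set ρ := ι N
  set ρ' : I.alg N →⋆ₐ[ℂ] X'.carrier := (ι' N).comp (ψ : I.alg N →⋆ₐ[ℂ] I'.alg N)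
  have hρ : Function.Injective ρ := h.isLimit.injective N
  have hρ' : Function.Injective ρ' := (h'.isLimit.injective N).comp ψ.injective
  have hN' : ρ'.range = (ι' N).range := by
    refine le_antisymm ?_ ?_
    · rintro _ ⟨z, rfl⟩
      exact ⟨ψ z, rfl⟩
    · rintro _ ⟨z, rfl⟩
      exact ⟨ψ.symm z, congrArg (ι' N) (ψ.apply_symm_apply z)⟩
  obtain ⟨P, hP, hPE⟩ := exists_isLipRetraction (β := β) hμ h.isLimit.monotone_range hβ0 hρ N rfl
  obtain ⟨P', hP', hPE'⟩ :=
    exists_isLipRetraction (β := β') hμ' h'.isLimit.monotone_range hβ0' hρ' N hN'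
  rw [← hLX] at hP
  rw [← hLX'] at hP'
  have htr (z) : μ (ρ z) = μ' (ρ' z) := by
    refine congrArg (fun k : I.alg N →ₗ[ℂ] ℂ => k z) (eq_of_tracial eN
      (f := (WeakDual.toStrongDual μ).toLinearMap ∘ₗ ρ.toAlgHom.toLinearMap)
      (g := (WeakDual.toStrongDual μ').toLinearMap ∘ₗ ρ'.toAlgHom.toLinearMap)
      (fun x y => ?_) (fun x y => ?_) ?_)
    · change μ (ρ (x * y)) = μ (ρ (y * x))
      rw [map_mul ρ, map_mul ρ, hμ.tracial]
    · change μ' (ρ' (x * y)) = μ' (ρ' (y * x))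
      rw [map_mul ρ', map_mul ρ', hμ'.tracial]
    · change μ (ρ 1) = μ' (ρ' 1)
      rw [map_one ρ, map_one ρ', hμ.mem.1, hμ'.mem.1]
  refine propinquity_le_of_common_retract X X' hP hP' (fun z => ?_) ⟨μ, hμ.mem⟩ ⟨μ', hμ'.mem⟩
    (fun a ha => ?_) fun a ha => ?_
  · rw [hLX, hLX']
    exact lipNorm_saMap_eq hμ hμ' h.isLimit.monotone_range h'.isLimit.monotone_range hρ hρ' rfl hN'
      hβ hψ htr z
  · rw [hPE]
    rw [hLX] at ha
    exact norm_sub_condExp_le_of_lipNorm_le hβ0 ha N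
  · rw [hPE', hβ N le_rfl]
    rw [hLX'] at ha
    exact norm_sub_condExp_le_of_lipNorm_le hβ0' ha N

end Limits

/-! ### Inductive limits with a faithful trace, by the GNS construction of an ultralimit. -/

section InductiveLimit

namespace InductiveSequence

variable (I : InductiveSequence)

/-- The composed connecting maps. -/
def trans {n k : ℕ} (h : n ≤ k) : I.alg n →⋆ₐ[ℂ] I.alg k :=
  Nat.leRec (motive := fun k _ => I.alg n →⋆ₐ[ℂ] I.alg k) (StarAlgHom.id ℂ _)
    (fun k _ f => (I.map k).comp f) h

theorem trans_self (n : ℕ) (x : I.alg n) : I.trans le_rfl x = x := by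
  simp [trans]

theorem trans_succ {n k : ℕ} (h : n ≤ k) (x : I.alg n) :
    I.trans (h.trans k.le_succ) x = I.map k (I.trans h x) := by
  simp [trans, Nat.leRec_succ _ _ h]

theorem trans_map {n k : ℕ} (h : n + 1 ≤ k) (x : I.alg n) :
    I.trans h (I.map n x) = I.trans (n.le_succ.trans h) x := by
  induction k, h using Nat.le_induction with
  | base => rw [trans_self, trans_succ I le_rfl, trans_self]
  | succ k hk ih => rw [trans_succ I hk, ih, ← trans_succ]

/-- The bounded sequence given by an element of `I.alg n`. -/
def seq (n : ℕ) (x : I.alg n) : lp I.alg ∞ :=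
  ⟨fun k => if h : n ≤ k then I.trans h x else 0, memℓp_infty ⟨‖x‖, by
    rintro _ ⟨k, rfl⟩
    dsimp only
    split_ifs with h
    · exact NonUnitalStarAlgHom.norm_apply_le (I.trans h) x
    · simp⟩⟩

theorem seq_apply_of_le {n k : ℕ} (h : n ≤ k) (x : I.alg n) :
    (I.seq n x : ∀ k, I.alg k) k = I.trans h x := dif_pos h

theorem seq_apply_of_not_le {n k : ℕ} (h : ¬ n ≤ k) (x : I.alg n) :
    (I.seq n x : ∀ k, I.alg k) k = 0 := dif_neg h

theorem seq_add (n : ℕ) (x y : I.alg n) : I.seq n (x + y) = I.seq n x + I.seq n y := by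
  refine lp.ext (funext fun k => ?_)
  by_cases h : n ≤ k
  · simp [seq_apply_of_le I h]
  · simp [seq_apply_of_not_le I h]

theorem seq_mul (n : ℕ) (x y : I.alg n) : I.seq n (x * y) = I.seq n x * I.seq n y := by
  refine lp.ext (funext fun k => ?_)
  by_cases h : n ≤ k
  · simp [seq_apply_of_le I h]
  · simp [seq_apply_of_not_le I h]

theorem seq_smul (n : ℕ) (c : ℂ) (x : I.alg n) : I.seq n (c • x) = c • I.seq n x := by
  refine lp.ext (funext fun k => ?_)
  by_cases h : n ≤ k
  · simp [seq_apply_of_le I h]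
  · simp [seq_apply_of_not_le I h]

theorem seq_star (n : ℕ) (x : I.alg n) : I.seq n (star x) = star (I.seq n x) := by
  refine lp.ext (funext fun k => ?_)
  by_cases h : n ≤ k
  · simp [seq_apply_of_le I h, map_star]
  · simp [seq_apply_of_not_le I h]

/-- Starting at index 0 matters: `I.seq n 1` vanishes before `n`, so it is a unit only up to
finitely many coordinates. -/
theorem mul_seq_one (x : lp I.alg ∞) : x * I.seq 0 1 = x := by
  refine lp.ext (funext fun k => ?_)
  simp [seq_apply_of_le I (Nat.zero_le k)]

theorem seq_one_mul_apply {n k : ℕ} (h : n ≤ k) (x : lp I.alg ∞) :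
    (I.seq n 1 * x : lp I.alg ∞) k = x k := by
  simp [seq_apply_of_le I h]

variable {I} {τ : ∀ n, WeakDual ℂ (I.alg n)}

theorem exists_tendsto_trace (hτ : ∀ n, IsFaithfulTracialState (τ n)) (x : lp I.alg ∞) :
    ∃ c : ℂ, Tendsto (fun k => τ k (x k)) (hyperfilter ℕ) (𝓝 c) := by
  have hc : IsCompact (Metric.closedBall (0 : ℂ) ‖x‖) := isCompact_closedBall _ _
  obtain ⟨c, -, h⟩ := hc.ultrafilter_le_nhds ((hyperfilter ℕ).map fun k => τ k (x k)) (by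
    rw [le_principal_iff]
    refine Eventually.of_forall (f := (hyperfilter ℕ : Filter ℕ)) fun k => ?_
    rw [Metric.mem_closedBall, dist_zero_right]
    exact (state_norm_apply_le (hτ k).mem _).trans (lp.norm_apply_le_norm ENNReal.top_ne_zero x k))
  exact ⟨c, h⟩

/-- The limit of the traces along an ultrafilter. -/
def limitTrace (hτ : ∀ n, IsFaithfulTracialState (τ n)) (x : lp I.alg ∞) : ℂ :=
  (exists_tendsto_trace hτ x).choose

theorem tendsto_limitTrace (hτ : ∀ n, IsFaithfulTracialState (τ n)) (x : lp I.alg ∞) :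
    Tendsto (fun k => τ k (x k)) (hyperfilter ℕ) (𝓝 (limitTrace hτ x)) :=
  (exists_tendsto_trace hτ x).choose_spec

theorem limitTrace_eq (hτ : ∀ n, IsFaithfulTracialState (τ n)) {x : lp I.alg ∞} {c : ℂ}
    (h : Tendsto (fun k => τ k (x k)) (hyperfilter ℕ) (𝓝 c)) : limitTrace hτ x = c :=
  tendsto_nhds_unique (tendsto_limitTrace hτ x) h

theorem limitTrace_congr (hτ : ∀ n, IsFaithfulTracialState (τ n)) {x y : lp I.alg ∞} {n : ℕ}
    (h : ∀ k, n ≤ k → x k = y k) : limitTrace hτ x = limitTrace hτ y := by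
  refine limitTrace_eq hτ ((tendsto_limitTrace hτ y).congr' ?_)
  have : ∀ᶠ k in atTop, τ k (y k) = τ k (x k) := by
    filter_upwards [eventually_ge_atTop n] with k hk
    rw [h k hk]
  rw [← Nat.cofinite_eq_atTop] at this
  exact hyperfilter_le_cofinite this

theorem limitTrace_mul_comm (hτ : ∀ n, IsFaithfulTracialState (τ n)) (x y : lp I.alg ∞) :
    limitTrace hτ (x * y) = limitTrace hτ (y * x) := by
  refine limitTrace_eq hτ ((tendsto_limitTrace hτ (y * x)).congr fun k => ?_)
  exact (hτ k).tracial _ _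

theorem trace_trans (hcomp : ∀ n x, τ (n + 1) (I.map n x) = τ n x) {n k : ℕ} (h : n ≤ k)
    (x : I.alg n) : τ k (I.trans h x) = τ n x := by
  induction k, h using Nat.le_induction with
  | base => rw [trans_self]
  | succ k hk ih => rw [trans_succ I hk, hcomp, ih]

theorem limitTrace_seq (hτ : ∀ n, IsFaithfulTracialState (τ n))
    (hcomp : ∀ n x, τ (n + 1) (I.map n x) = τ n x) (n : ℕ) (x : I.alg n) :
    limitTrace hτ (I.seq n x) = τ n x := by
  refine limitTrace_eq hτ (tendsto_const_nhds.congr' ?_)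
  have : ∀ᶠ k in atTop, τ n x = τ k ((I.seq n x : lp I.alg ∞) k) := by
    filter_upwards [eventually_ge_atTop n] with k hk
    rw [seq_apply_of_le I hk, trace_trans hcomp]
  rw [← Nat.cofinite_eq_atTop] at this
  exact hyperfilter_le_cofinite this

/-- The limit of the traces as a positive linear functional. -/
def limitTracePositive (hτ : ∀ n, IsFaithfulTracialState (τ n)) :
    letI := CStarAlgebra.spectralOrder (lp I.alg ∞)
    lp I.alg ∞ →ₚ[ℂ] ℂ :=
  letI := CStarAlgebra.spectralOrder (lp I.alg ∞)
  haveI := CStarAlgebra.spectralOrderedRing (lp I.alg ∞)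
  PositiveLinearMap.mk₀
    { toFun := limitTrace hτ
      map_add' := fun x y => limitTrace_eq hτ
        (((tendsto_limitTrace hτ x).add (tendsto_limitTrace hτ y)).congr fun k => by simp)
      map_smul' := fun c x => limitTrace_eq hτ
        (((tendsto_limitTrace hτ x).const_smul c).congr fun k => by simp) } fun x hx => by
    rw [StarOrderedRing.nonneg_iff] at hx
    induction hx using AddSubmonoid.closure_induction with
    | mem x hx =>
      obtain ⟨y, rfl⟩ := hx
      refine ge_of_tendsto' (tendsto_limitTrace hτ (star y * y)) fun k => ?_
      exact (hτ k).mem.2 (y k)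
    | zero => rw [map_zero]
    | add x y _ _ hx hy =>
      rw [map_add]
      exact add_nonneg hx hy

section GNS

variable (hτ : ∀ n, IsFaithfulTracialState (τ n))

/-- The Hilbert space of the limit of the traces. -/
abbrev limitSpace : Type :=
  letI := CStarAlgebra.spectralOrder (lp I.alg ∞)
  haveI := CStarAlgebra.spectralOrderedRing (lp I.alg ∞)
  (limitTracePositive hτ).GNS

/-- The representation on the Hilbert space of the limit of the traces. -/
def limitRep : lp I.alg ∞ →⋆ₙₐ[ℂ] (limitSpace hτ →L[ℂ] limitSpace hτ) :=
  letI := CStarAlgebra.spectralOrder (lp I.alg ∞)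
  haveI := CStarAlgebra.spectralOrderedRing (lp I.alg ∞)
  (limitTracePositive hτ).gnsNonUnitalStarAlgHom

/-- The vector given by a bounded sequence. -/
def limitVec (x : lp I.alg ∞) : limitSpace hτ :=
  letI := CStarAlgebra.spectralOrder (lp I.alg ∞)
  haveI := CStarAlgebra.spectralOrderedRing (lp I.alg ∞)
  (((limitTracePositive hτ).toPreGNS x : (limitTracePositive hτ).PreGNS) : limitSpace hτ)

theorem limitRep_limitVec (x y : lp I.alg ∞) :
    limitRep hτ x (limitVec hτ y) = limitVec hτ (x * y) := by
  let _ := CStarAlgebra.spectralOrder (lp I.alg ∞)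
  have _ := CStarAlgebra.spectralOrderedRing (lp I.alg ∞)
  exact (limitTracePositive hτ).gnsNonUnitalStarAlgHom_apply_coe

theorem inner_limitVec (x y : lp I.alg ∞) :
    inner ℂ (limitVec hτ x) (limitVec hτ y) = limitTrace hτ (star x * y) := by
  let _ := CStarAlgebra.spectralOrder (lp I.alg ∞)
  have _ := CStarAlgebra.spectralOrderedRing (lp I.alg ∞)
  exact UniformSpace.Completion.inner_coe _ _

theorem norm_limitVec_sq (x : lp I.alg ∞) :
    ((‖limitVec hτ x‖ ^ 2 : ℝ) : ℂ) = limitTrace hτ (star x * x) := by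
  rw [← inner_limitVec, inner_self_eq_norm_sq_to_K]
  push_cast
  rfl

theorem denseRange_limitVec : DenseRange (limitVec hτ) := by
  let _ := CStarAlgebra.spectralOrder (lp I.alg ∞)
  have _ := CStarAlgebra.spectralOrderedRing (lp I.alg ∞)
  exact UniformSpace.Completion.denseRange_coe.comp
    (limitTracePositive hτ).toPreGNS.surjective.denseRange (UniformSpace.Completion.continuous_coe _)

theorem norm_limitRep_le (x : lp I.alg ∞) : ‖limitRep hτ x‖ ≤ ‖x‖ :=
  NonUnitalStarAlgHom.norm_apply_le (limitRep hτ) x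

variable {hτ}

theorem limitVec_sub (x y : lp I.alg ∞) :
    limitVec hτ (x - y) = limitVec hτ x - limitVec hτ y := by
  let _ := CStarAlgebra.spectralOrder (lp I.alg ∞)
  have _ := CStarAlgebra.spectralOrderedRing (lp I.alg ∞)
  change ((((limitTracePositive hτ).toPreGNS (x - y) : (limitTracePositive hτ).PreGNS)) :
    limitSpace hτ) = _
  rw [map_sub, UniformSpace.Completion.coe_sub]
  rfl

/-- The limit trace ignores finitely many coordinates, so the GNS space identifies sequences with
equal tails. This is what makes the maps `limitHom` unital and compatible. -/
theorem limitVec_congr {x y : lp I.alg ∞} {n : ℕ} (h : ∀ k, n ≤ k → x k = y k) :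
    limitVec hτ x = limitVec hτ y := by
  rw [← sub_eq_zero, ← limitVec_sub, ← norm_eq_zero]
  have h0 : limitTrace hτ (star (x - y) * (x - y)) = limitTrace hτ 0 :=
    limitTrace_congr hτ (n := n) fun k hk => by
      have hxy : (x - y : lp I.alg ∞) k = 0 := by simp [h k hk]
      change (star (x - y) : lp I.alg ∞) k * (x - y : lp I.alg ∞) k = 0
      rw [hxy, mul_zero]
  have h1 : limitTrace hτ 0 = 0 := limitTrace_eq hτ (tendsto_const_nhds.congr fun k => by simp)
  have h2 := norm_limitVec_sq hτ (x - y)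
  rw [h0, h1] at h2
  simpa using h2

theorem clm_ext {f g : limitSpace hτ →L[ℂ] limitSpace hτ}
    (h : ∀ y, f (limitVec hτ y) = g (limitVec hτ y)) : f = g := by
  refine ContinuousLinearMap.ext fun x => ?_
  exact congrFun ((denseRange_limitVec hτ).equalizer f.continuous g.continuous (funext h)) x

theorem limitRep_congr {x y : lp I.alg ∞} {n : ℕ} (h : ∀ k, n ≤ k → x k = y k) :
    limitRep hτ x = limitRep hτ y := by
  refine clm_ext fun z => ?_
  rw [limitRep_limitVec, limitRep_limitVec]
  exact limitVec_congr (n := n) fun k hk => by simp [h k hk]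

theorem norm_limitVec_star (x : lp I.alg ∞) : ‖limitVec hτ (star x)‖ = ‖limitVec hτ x‖ := by
  have h := norm_limitVec_sq hτ (star x)
  rw [star_star, limitTrace_mul_comm, ← norm_limitVec_sq, Complex.ofReal_inj] at h
  exact (sq_eq_sq₀ (norm_nonneg _) (norm_nonneg _)).mp h

/-- By the trace property the involution preserves the norm of vectors, which turns right
multiplication into left multiplication. -/
theorem norm_limitVec_mul_le (x y : lp I.alg ∞) :
    ‖limitVec hτ (x * y)‖ ≤ ‖y‖ * ‖limitVec hτ x‖ := by
  rw [← norm_limitVec_star, star_mul, ← limitRep_limitVec, ← norm_limitVec_star x, ← norm_star y]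
  exact ((limitRep hτ (star y)).le_opNorm _).trans
    (mul_le_mul_of_nonneg_right (norm_limitRep_le hτ _) (norm_nonneg _))

variable (hτ)

/-- The representation of `I.alg n` on the Hilbert space of the limit of the traces. -/
def limitHom (n : ℕ) : I.alg n →⋆ₐ[ℂ] (limitSpace hτ →L[ℂ] limitSpace hτ) :=
  have h1 : limitRep hτ (I.seq n 1) = 1 := clm_ext fun y => by
    rw [limitRep_limitVec]
    exact limitVec_congr (n := n) fun k hk => seq_one_mul_apply I hk y
  { toFun := fun x => limitRep hτ (I.seq n x)
    map_one' := h1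
    map_mul' := fun x y => by rw [seq_mul, map_mul]
    map_zero' := by
      rw [← zero_smul ℂ (0 : I.alg n), seq_smul, zero_smul, map_zero]
    map_add' := fun x y => by rw [seq_add, map_add]
    commutes' := fun c => by
      rw [Algebra.algebraMap_eq_smul_one, seq_smul, map_smul, h1, Algebra.algebraMap_eq_smul_one]
    map_star' := fun x => by rw [seq_star, map_star] }

theorem limitHom_apply (n : ℕ) (x : I.alg n) : limitHom hτ n x = limitRep hτ (I.seq n x) := rfl

theorem limitHom_map (n : ℕ) (x : I.alg n) : limitHom hτ (n + 1) (I.map n x) = limitHom hτ n x :=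
  limitRep_congr (n := n + 1) fun k hk => by
    rw [seq_apply_of_le I hk, seq_apply_of_le I (n.le_succ.trans hk), trans_map]

theorem monotone_range_limitHom : Monotone fun n => (limitHom hτ n).range :=
  monotone_nat_of_le_succ fun n => by
    rintro _ ⟨a, rfl⟩
    exact ⟨I.map n a, limitHom_map hτ n a⟩

/-- The union of the images of the algebras `I.alg n`. -/
def limitUnion : StarSubalgebra ℂ (limitSpace hτ →L[ℂ] limitSpace hτ) where
  carrier := ⋃ n, (limitHom hτ n).range
  mul_mem' := by
    intro a b ha hb
    obtain ⟨n, hn⟩ := Set.mem_iUnion.mp ha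
    obtain ⟨m, hm⟩ := Set.mem_iUnion.mp hb
    exact Set.mem_iUnion.mpr ⟨max n m, mul_mem (monotone_range_limitHom hτ (le_max_left n m) hn)
      (monotone_range_limitHom hτ (le_max_right n m) hm)⟩
  add_mem' := by
    intro a b ha hb
    obtain ⟨n, hn⟩ := Set.mem_iUnion.mp ha
    obtain ⟨m, hm⟩ := Set.mem_iUnion.mp hb
    exact Set.mem_iUnion.mpr ⟨max n m, add_mem (monotone_range_limitHom hτ (le_max_left n m) hn)
      (monotone_range_limitHom hτ (le_max_right n m) hm)⟩
  algebraMap_mem' := fun c => Set.mem_iUnion.mpr ⟨0, (limitHom hτ 0).range.algebraMap_mem c⟩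
  star_mem' := by
    intro a ha
    obtain ⟨n, hn⟩ := Set.mem_iUnion.mp ha
    exact Set.mem_iUnion.mpr ⟨n, star_mem hn⟩

/-- The vector state of the limit of the traces. -/
def limitState : (limitSpace hτ →L[ℂ] limitSpace hτ) →L[ℂ] ℂ :=
  (innerSL ℂ (limitVec hτ (I.seq 0 1))).comp
    (ContinuousLinearMap.apply ℂ (limitSpace hτ) (limitVec hτ (I.seq 0 1)))

theorem limitState_apply (a : limitSpace hτ →L[ℂ] limitSpace hτ) :
    limitState hτ a =
      inner ℂ (limitVec hτ (I.seq 0 1)) (a (limitVec hτ (I.seq 0 1))) := rfl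

theorem limitState_limitRep (x : lp I.alg ∞) :
    limitState hτ (limitRep hτ x) = limitTrace hτ x := by
  rw [limitState_apply, limitRep_limitVec, inner_limitVec, mul_seq_one, ← seq_star, star_one]
  exact limitTrace_congr hτ (n := 0) fun k hk => seq_one_mul_apply I hk x

theorem limitState_star_mul_self (a : limitSpace hτ →L[ℂ] limitSpace hτ) :
    limitState hτ (star a * a) = ((‖a (limitVec hτ (I.seq 0 1))‖ ^ 2 : ℝ) : ℂ) := by
  rw [limitState_apply, ContinuousLinearMap.star_eq_adjoint, mul_apply_eq_comp,
    ContinuousLinearMap.adjoint_inner_right, inner_self_eq_norm_sq_to_K]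
  push_cast
  rfl

/-- The identity holds on the union of the stages, where it is that of `limitTrace`, and passes to
the closure in one variable at a time. -/
theorem limitState_mul_comm {a b : limitSpace hτ →L[ℂ] limitSpace hτ}
    (ha : a ∈ closure (limitUnion hτ : Set (limitSpace hτ →L[ℂ] limitSpace hτ)))
    (hb : b ∈ closure (limitUnion hτ : Set (limitSpace hτ →L[ℂ] limitSpace hτ))) :
    limitState hτ (a * b) = limitState hτ (b * a) := by
  have h1 : ∀ a ∈ (limitUnion hτ : Set (limitSpace hτ →L[ℂ] limitSpace hτ)),
      ∀ b ∈ (limitUnion hτ : Set (limitSpace hτ →L[ℂ] limitSpace hτ)),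
      limitState hτ (a * b) = limitState hτ (b * a) := by
    intro a ha b hb
    obtain ⟨n, x, rfl⟩ := Set.mem_iUnion.mp ha
    obtain ⟨m, y, rfl⟩ := Set.mem_iUnion.mp hb
    change limitState hτ (limitRep hτ _ * limitRep hτ _) =
      limitState hτ (limitRep hτ _ * limitRep hτ _)
    rw [← map_mul, ← map_mul, limitState_limitRep, limitState_limitRep, limitTrace_mul_comm]
  have h2 : ∀ a ∈ (limitUnion hτ : Set (limitSpace hτ →L[ℂ] limitSpace hτ)),
      ∀ b ∈ closure (limitUnion hτ : Set (limitSpace hτ →L[ℂ] limitSpace hτ)),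
      limitState hτ (a * b) = limitState hτ (b * a) := fun a ha b hb =>
    closure_minimal (h1 a ha) (isClosed_eq
      ((limitState hτ).continuous.comp (continuous_const.mul continuous_id))
      ((limitState hτ).continuous.comp (continuous_id.mul continuous_const))) hb
  exact closure_minimal (fun a ha => h2 a ha b hb) (isClosed_eq
      ((limitState hτ).continuous.comp (continuous_id.mul continuous_const))
      ((limitState hτ).continuous.comp (continuous_const.mul continuous_id))) ha

theorem norm_apply_limitVec_le {a : limitSpace hτ →L[ℂ] limitSpace hτ}
    (ha : a ∈ closure (limitUnion hτ : Set (limitSpace hτ →L[ℂ] limitSpace hτ)))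
    (y : lp I.alg ∞) : ‖a (limitVec hτ y)‖ ≤ ‖y‖ * ‖a (limitVec hτ (I.seq 0 1))‖ := by
  have hcl : IsClosed {a : limitSpace hτ →L[ℂ] limitSpace hτ |
      ‖a (limitVec hτ y)‖ ≤ ‖y‖ * ‖a (limitVec hτ (I.seq 0 1))‖} :=
    isClosed_le (by fun_prop) (by fun_prop)
  refine closure_minimal (fun b hb => ?_) hcl ha
  obtain ⟨n, x, rfl⟩ := Set.mem_iUnion.mp hb
  change ‖limitRep hτ (I.seq n x) (limitVec hτ y)‖ ≤
    ‖y‖ * ‖limitRep hτ (I.seq n x) (limitVec hτ (I.seq 0 1))‖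
  rw [limitRep_limitVec, limitRep_limitVec, mul_seq_one]
  exact norm_limitVec_mul_le _ _

/-- The trace vector is separating for the closure: right multiplications move it to a dense set of
vectors, and `a` vanishes on these once it vanishes on the trace vector. -/
theorem eq_zero_of_limitState {a : limitSpace hτ →L[ℂ] limitSpace hτ}
    (ha : a ∈ closure (limitUnion hτ : Set (limitSpace hτ →L[ℂ] limitSpace hτ)))
    (h : limitState hτ (star a * a) = 0) : a = 0 := by
  rw [limitState_star_mul_self, Complex.ofReal_eq_zero, sq_eq_zero_iff] at h
  refine clm_ext fun y => ?_
  rw [zero_apply, ← norm_le_zero_iff]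
  simpa [h] using norm_apply_limitVec_le hτ ha y

end GNS

/-- A compatible system of *-morphisms into a C*-algebra with a suitable functional gives a limit
with a faithful tracial state. -/
theorem exists_isLimit_of_functional {𝔇 : Type} [CStarAlgebra 𝔇]
    (hτ : ∀ n, IsFaithfulTracialState (τ n)) {f : ∀ n, I.alg n →⋆ₐ[ℂ] 𝔇}
    (hf : ∀ n x, f (n + 1) (I.map n x) = f n x) {U : StarSubalgebra ℂ 𝔇}
    (hU : (U : Set 𝔇) = ⋃ n, ((f n).range : Set 𝔇)) {s : 𝔇 →L[ℂ] ℂ}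
    (hs : ∀ n x, s (f n x) = τ n x) (hpos : ∀ a, 0 ≤ s (star a * a))
    (hcomm : ∀ a ∈ closure (U : Set 𝔇), ∀ b ∈ closure (U : Set 𝔇), s (a * b) = s (b * a))
    (hfaith : ∀ a ∈ closure (U : Set 𝔇), s (star a * a) = 0 → a = 0) :
    ∃ (A : Type) (_ : CStarAlgebra A) (ι : ∀ n, I.alg n →⋆ₐ[ℂ] A) (μ : WeakDual ℂ A),
      I.IsLimit A ι ∧ IsFaithfulTracialState μ := by
  let T := U.topologicalClosure
  have hT : IsClosed (T : Set 𝔇) := U.isClosed_topologicalClosure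
  have hTc (a : T) : (a : 𝔇) ∈ closure (U : Set 𝔇) := a.2
  have hle : U ≤ T := U.le_topologicalClosure
  have hfU (n) (x : I.alg n) : f n x ∈ U := by
    have : f n x ∈ (U : Set 𝔇) := hU ▸ Set.mem_iUnion.mpr ⟨n, x, rfl⟩
    exact this
  let ι (n) : I.alg n →⋆ₐ[ℂ] T := (f n).codRestrict T fun x => hle (hfU n x)
  let μ : WeakDual ℂ T := StrongDual.toWeakDual (s.comp T.toSubalgebra.toSubmodule.subtypeL)
  have hμ (a : T) : μ a = s a := rfl
  have hμι (n) (x : I.alg n) : μ (ι n x) = τ n x := (hμ _).trans (hs n x)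
  refine ⟨T, inferInstance, ι, μ, ⟨fun n => ?_, fun n a => ?_, ?_⟩, ⟨⟨?_, fun a => ?_⟩, ?_, ?_⟩⟩
  -- Injectivity is a consequence of the faithfulness of the trace on each stage.
  · rw [injective_iff_map_eq_zero]
    intro x hx
    refine (hτ n).faithful x ?_
    rw [← hμι, map_mul, hx, mul_zero, map_zero]
  · exact Subtype.ext (hf n a)
  · have : Dense ((↑) ⁻¹' (U : Set 𝔇) : Set T) := by
      rw [Subtype.dense_iff]
      intro a ha
      have hsub : (U : Set 𝔇) ⊆ (↑) '' ((↑) ⁻¹' (U : Set 𝔇) : Set T) :=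
        fun b hb => ⟨⟨b, hle hb⟩, hb, rfl⟩
      exact closure_mono hsub ha
    refine this.mono fun a ha => ?_
    have ha' : (a : 𝔇) ∈ ⋃ n, ((f n).range : Set 𝔇) := hU ▸ ha
    obtain ⟨n, x, hx⟩ := Set.mem_iUnion.mp ha'
    exact Set.mem_iUnion.mpr ⟨n, x, Subtype.ext hx⟩
  · rw [← map_one (ι 0), hμι, (hτ 0).mem.1]
  · exact hpos a
  · exact fun a b => hcomm a (hTc a) b (hTc b)
  · exact fun a ha => Subtype.ext (hfaith a (hTc a) ha)

/-- An inductive sequence with compatible faithful tracial states has a limit with a faithful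
tracial state. -/
theorem exists_isLimit (hτ : ∀ n, IsFaithfulTracialState (τ n))
    (hcomp : ∀ n x, τ (n + 1) (I.map n x) = τ n x) :
    ∃ (A : Type) (_ : CStarAlgebra A) (ι : ∀ n, I.alg n →⋆ₐ[ℂ] A) (μ : WeakDual ℂ A),
      I.IsLimit A ι ∧ IsFaithfulTracialState μ :=
  exists_isLimit_of_functional hτ (limitHom_map hτ) (U := limitUnion hτ) rfl (s := limitState hτ)
    (fun n x => by rw [limitHom_apply, limitState_limitRep, limitTrace_seq hτ hcomp])
    (fun a => by
      rw [limitState_star_mul_self]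
      exact Complex.zero_le_real.mpr (sq_nonneg _))
    (fun _ ha _ hb => limitState_mul_comm hτ ha hb) fun _ ha => eq_zero_of_limitState hτ ha

end InductiveSequence

end InductiveLimit

/-! ### Realizing every sequence of matrix sizes. -/

section Matrices

theorem exists_blockDiagonal_hom {a b : ℕ} (hb : 0 < b) (h : a ∣ b) :
    ∃ f : Matrix (Fin a) (Fin a) ℂ →⋆ₐ[ℂ] Matrix (Fin b) (Fin b) ℂ, Function.Injective f := by
  obtain ⟨m, rfl⟩ := h
  have hm : 0 < m := Nat.pos_of_mul_pos_left hb
  let e : Fin a × Fin m ≃ Fin (a * m) := finProdFinEquiv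
  let g : Matrix (Fin a) (Fin a) ℂ → Matrix (Fin a × Fin m) (Fin a × Fin m) ℂ :=
    fun x => Matrix.blockDiagonal fun _ => x
  let r := Matrix.reindexAlgEquiv ℂ ℂ e
  have hr (x) : r (star x) = star (r x) := by
    rw [Matrix.star_eq_conjTranspose, Matrix.star_eq_conjTranspose]
    exact (Matrix.conjTranspose_reindex e e x).symm
  have h1 : g 1 = 1 := Matrix.blockDiagonal_one
  refine ⟨{ toFun := fun x => r (g x)
            map_one' := by rw [h1, map_one]
            map_zero' := by
              rw [show g 0 = 0 from Matrix.blockDiagonal_zero, map_zero]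
            map_mul' := fun x y => by
              rw [← map_mul]
              exact congrArg r (Matrix.blockDiagonal_mul (fun _ => x) (fun _ => y))
            map_add' := fun x y => by
              rw [← map_add]
              exact congrArg r (Matrix.blockDiagonal_add (fun _ => x) (fun _ => y))
            commutes' := fun c => by
              have : g (c • 1) = c • g 1 := Matrix.blockDiagonal_smul c fun _ => 1
              rw [Algebra.algebraMap_eq_smul_one, this, map_smul, h1, map_one,
                Algebra.algebraMap_eq_smul_one]
            map_star' := fun x => by
              rw [← hr]
              exact congrArg r (Matrix.blockDiagonal_conjTranspose fun _ => x).symm }, ?_⟩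
  intro x y hxy
  have h2 : g x = g y := r.injective hxy
  exact congrFun (Matrix.blockDiagonal_injective h2) ⟨0, hm⟩

/-- Matrices of size one. -/
def matrixUniqueEquiv (n : Type) [Fintype n] [DecidableEq n] [Unique n] :
    Matrix n n ℂ ≃⋆ₐ[ℂ] ℂ where
  toFun x := x default default
  invFun c := Matrix.of fun _ _ => c
  left_inv x := by
    ext i j
    rw [Subsingleton.elim i default, Subsingleton.elim j default]
    rfl
  right_inv _ := rfl
  map_mul' x y := by
    rw [Matrix.mul_apply, Fintype.sum_subsingleton _ default]
  map_add' _ _ := rfl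
  map_smul' _ _ := rfl
  map_star' _ := rfl

theorem finiteDimensional_of_equiv {Z : Type} [CStarAlgebra Z] {d : ℕ}
    (e : Z ≃⋆ₐ[ℂ] Matrix (Fin d) (Fin d) ℂ) : FiniteDimensional ℂ Z :=
  Module.Finite.of_surjective (e.symm : Matrix (Fin d) (Fin d) ℂ →⋆ₐ[ℂ] Z).toAlgHom.toLinearMap
    e.symm.surjective

theorem finrank_of_equiv {Z : Type} [CStarAlgebra Z] {d : ℕ}
    (e : Z ≃⋆ₐ[ℂ] Matrix (Fin d) (Fin d) ℂ) : Module.finrank ℂ Z = d ^ 2 := by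
  have h : Module.finrank ℂ Z = Module.finrank ℂ (Matrix (Fin d) (Fin d) ℂ) :=
    LinearEquiv.finrank_eq (LinearEquiv.ofBijective
      (e : Z →⋆ₐ[ℂ] Matrix (Fin d) (Fin d) ℂ).toAlgHom.toLinearMap e.bijective)
  rw [h, Module.finrank_matrix]
  simp [sq]

theorem exists_isFaithfulTracialState {Z : Type} [CStarAlgebra Z] {d : ℕ} (hd : 0 < d)
    (e : Z ≃⋆ₐ[ℂ] Matrix (Fin d) (Fin d) ℂ) : ∃ τ : WeakDual ℂ Z, IsFaithfulTracialState τ := by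
  have := finiteDimensional_of_equiv e
  have hd0 : (0 : ℝ) < d := by exact_mod_cast hd
  let t : Z →ₗ[ℂ] ℂ := ((d : ℝ)⁻¹ : ℂ) • Matrix.traceLinearMap (Fin d) ℂ ℂ ∘ₗ
    (e : Z →⋆ₐ[ℂ] Matrix (Fin d) (Fin d) ℂ).toAlgHom.toLinearMap
  have ht (z) : t z = ((d : ℝ)⁻¹ : ℂ) * (e z).trace := rfl
  refine ⟨StrongDual.toWeakDual (LinearMap.toContinuousLinearMap t), ⟨⟨?_, fun a => ?_⟩, ?_, ?_⟩⟩
  · change t 1 = 1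
    have : (d : ℂ) ≠ 0 := by exact_mod_cast hd.ne'
    rw [ht, map_one e]
    simp [this]
  · change 0 ≤ t (star a * a)
    rw [ht, map_mul e, map_star e]
    refine mul_nonneg ?_ (Matrix.posSemidef_conjTranspose_mul_self (e a)).trace_nonneg
    rw [← Complex.ofReal_inv]
    exact Complex.zero_le_real.mpr (inv_pos.mpr hd0).le
  · intro a b
    change t (a * b) = t (b * a)
    rw [ht, ht, map_mul e, map_mul e, Matrix.trace_mul_comm]
  · intro a ha
    change t (star a * a) = 0 at ha
    rw [ht, map_mul e, map_star e] at ha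
    have h2 : ((e a).conjTranspose * e a).trace = 0 := by
      refine (mul_eq_zero.mp ha).resolve_left ?_
      rw [← Complex.ofReal_inv]
      exact_mod_cast (inv_pos.mpr hd0).ne'
    exact e.injective ((Matrix.trace_conjTranspose_mul_self_eq_zero_iff.mp h2).trans
      (map_zero e).symm)

end Matrices

section Sizes

variable {I : InductiveSequence}

/-- The algebras of an inductive sequence are the full matrix algebras of sizes `q n`. -/
def HasSizes (I : InductiveSequence) (q : ℕ → ℕ) : Prop :=
  ∀ n, Nonempty (I.alg n ≃⋆ₐ[ℂ] Matrix (Fin (q n)) (Fin (q n)) ℂ)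

/-- Sequences of sizes of strictly growing unital inclusions of full matrix algebras. -/
structure IsSizeSeq (q : ℕ → ℕ) : Prop where
  zero : q 0 = 1
  dvd : ∀ n, q n ∣ q (n + 1)
  lt : ∀ n, q n < q (n + 1)

theorem IsSizeSeq.strictMono {q : ℕ → ℕ} (h : IsSizeSeq q) : StrictMono q :=
  strictMono_nat_of_lt_succ h.lt

theorem IsSizeSeq.pos {q : ℕ → ℕ} (h : IsSizeSeq q) (n : ℕ) : 0 < q n := by
  have := h.strictMono.monotone (Nat.zero_le n)
  rw [h.zero] at this
  exact this

theorem HasSizes.dim_eq {q : ℕ → ℕ} (h : HasSizes I q) (n : ℕ) : I.dim n = q n ^ 2 :=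
  finrank_of_equiv (h n).some

theorem HasSizes.finiteDimensional {q : ℕ → ℕ} (h : HasSizes I q) (n : ℕ) :
    FiniteDimensional ℂ (I.alg n) :=
  finiteDimensional_of_equiv (h n).some

theorem HasSizes.multiplicity_eq {q : ℕ → ℕ} (h : HasSizes I q) (n : ℕ) :
    I.multiplicity n = (q (n + 1) : ℝ) / q n := by
  rw [InductiveSequence.multiplicity, h.dim_eq, h.dim_eq]
  push_cast
  rw [← div_pow, Real.sqrt_sq (by positivity)]

/-- Dimensions are squares of sizes, so the multiplicity is the quotient of consecutive sizes; its
being an integer at least 2 gives divisibility and growth. -/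
theorem exists_sizes (h : I.IsStrictFull) : ∃ q, IsSizeSeq q ∧ HasSizes I q := by
  choose q hq0 hq using h.full
  have hq' : HasSizes I q := hq
  have hstep (n) : ∃ m, 2 ≤ m ∧ q (n + 1) = q n * m := by
    obtain ⟨m, hm, hm'⟩ := h.strict n
    rw [hq'.multiplicity_eq, div_eq_iff (by exact_mod_cast (hq0 n).ne')] at hm'
    refine ⟨m, hm, ?_⟩
    rw [mul_comm]
    exact_mod_cast hm'
  refine ⟨q, ⟨?_, fun n => ?_, fun n => ?_⟩, hq'⟩
  · obtain ⟨e⟩ := h.zero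
    have h1 : I.dim 0 = 1 := by
      have : Module.finrank ℂ (I.alg 0) = Module.finrank ℂ ℂ :=
        LinearEquiv.finrank_eq (LinearEquiv.ofBijective
          (e : I.alg 0 →⋆ₐ[ℂ] ℂ).toAlgHom.toLinearMap e.bijective)
      rwa [Module.finrank_self] at this
    rw [hq'.dim_eq] at h1
    exact Nat.pow_eq_one.mp h1 |>.resolve_right two_ne_zero
  · obtain ⟨m, -, hm⟩ := hstep n
    exact ⟨m, hm⟩
  · obtain ⟨m, hm2, hm⟩ := hstep n
    have := hq0 n
    rw [hm]
    nlinarith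

/-- Every sequence of sizes is realized by a limit with a faithful tracial state. -/
theorem exists_limit_of_sizes {q : ℕ → ℕ} (hq : IsSizeSeq q) :
    ∃ (I : InductiveSequence) (A : Type) (_ : CStarAlgebra A) (ι : ∀ n, I.alg n →⋆ₐ[ℂ] A)
      (μ : WeakDual ℂ A), HasSizes I q ∧ Nonempty (I.alg 0 ≃⋆ₐ[ℂ] ℂ) ∧ I.IsLimit A ι ∧
        IsFaithfulTracialState μ := by
  choose f hf using fun n => exists_blockDiagonal_hom (hq.pos (n + 1)) (hq.dvd n)
  let e (n : ℕ) : Matrix (Fin (q n)) (Fin (q n)) ℂ ≃⋆ₐ[ℂ] CStarMatrix (Fin (q n)) (Fin (q n)) ℂ :=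
    CStarMatrix.ofMatrixStarAlgEquiv
  let I : InductiveSequence :=
    { alg := fun n => CStarMatrix (Fin (q n)) (Fin (q n)) ℂ
      map := fun n => (e (n + 1) : _ →⋆ₐ[ℂ] CStarMatrix (Fin (q (n + 1))) (Fin (q (n + 1))) ℂ).comp
        ((f n).comp ((e n).symm : CStarMatrix (Fin (q n)) (Fin (q n)) ℂ →⋆ₐ[ℂ] _))
      map_injective := fun n => (e (n + 1)).injective.comp ((hf n).comp (e n).symm.injective) }
  have hI : HasSizes I q := fun n => ⟨(e n).symm⟩
  have h0 : Nonempty (I.alg 0 ≃⋆ₐ[ℂ] ℂ) := by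
    have : Unique (Fin (q 0)) := by rw [hq.zero]; infer_instance
    exact ⟨(e 0).symm.trans (matrixUniqueEquiv (Fin (q 0)))⟩
  choose τ hτ using fun n => exists_isFaithfulTracialState (hq.pos n) (hI n).some
  -- Compatibility is automatic, as both sides are normalized traces of a full matrix algebra.
  have hcomp n (x : I.alg n) : τ (n + 1) (I.map n x) = τ n x := by
    refine congrArg (fun k : I.alg n →ₗ[ℂ] ℂ => k x) (eq_of_tracial (hI n).some
      (f := (WeakDual.toStrongDual (τ (n + 1))).toLinearMap ∘ₗ (I.map n).toAlgHom.toLinearMap)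
      (g := (WeakDual.toStrongDual (τ n)).toLinearMap)
      (fun x y => ?_) (fun x y => ?_) ?_)
    · change τ (n + 1) (I.map n (x * y)) = τ (n + 1) (I.map n (y * x))
      rw [map_mul (I.map n), map_mul (I.map n), (hτ (n + 1)).tracial]
    · exact (hτ n).tracial x y
    · change τ (n + 1) (I.map n 1) = τ n 1
      rw [map_one (I.map n), (hτ (n + 1)).mem.1, (hτ n).mem.1]
  obtain ⟨A, hA, ι, μ, h1, h2⟩ := InductiveSequence.exists_isLimit hτ hcomp
  exact ⟨I, A, hA, ι, μ, hI, h0, h1, h2⟩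

end Sizes

section Classes

variable {k : ℝ} {q σ : ℕ → ℕ} {I : InductiveSequence} {X : QQCMS 2 0}

theorem HasSizes.weight_eq (hI : HasSizes I q) (n : ℕ) :
    1 / (I.dim n : ℝ) ^ k = 1 / ((q n ^ 2 : ℕ) : ℝ) ^ k := by
  rw [hI.dim_eq]

theorem IsSizeSeq.weight_pos (hq : IsSizeSeq q) (n : ℕ) : 0 < 1 / ((q n ^ 2 : ℕ) : ℝ) ^ k := by
  have h : (0 : ℝ) < (q n ^ 2 : ℕ) := by exact_mod_cast pow_pos (hq.pos n) 2
  positivity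

theorem IsSizeSeq.tendsto_weight (hk : 0 < k) (hq : IsSizeSeq q) :
    Tendsto (fun n => 1 / ((q n ^ 2 : ℕ) : ℝ) ^ k) atTop (𝓝 0) := by
  simp only [one_div]
  refine ((tendsto_rpow_atTop hk).comp (tendsto_natCast_atTop_atTop.comp ?_)).inv_tendsto_atTop
  refine tendsto_atTop_mono (fun n => ?_) tendsto_id
  exact (hq.strictMono.le_apply (x := n)).trans (Nat.le_self_pow two_ne_zero _)

theorem HasSizes.isStrictFull (hI : HasSizes I q) (hq : IsSizeSeq q)
    (h0 : Nonempty (I.alg 0 ≃⋆ₐ[ℂ] ℂ)) : I.IsStrictFull where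
  full n := ⟨q n, hq.pos n, hI n⟩
  zero := h0
  strict n := by
    obtain ⟨m, hm⟩ := hq.dvd n
    have hlt := hq.lt n
    have hpos : (q n : ℝ) ≠ 0 := by exact_mod_cast (hq.pos n).ne'
    refine ⟨m, ?_, ?_⟩
    · by_contra! h
      interval_cases m <;> omega
    · rw [hI.multiplicity_eq, hm]
      push_cast
      field_simp

theorem not_finiteDimensional_of_sizes {ι : ∀ n, I.alg n →⋆ₐ[ℂ] X.carrier}
    (hI : HasSizes I q) (hq : IsSizeSeq q) (h : ∀ n, Function.Injective (ι n)) :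
    ¬ FiniteDimensional ℂ X.carrier := by
  intro hX
  have h1 (n) : n ≤ Module.finrank ℂ X.carrier := by
    have h2 : I.dim n ≤ Module.finrank ℂ X.carrier :=
      LinearMap.finrank_le_finrank_of_injective (f := (ι n).toAlgHom.toLinearMap) (h n)
    rw [hI.dim_eq] at h2
    exact (hq.strictMono.le_apply (x := n)).trans ((Nat.le_self_pow two_ne_zero _).trans h2)
  exact absurd (h1 (Module.finrank ℂ X.carrier + 1)) (by omega)

theorem IsAFSpace.mem_AFk (hk : 0 < k) {ι : ∀ n, I.alg n →⋆ₐ[ℂ] X.carrier}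
    {μ : WeakDual ℂ X.carrier} (h : IsAFSpace X I ι μ fun n => 1 / (I.dim n : ℝ) ^ k)
    (hI : HasSizes I q) (hq : IsSizeSeq q) : X ∈ AFk k := by
  refine ⟨⟨I, ι, μ, _, fun n => ?_, ?_, h⟩,
    not_finiteDimensional_of_sizes hI hq h.isLimit.injective, I, ι, μ, h⟩
  · rw [hI.weight_eq]
    exact hq.weight_pos n
  · simp only [hI.weight_eq]
    exact hq.tendsto_weight hk

theorem IsAFSpace.mem_UHFk (hk : 0 < k) {ι : ∀ n, I.alg n →⋆ₐ[ℂ] X.carrier}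
    {μ : WeakDual ℂ X.carrier} (h : IsAFSpace X I ι μ fun n => 1 / (I.dim n : ℝ) ^ k)
    (hI : HasSizes I q) (hq : IsSizeSeq q) : X ∈ UHFk k :=
  ⟨h.mem_AFk hk hI hq, I, hI.isStrictFull hq h.zero, ι, μ, h⟩

/-- Every sequence of sizes is realized by a quantum compact metric space. -/
theorem exists_isAFSpace_of_sizes (hk : 0 < k) (hq : IsSizeSeq q) :
    ∃ (X : QQCMS 2 0) (I : InductiveSequence) (ι : ∀ n, I.alg n →⋆ₐ[ℂ] X.carrier)
      (μ : WeakDual ℂ X.carrier), HasSizes I q ∧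
        IsAFSpace X I ι μ fun n => 1 / (I.dim n : ℝ) ^ k := by
  obtain ⟨I, A, _, ι, μ, hI, h0, hlim, hμ⟩ := exists_limit_of_sizes hq
  have : ∀ n, FiniteDimensional ℂ (I.alg n) := hI.finiteDimensional
  have : ∀ n, FiniteDimensional ℂ (ι n).range := fun n => finiteDimensional_range (ι n)
  have hβ (n) : 0 < 1 / (I.dim n : ℝ) ^ k := by
    rw [hI.weight_eq]
    exact hq.weight_pos n
  have hβ0 : Tendsto (fun n => 1 / (I.dim n : ℝ) ^ k) atTop (𝓝 0) := by
    simp only [hI.weight_eq]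
    exact hq.tendsto_weight hk
  exact ⟨QQCMS.ofFiltration hμ hlim.monotone_range (range_eq_bot_of_equiv h0 (ι 0)) hlim.dense
    hβ hβ0, I, ι, μ, hI, ⟨hI.finiteDimensional, h0, hlim, hμ, fun _ => rfl⟩⟩

end Classes

/-! ### Repeating stages of a filtration. -/

section Reindexing

variable {I : InductiveSequence}

theorem InductiveSequence.trans_injective {n m : ℕ} (h : n ≤ m) :
    Function.Injective (I.trans h) := by
  induction m, h using Nat.le_induction with
  | base => exact fun x y hxy => by rwa [trans_self, trans_self] at hxy
  | succ m hm ih =>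
    intro x y hxy
    rw [trans_succ I hm, trans_succ I hm] at hxy
    exact ih (I.map_injective m hxy)

theorem InductiveSequence.IsLimit.apply_trans {A : Type} [CStarAlgebra A]
    {ι : ∀ n, I.alg n →⋆ₐ[ℂ] A} (h : I.IsLimit A ι) {n m : ℕ} (hnm : n ≤ m) (x : I.alg n) :
    ι m (I.trans hnm x) = ι n x := by
  induction m, hnm using Nat.le_induction with
  | base => rw [trans_self]
  | succ m hm ih => rw [trans_succ I hm, h.compatible, ih]

variable (I) in
/-- The inductive sequence with algebras `I.alg (σ n)`. -/
def InductiveSequence.reindex {σ : ℕ → ℕ} (hσ : Monotone σ) : InductiveSequence where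
  alg n := I.alg (σ n)
  map n := I.trans (hσ n.le_succ)
  map_injective n := trans_injective (hσ n.le_succ)

/-- A surjective reindexing changes neither the union of the stages nor the supremum defining the
Lip-norm. -/
theorem IsAFSpace.reindex {X : QQCMS 2 0} {ι : ∀ n, I.alg n →⋆ₐ[ℂ] X.carrier}
    {μ : WeakDual ℂ X.carrier} {β : ℕ → ℝ} (h : IsAFSpace X I ι μ β) {σ : ℕ → ℕ}
    (hσ : Monotone σ) (h0 : σ 0 = 0) (hs : Function.Surjective σ) :
    IsAFSpace X (I.reindex hσ) (fun n => ι (σ n)) μ fun n => β (σ n) where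
  finiteDimensional n := h.finiteDimensional (σ n)
  zero := by
    change Nonempty (I.alg (σ 0) ≃⋆ₐ[ℂ] ℂ)
    rw [h0]
    exact h.zero
  isLimit :=
    { injective := fun n => h.isLimit.injective (σ n)
      compatible := fun n => h.isLimit.apply_trans (hσ n.le_succ)
      dense := by
        have := hs.iUnion_comp fun n => Set.range (ι n)
        change Dense (⋃ n, Set.range (ι (σ n)))
        rw [this]
        exact h.isLimit.dense }
  trace := h.trace
  lip a := (h.lip a).trans (hs.iSup_comp (g := fun n =>
    ENNReal.ofReal (‖(a : X.carrier) - condExp μ (ι n).range a‖ / β n))).symm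

/-- A functional with `φ 1 = 1` and the trace property is unique on a limit of matrix algebras. -/
theorem IsFaithfulTracialState.unique {A : Type} [CStarAlgebra A] {ι : ∀ n, I.alg n →⋆ₐ[ℂ] A}
    (h : I.IsLimit A ι) {q : ℕ → ℕ} (hI : HasSizes I q) {μ μ' : WeakDual ℂ A}
    (hμ : IsFaithfulTracialState μ) (hμ' : IsFaithfulTracialState μ') : μ = μ' := by
  have key (n) (z : I.alg n) : μ (ι n z) = μ' (ι n z) := by
    refine congrArg (fun k : I.alg n →ₗ[ℂ] ℂ => k z) (eq_of_tracial (hI n).some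
      (f := (WeakDual.toStrongDual μ).toLinearMap ∘ₗ (ι n).toAlgHom.toLinearMap)
      (g := (WeakDual.toStrongDual μ').toLinearMap ∘ₗ (ι n).toAlgHom.toLinearMap)
      (fun x y => ?_) (fun x y => ?_) ?_)
    · change μ (ι n (x * y)) = μ (ι n (y * x))
      rw [map_mul (ι n), map_mul (ι n), hμ.tracial]
    · change μ' (ι n (x * y)) = μ' (ι n (y * x))
      rw [map_mul (ι n), map_mul (ι n), hμ'.tracial]
    · change μ (ι n 1) = μ' (ι n 1)
      rw [map_one (ι n), hμ.mem.1, hμ'.mem.1]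
  have hfun : (fun a => μ a) = fun a => μ' a :=
    Continuous.ext_on h.dense (map_continuous (WeakDual.toStrongDual μ))
      (map_continuous (WeakDual.toStrongDual μ')) (by
        intro a ha
        obtain ⟨n, z, rfl⟩ := Set.mem_iUnion.mp ha
        exact key n z)
  exact DFunLike.ext _ _ fun a => congrFun hfun a

end Reindexing

/-! ### Admissible pairs of integer sequences and compactness. -/

section Admissible

/-- Sizes `q` of a strict sequence of matrix algebras together with a reindexing `σ` with steps
at most one for which the dimensions `q (σ n) ^ 2` obey the bounds `2 ^ n` and `B n`. -/
structure IsAdmissible (B q σ : ℕ → ℕ) : Prop where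
  size : IsSizeSeq q
  zero : σ 0 = 0
  step : ∀ n, σ (n + 1) = σ n ∨ σ (n + 1) = σ n + 1
  lower : ∀ n, 2 ^ n ≤ q (σ n) ^ 2
  upper : ∀ n, q (σ n) ^ 2 ≤ B n

variable {k : ℝ} {B q σ : ℕ → ℕ} {X : QQCMS 2 0} {I : InductiveSequence}

theorem IsAdmissible.monotone (h : IsAdmissible B q σ) : Monotone σ :=
  monotone_nat_of_le_succ fun n => by
    rcases h.step n with h | h <;> omega

theorem IsAdmissible.le_self (h : IsAdmissible B q σ) (n : ℕ) : σ n ≤ n := by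
  induction n with
  | zero => rw [h.zero]
  | succ n ih => rcases h.step n with h | h <;> omega

/-- At `n = q j ^ 2` the lower bound `2 ^ n` already exceeds `q j ^ 2`, so `σ` has passed `j`. -/
theorem IsAdmissible.lt_apply (h : IsAdmissible B q σ) (j : ℕ) : j < σ (q j ^ 2) := by
  have h1 : q j ^ 2 < q (σ (q j ^ 2)) ^ 2 := Nat.lt_two_pow_self.trans_le (h.lower _)
  exact h.size.strictMono.lt_iff_lt.mp (lt_of_pow_lt_pow_left₀ 2 (Nat.zero_le _) h1)

theorem IsAdmissible.surjective (h : IsAdmissible B q σ) : Function.Surjective σ := by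
  have key (n) : ∀ j ≤ σ n, ∃ m, σ m = j := by
    induction n with
    | zero =>
      intro j hj
      exact ⟨0, by rw [h.zero] at hj ⊢; omega⟩
    | succ n ih =>
      intro j hj
      rcases Nat.lt_or_ge (σ n) j with hlt | hle
      · exact ⟨n + 1, by rcases h.step n with h | h <;> omega⟩
      · exact ih j hle
  exact fun j => key _ j (h.lt_apply j).le

/-- An upper bound for the sizes of an admissible sequence. -/
def sizeBound (B : ℕ → ℕ) : ℕ → ℕ
  | 0 => 1
  | j + 1 => ∑ i ∈ Finset.range (sizeBound B j ^ 2 + 1), B i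

/-- Since `σ` passes `j` by the time `q j ^ 2`, the next size is at most `B (q j ^ 2)`. Only a bound
on `q j` is known in advance, hence the sum over all possible indices in `sizeBound`. -/
theorem IsAdmissible.le_sizeBound (h : IsAdmissible B q σ) (j : ℕ) : q j ≤ sizeBound B j := by
  induction j with
  | zero => rw [h.size.zero, sizeBound]
  | succ j ih =>
    have h1 : q (j + 1) ≤ q (σ (q j ^ 2)) := h.size.strictMono.monotone (h.lt_apply j)
    have h2 : q j ^ 2 ∈ Finset.range (sizeBound B j ^ 2 + 1) :=
      Finset.mem_range.mpr (Nat.lt_succ_of_le (Nat.pow_le_pow_left ih 2))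
    calc q (j + 1) ≤ q (σ (q j ^ 2)) := h1
      _ ≤ q (σ (q j ^ 2)) ^ 2 := Nat.le_self_pow two_ne_zero _
      _ ≤ B (q j ^ 2) := h.upper _
      _ ≤ _ := Finset.single_le_sum (f := B) (fun _ _ => Nat.zero_le _) h2

theorem IsAFSpace.mem_inter (hk : 0 < k) {ι : ∀ n, I.alg n →⋆ₐ[ℂ] X.carrier}
    {μ : WeakDual ℂ X.carrier} (h : IsAFSpace X I ι μ fun n => 1 / (I.dim n : ℝ) ^ k)
    (hI : HasSizes I q) (ha : IsAdmissible B q σ) :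
    X ∈ UHFk k ∩ AFkBounded k (fun n => 2 ^ n) B := by
  refine ⟨h.mem_UHFk hk hI ha.size, h.mem_AFk hk hI ha.size, I.reindex ha.monotone,
    ⟨_, μ, h.reindex ha.monotone ha.zero ha.surjective⟩, fun n => ?_⟩
  change 2 ^ n ≤ I.dim (σ n) ∧ I.dim (σ n) ≤ B n
  rw [hI.dim_eq]
  exact ⟨ha.lower n, ha.upper n⟩

/-- The two presentations of `X`, one by matrix algebras and one within the bounds, give the same
Lip-norm; rigidity makes the second a reindexing of the first. -/
theorem exists_isAdmissible (hk : 0 < k) (h : X ∈ UHFk k ∩ AFkBounded k (fun n => 2 ^ n) B) :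
    ∃ (q σ : ℕ → ℕ) (I : InductiveSequence) (ι : ∀ n, I.alg n →⋆ₐ[ℂ] X.carrier)
      (μ : WeakDual ℂ X.carrier), IsAdmissible B q σ ∧ HasSizes I q ∧
        IsAFSpace X I ι μ fun n => 1 / (I.dim n : ℝ) ^ k := by
  obtain ⟨⟨-, I, hstrict, ι, μ, hX⟩, -, I', ⟨ι', μ', hX'⟩, hB⟩ := h
  obtain ⟨q, hq, hI⟩ := exists_sizes hstrict
  -- The presentations come with their own traces, which must coincide before their Lip-norms can be
  -- compared.
  obtain rfl := hX.trace.unique hX.isLimit hI hX'.trace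
  have : ∀ n, FiniteDimensional ℂ (I.alg n) := hX.finiteDimensional
  have : ∀ n, FiniteDimensional ℂ (I'.alg n) := hX'.finiteDimensional
  have : ∀ n, FiniteDimensional ℂ (ι n).range := fun n => finiteDimensional_range (ι n)
  have : ∀ n, FiniteDimensional ℂ (ι' n).range := fun n => finiteDimensional_range (ι' n)
  have hr (n) : Module.finrank ℂ (ι n).range = q n ^ 2 :=
    (finrank_range (hX.isLimit.injective n)).trans (hI.dim_eq n)
  have hr' (n) : Module.finrank ℂ (ι' n).range = I'.dim n :=
    finrank_range (hX'.isLimit.injective n)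
  obtain ⟨σ, h0, hstep, hσ⟩ := exists_reindexing (S := fun n => (ι n).range)
    (S' := fun n => (ι' n).range) (w := fun d => 1 / (d : ℝ) ^ k) hX.trace
    (fun n hn => by
      have : (0 : ℝ) < n := by exact_mod_cast hn
      positivity)
    (fun m n hm hmn => by
      have hm' : (0 : ℝ) < m := by exact_mod_cast hm
      exact one_div_lt_one_div_of_lt (by positivity)
        (Real.rpow_lt_rpow hm'.le (by exact_mod_cast hmn) hk))
    hX.isLimit.monotone_range
    (fun m n hmn => by
      simp only [hr]
      exact Nat.pow_lt_pow_left (hq.strictMono hmn) two_ne_zero)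
    hX'.isLimit.monotone_range
    ((range_eq_bot_of_equiv hX'.zero (ι' 0)).trans (range_eq_bot_of_equiv hX.zero (ι 0)).symm)
    (fun n => by rw [hr, hI.weight_eq]) (fun n => by rw [hr'])
    (fun a => (hX.lip a).symm.trans (hX'.lip a))
  have hd (n) : I'.dim n = q (σ n) ^ 2 := by
    rw [← hr', ← hr]
    exact congrArg (fun T : StarSubalgebra ℂ X.carrier => Module.finrank ℂ T) (hσ n)
  refine ⟨q, σ, I, ι, μ, ⟨hq, h0, hstep, fun n => ?_, fun n => ?_⟩, hI, hX⟩
  · rw [← hd]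
    exact (hB n).1
  · rw [← hd]
    exact (hB n).2

/-- Admissible pairs are closed under pointwise limits. -/
theorem IsAdmissible.of_eventually {ℓ : Filter ℕ} [ℓ.NeBot] {p : ℕ → ℕ → ℕ × ℕ} {r : ℕ → ℕ × ℕ}
    (hp : ∀ i, IsAdmissible B (fun n => (p i n).1) fun n => (p i n).2)
    (h : ∀ n, ∀ᶠ i in ℓ, p i n = r n) :
    IsAdmissible B (fun n => (r n).1) fun n => (r n).2 := by
  -- The bounds involve the size at the index given by the second component, which is eventually
  -- constant too.
  have hsize : ∀ n, ∀ᶠ i in ℓ, p i (r n).2 = r (r n).2 := fun n => h _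
  refine ⟨⟨?_, fun n => ?_, fun n => ?_⟩, ?_, fun n => ?_, fun n => ?_, fun n => ?_⟩
  · obtain ⟨i, hi⟩ := (h 0).exists
    exact hi ▸ (hp i).size.zero
  · obtain ⟨i, hi, hi'⟩ := ((h n).and (h (n + 1))).exists
    exact hi ▸ hi' ▸ (hp i).size.dvd n
  · obtain ⟨i, hi, hi'⟩ := ((h n).and (h (n + 1))).exists
    exact hi ▸ hi' ▸ (hp i).size.lt n
  · obtain ⟨i, hi⟩ := (h 0).exists
    exact hi ▸ (hp i).zero
  · obtain ⟨i, hi, hi'⟩ := ((h n).and (h (n + 1))).exists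
    exact hi ▸ hi' ▸ (hp i).step n
  · obtain ⟨i, hi, hi'⟩ := ((h n).and (hsize n)).exists
    have := (hp i).lower n
    simp only [hi, hi'] at this
    exact this
  · obtain ⟨i, hi, hi'⟩ := ((h n).and (hsize n)).exists
    have := (hp i).upper n
    simp only [hi, hi'] at this
    exact this

theorem isCompact_inter (hk : 0 < k) (B : ℕ → ℕ) :
    IsCompact (UHFk k ∩ AFkBounded k (fun n => 2 ^ n) B) := by
  refine IsSeqCompact.isCompact fun X hX => ?_
  choose q σ I ι μ ha hI hAF using fun i => exists_isAdmissible hk (hX i)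
  -- The pairs lie in a product of finite sets, compact by Tychonoff and metrizable; in discrete
  -- factors convergence is eventual equality.
  obtain ⟨r, -, φ, hφ, hr⟩ :=
    (isCompact_univ_pi fun n => (Set.toFinite (Set.Iic (sizeBound B n, n))).isCompact).isSeqCompact
      (x := fun i n => (q i n, σ i n))
      (fun i n _ => ⟨(ha i).le_sizeBound n, (ha i).le_self n⟩)
  have hev (n) : ∀ᶠ i in atTop, (q (φ i) n, σ (φ i) n) = r n := by
    have := tendsto_pi_nhds.mp hr n
    rw [nhds_discrete, tendsto_pure] at this
    exact this
  have har := IsAdmissible.of_eventually (p := fun i n => (q (φ i) n, σ (φ i) n))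
    (fun i => ha (φ i)) hev
  obtain ⟨Y, J, κ, ν, hJ, hY⟩ := exists_isAFSpace_of_sizes hk har.size
  refine ⟨Y, hY.mem_inter hk hJ har, φ, hφ, ?_⟩
  rw [EMetric.tendsto_atTop]
  intro ε hε
  have h2 : Tendsto (fun n => ENNReal.ofReal (1 / (J.dim n : ℝ) ^ k) +
      ENNReal.ofReal (1 / (J.dim n : ℝ) ^ k)) atTop (𝓝 0) := by
    have h3 : Tendsto (fun n => 1 / (J.dim n : ℝ) ^ k) atTop (𝓝 0) := by
      simp only [hJ.weight_eq]
      exact har.size.tendsto_weight hk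
    simpa using (ENNReal.tendsto_ofReal h3).add (ENNReal.tendsto_ofReal h3)
  obtain ⟨N, hN⟩ := (h2.eventually (gt_mem_nhds hε)).exists
  have hall : ∀ᶠ i in atTop, ∀ n ∈ Finset.range (N + 1), (q (φ i) n, σ (φ i) n) = r n :=
    (Finset.eventually_all _).mpr fun n _ => hev n
  obtain ⟨M, hM⟩ := eventually_atTop.mp hall
  refine ⟨M, fun i hi => ?_⟩
  have hq (n) (hn : n ≤ N) : (r n).1 = q (φ i) n :=
    (congrArg Prod.fst (hM i hi n (Finset.mem_range_succ_iff.mpr hn))).symm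
  change edist (X (φ i)) Y < ε
  rw [edist_comm]
  -- Only the sizes up to `N` enter the distance estimate; `σ` served to place the limit in the
  -- class.
  refine (propinquity_le_of_agree hY (hAF (φ i)) (fun n => ?_) (fun n => ?_) har.size.pos
    (fun n _ => hJ n) (fun n hn => ?_) fun n hn => ?_).trans_lt hN
  · rw [hJ.weight_eq]
    exact har.size.weight_pos n
  · rw [(hI (φ i)).weight_eq]
    exact (ha (φ i)).size.weight_pos n
  · rw [hq n hn]
    exact hI (φ i) n
  · rw [hJ.weight_eq, (hI (φ i)).weight_eq, hq n hn]

end Admissible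

end QuantumMetric

end

theorem mainTheorem7 (k : ℝ) (hk : 0 < k) (B : ℕ → ℕ) (hB_pos : ∀ n, 0 < B n)
    (hB : ∀ n, ∃ m : ℕ, 2 ≤ m ∧ √((B (n + 1) : ℝ) / B n) = m) :
    IsCompact (QuantumMetric.UHFk k ∩ QuantumMetric.AFkBounded k (fun n => 2 ^ n) B) :=
  QuantumMetric.isCompact_inter hk B
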